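/- Let $h,k\ge 0$ be integers and let $M$ be a smooth manifold of dimension $2h+2k+2$ (Hausdorff, second countable, without boundary). Let $(\alpha_1,\alpha_2)$ be a contact pair of type $(h,k)$ on $M$, i.e. smooth one-forms such that $\alpha_1\wedge(d\alpha_1)^h\wedge\alpha_2\wedge(d\alpha_2)^k$ is a volume form, $(d\alpha_1)^{h+1}=0$ and $(d\alpha_2)^{k+1}=0$. Let $Z_1,Z_2$ be its Reeb vector fields, determined by $\alpha_i(Z_j)=\delta_{ij}$ and $i_{Z_j}d\alpha_i=0$ for $i,j\in\{1,2\}$, and let $\phi$ be a smooth $(1,1)$-tensor field on $M$ with $\phi^2=-\mathrm{Id}+\alpha_1\otimes Z_1+\alpha_2\otimes Z_2$ and $\phi(Z_1)=\phi(Z_2)=0$; that is, $(\alpha_1,\alpha_2,\phi)$ is a contact pair structure. For $i=1,2$ let $\mathcal F_i$ be the characteristic foliation of $\alpha_i$, with tangent bundle $T\mathcal F_i=\ker\alpha_i\cap\ker d\alpha_i$, and suppose that $\phi$ is decomposable: $\phi(T\mathcal F_i)\subset T\mathcal F_i$ for $i=1,2$. For a field $A$ of endomorphisms of the tangent bundle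 write $[A,A](X,Y)=A^2[X,Y]+[AX,AY]-A[AX,Y]-A[X,AY]$. The structure $(\alpha_1,\alpha_2,\phi)$ is called normal if $[J,J]=0$ and $[T,T]=0$, where $J=\phi-\alpha_2\otimes Z_1+\alpha_1\otimes Z_2$ and $T=\phi+\alpha_2\otimes Z_1-\alpha_1\otimes Z_2$. An almost contact structure $(\alpha,Z,\phi)$ on a manifold $N$ (that is, $\alpha(Z)=1$, $\phi(Z)=0$, $\phi^2=-\mathrm{Id}+\alpha\otimes Z$) is called normal if the almost complex structure $\mathcal J(X+f\tfrac{d}{dt})=\phi X-fZ+\alpha(X)\tfrac{d}{dt}$ on $N\times\mathbb R$ is integrable, i.e. $[\mathcal J,\mathcal J]=0$. Then $(\alpha_1,\alpha_2,\phi)$ is normal if and only if both of the following hold: 1. on every leaf of $\mathcal F_2$ the almost contact structure induced by $(\alpha_1,Z_1,\phi)$ is normal, and on every leaf of $\mathcal F_1$ the almost contact structure induced by $(\alpha_2,Z_2,\phi)$ is normal; 2. $[\phi,\phi](X,Y)=0$ for all vector fields $X$ tangent to $\mathcal F_1$ and all vector fields $Y$ tangent to $\mathcal F_2$. -/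

import Mathlib

open Bundle Set VectorField
open scoped Manifold ContDiff

universe u

noncomputable section

namespace ContactPair

section Fields

variable {E : Type*} [NormedAddCommGroup E] [NormedSpace ℝ E]
  {H : Type*} [TopologicalSpace H] (I : ModelWithCorners ℝ E H)
  (M : Type*) [TopologicalSpace M] [ChartedSpace H M] [IsManifold I ∞ M]

/-- Smooth vector fields on `M`. -/
abbrev SmoothField : Type _ :=
  Cₛ^∞⟮I; E, (TangentSpace I : M → Type _)⟯

/-- Smooth tensor fields of type `(1,1)` on `M`, i.e. smooth fields of endomorphisms of `TM`. -/
abbrev EndoField : Type _ :=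
  Cₛ^∞⟮I; E →L[ℝ] E, fun p : M ↦ TangentSpace I p →L[ℝ] TangentSpace I p⟯

/-- Smooth one-forms on `M`. -/
structure OneForm where
  toFun : ∀ p : M, TangentSpace I p →L[ℝ] ℝ
  smooth : ContMDiff I (I.prod 𝓘(ℝ, E →L[ℝ] ℝ)) ∞
    (fun p ↦ TotalSpace.mk' (E →L[ℝ] ℝ)
      (E := fun x : M ↦ TangentSpace I x →L[ℝ] Bundle.Trivial M ℝ x) p (toFun p))

instance : CoeFun (OneForm I M) (fun _ ↦ ∀ p : M, TangentSpace I p →L[ℝ] ℝ) :=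
  ⟨OneForm.toFun⟩

end Fields

section ExteriorDerivative

variable {E : Type*} [NormedAddCommGroup E] [NormedSpace ℝ E]
  {H : Type*} [TopologicalSpace H] {I : ModelWithCorners ℝ E H}
  {M : Type*} [TopologicalSpace M] [ChartedSpace H M] [IsManifold I ∞ M]

lemma OneForm.mdifferentiableAt_apply (α : OneForm I M) {X : ∀ p : M, TangentSpace I p} {p : M}
    (hX : MDiffAt (T% X) p) : MDiffAt (fun q ↦ α q (X q)) p := by
  have h1 := (α.smooth p).mdifferentiableAt (by simp)
  have h2 := MDifferentiableAt.clm_bundle_apply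
    (E₁ := (TangentSpace I : M → Type _)) (E₂ := Bundle.Trivial M ℝ) h1 hX
  exact (mdifferentiableAt_section I _).1 h2

/-- The expression `X(α(Y)) - Y(α(X)) - α([X, Y])` at the point `p`. -/
def OneForm.extDerivAux (α : OneForm I M) (X Y : ∀ p : M, TangentSpace I p) (p : M) : ℝ :=
  mvfderiv I (fun q ↦ α q (Y q)) p (X p) - mvfderiv I (fun q ↦ α q (X q)) p (Y p)
    - α p (mlieBracket I X Y p)

lemma OneForm.extDerivAux_swap (α : OneForm I M) (X Y : ∀ p : M, TangentSpace I p) (p : M) :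
    α.extDerivAux X Y p = - α.extDerivAux Y X p := by
  rw [OneForm.extDerivAux, OneForm.extDerivAux, mlieBracket_swap]
  simp
  ring

variable [FiniteDimensional ℝ E]

lemma OneForm.extDerivAux_tensorial_left (α : OneForm I M) (p : M)
    (Y : ∀ p : M, TangentSpace I p) (_hY : MDiffAt (T% Y) p) :
    TensorialAt I E (fun X ↦ α.extDerivAux X Y p) p where
  smul {f X} hf hX := by
    have h2 : IsManifold I 2 M := inferInstance
    have hαX := α.mdifferentiableAt_apply hX
    have h := mvfderiv_fun_smul hf hαX
    simp only [smul_eq_mul] at h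
    simp [OneForm.extDerivAux, mlieBracket_smul_left hf hX, h]
    ring
  add {X X'} hX hX' := by
    have h2 : IsManifold I 2 M := inferInstance
    have h := mvfderiv_fun_add (α.mdifferentiableAt_apply hX) (α.mdifferentiableAt_apply hX')
    simp [OneForm.extDerivAux, mlieBracket_add_left hX hX', h]
    ring

lemma OneForm.extDerivAux_tensorial_right (α : OneForm I M) (p : M)
    (X : ∀ p : M, TangentSpace I p) (hX : MDiffAt (T% X) p) :
    TensorialAt I E (fun Y ↦ α.extDerivAux X Y p) p where
  smul {f Y} hf hY := by
    rw [α.extDerivAux_swap X, α.extDerivAux_swap X, (α.extDerivAux_tensorial_left p X hX).smul hf hY]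
    simp
  add {Y Y'} hY hY' := by
    rw [α.extDerivAux_swap X, α.extDerivAux_swap X, α.extDerivAux_swap X,
      (α.extDerivAux_tensorial_left p X hX).add hY hY']
    ring

/-- The exterior derivative `dα` of a smooth one-form, as the tensor with
`dα(X, Y) = X(α(Y)) - Y(α(X)) - α([X, Y])` for all vector fields `X`, `Y`. -/
def OneForm.d (α : OneForm I M) (p : M) : TangentSpace I p →L[ℝ] TangentSpace I p →L[ℝ] ℝ :=
  TensorialAt.mkHom₂ (fun X Y ↦ α.extDerivAux X Y p) p
    (α.extDerivAux_tensorial_left p) (α.extDerivAux_tensorial_right p)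

lemma OneForm.d_apply (α : OneForm I M) {X Y : ∀ p : M, TangentSpace I p} {p : M}
    (hX : MDiffAt (T% X) p) (hY : MDiffAt (T% Y) p) :
    α.d p (X p) (Y p) = mvfderiv I (fun q ↦ α q (Y q)) p (X p)
      - mvfderiv I (fun q ↦ α q (X q)) p (Y p) - α p (mlieBracket I X Y p) :=
  TensorialAt.mkHom₂_apply (α.extDerivAux_tensorial_left p) (α.extDerivAux_tensorial_right p) hX hY

lemma OneForm.d_self (α : OneForm I M) (p : M) (v : TangentSpace I p) : α.d p v v = 0 := by
  have h : α.d p v v =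
      α.extDerivAux (FiberBundle.extend E v) (FiberBundle.extend E v) p := rfl
  have h' := α.extDerivAux_swap (FiberBundle.extend E v) (FiberBundle.extend E v) p
  linarith

end ExteriorDerivative

section Wedge

variable {V : Type*} [AddCommGroup V] [Module ℝ V]

/-- The exterior product of real-valued alternating forms on a vector space
(signed sum over shuffles). -/
def wedge {m n : ℕ} (a : V [⋀^Fin m]→ₗ[ℝ] ℝ) (b : V [⋀^Fin n]→ₗ[ℝ] ℝ) :
    V [⋀^Fin (m + n)]→ₗ[ℝ] ℝ :=
  ((LinearMap.mul' ℝ ℝ).compAlternatingMap (a.domCoprod b)).domDomCongr finSumFinEquiv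

/-- The `n`-th exterior power `η ∧ ⋯ ∧ η` of a two-form, with `η ^ 0 = 1`. -/
def wedgePow (η : V [⋀^Fin 2]→ₗ[ℝ] ℝ) : (n : ℕ) → V [⋀^Fin (2 * n)]→ₗ[ℝ] ℝ
  | 0 => (AlternatingMap.constOfIsEmpty ℝ V (Fin 0) 1 : V [⋀^Fin 0]→ₗ[ℝ] ℝ)
  | n + 1 => wedge (wedgePow η n) η

end Wedge

section Structures

variable {E : Type*} [NormedAddCommGroup E] [NormedSpace ℝ E]
  {H : Type*} [TopologicalSpace H] {I : ModelWithCorners ℝ E H}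
  {M : Type*} [TopologicalSpace M] [ChartedSpace H M]

variable (I) in
/-- The Nijenhuis expression
`[A, A](X, Y) = A²[X, Y] + [AX, AY] - A[AX, Y] - A[X, AY]` of a field of endomorphisms `A`
at the point `p`. -/
def nijenhuis (A : ∀ p : M, TangentSpace I p →L[ℝ] TangentSpace I p)
    (X Y : ∀ p : M, TangentSpace I p) (p : M) : TangentSpace I p :=
  A p (A p (mlieBracket I X Y p))
    + mlieBracket I (fun q ↦ A q (X q)) (fun q ↦ A q (Y q)) p
    - A p (mlieBracket I (fun q ↦ A q (X q)) Y p)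
    - A p (mlieBracket I X (fun q ↦ A q (Y q)) p)

variable [IsManifold I ∞ M]

variable (I) in
/-- The Nijenhuis tensor of `A` vanishes identically. -/
def NijenhuisVanishes (A : ∀ p : M, TangentSpace I p →L[ℝ] TangentSpace I p) : Prop :=
  ∀ (X Y : SmoothField I M) (p : M), nijenhuis I A X Y p = 0

variable (I M) in
/-- An almost contact structure `(α, Z, φ)` on a manifold. -/
structure AlmostContactStructure where
  α : OneForm I M
  Z : SmoothField I M
  φ : EndoField I M
  α_Z : ∀ p, α p (Z p) = 1
  φ_Z : ∀ p, φ p (Z p) = 0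
  φ_sq : ∀ p (v : TangentSpace I p), φ p (φ p v) = -v + α p v • Z p

/-- The almost complex structure `J(X + f d/dt) = φ X - f Z + α(X) d/dt` on `M × ℝ` attached to an
almost contact structure. The tangent space of `M × ℝ` at `(p, t)` is `T_p M × ℝ`. -/
def AlmostContactStructure.J (S : AlmostContactStructure I M) (q : M × ℝ) :
    TangentSpace (I.prod 𝓘(ℝ, ℝ)) q →L[ℝ] TangentSpace (I.prod 𝓘(ℝ, ℝ)) q :=
  let pr₁ : TangentSpace (I.prod 𝓘(ℝ, ℝ)) q →L[ℝ] TangentSpace I q.1 := ContinuousLinearMap.fst ℝ E ℝ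
  let pr₂ : TangentSpace (I.prod 𝓘(ℝ, ℝ)) q →L[ℝ] ℝ := ContinuousLinearMap.snd ℝ E ℝ
  ((S.φ q.1).comp pr₁ - pr₂.smulRight (S.Z q.1)).prod ((S.α q.1).comp pr₁)

/-- An almost contact structure is normal if the almost complex structure `J` on `M × ℝ` is
integrable, i.e. its Nijenhuis tensor vanishes identically. -/
def AlmostContactStructure.IsNormal (S : AlmostContactStructure I M) : Prop :=
  NijenhuisVanishes (I.prod 𝓘(ℝ, ℝ)) S.J

variable [FiniteDimensional ℝ E]

/-- The one-form `α` at the point `p`, as an alternating form. -/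
def OneForm.alt (α : OneForm I M) (p : M) : TangentSpace I p [⋀^Fin 1]→ₗ[ℝ] ℝ :=
  AlternatingMap.ofSubsingleton ℝ (TangentSpace I p) ℝ 0 (α p).toLinearMap

/-- The two-form `dα` at the point `p`, as an alternating form. -/
def OneForm.dAlt (α : OneForm I M) (p : M) : TangentSpace I p [⋀^Fin 2]→ₗ[ℝ] ℝ where
  toFun v := α.d p (v 0) (v 1)
  map_update_add' v i x y := by fin_cases i <;> simp
  map_update_smul' v i c x := by fin_cases i <;> simp
  map_eq_zero_of_eq' v i j h hij := by
    fin_cases i <;> fin_cases j <;> simp_all [OneForm.d_self]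

/-- `(α₁, α₂)` is a contact pair of type `(h, k)` on the manifold `M` of dimension `2h + 2k + 2`:
`α₁ ∧ (dα₁)^h ∧ α₂ ∧ (dα₂)^k` is a volume form, `(dα₁)^(h+1) = 0` and `(dα₂)^(k+1) = 0`. -/
structure IsContactPair (h k : ℕ) (α₁ α₂ : OneForm I M) : Prop where
  finrank_eq : Module.finrank ℝ E = 2 * h + 2 * k + 2
  volume_form : ∀ p, wedge (wedge (wedge (α₁.alt p) (wedgePow (α₁.dAlt p) h)) (α₂.alt p))
    (wedgePow (α₂.dAlt p) k) ≠ 0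
  d_pow₁ : ∀ p, wedgePow (α₁.dAlt p) (h + 1) = 0
  d_pow₂ : ∀ p, wedgePow (α₂.dAlt p) (k + 1) = 0

/-- `Z₁`, `Z₂` are the Reeb vector fields of `(α₁, α₂)`: the equations below determine them
uniquely when `(α₁, α₂)` is a contact pair. -/
structure IsReebPair (α₁ α₂ : OneForm I M) (Z₁ Z₂ : SmoothField I M) : Prop where
  α₁_Z₁ : ∀ p, α₁ p (Z₁ p) = 1
  α₂_Z₂ : ∀ p, α₂ p (Z₂ p) = 1
  α₁_Z₂ : ∀ p, α₁ p (Z₂ p) = 0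
  α₂_Z₁ : ∀ p, α₂ p (Z₁ p) = 0
  dα₁_Z₁ : ∀ p v, α₁.d p (Z₁ p) v = 0
  dα₂_Z₁ : ∀ p v, α₂.d p (Z₁ p) v = 0
  dα₁_Z₂ : ∀ p v, α₁.d p (Z₂ p) v = 0
  dα₂_Z₂ : ∀ p v, α₂.d p (Z₂ p) v = 0

/-- `(α₁, α₂, φ)` is a contact pair structure of type `(h, k)`, with Reeb vector fields
`Z₁`, `Z₂`. -/
structure IsContactPairStructure (h k : ℕ) (α₁ α₂ : OneForm I M) (Z₁ Z₂ : SmoothField I M)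
    (φ : EndoField I M) : Prop where
  contactPair : IsContactPair h k α₁ α₂
  reeb : IsReebPair α₁ α₂ Z₁ Z₂
  φ_sq : ∀ p (v : TangentSpace I p), φ p (φ p v) = -v + α₁ p v • Z₁ p + α₂ p v • Z₂ p
  φ_Z₁ : ∀ p, φ p (Z₁ p) = 0
  φ_Z₂ : ∀ p, φ p (Z₂ p) = 0

/-- The almost complex structure `J = φ - α₂ ⊗ Z₁ + α₁ ⊗ Z₂`. -/
def assocJ (α₁ α₂ : OneForm I M) (Z₁ Z₂ : SmoothField I M) (φ : EndoField I M) (p : M) :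
    TangentSpace I p →L[ℝ] TangentSpace I p :=
  φ p - (α₂ p).smulRight (Z₁ p) + (α₁ p).smulRight (Z₂ p)

/-- The almost complex structure `T = φ + α₂ ⊗ Z₁ - α₁ ⊗ Z₂`. -/
def assocT (α₁ α₂ : OneForm I M) (Z₁ Z₂ : SmoothField I M) (φ : EndoField I M) (p : M) :
    TangentSpace I p →L[ℝ] TangentSpace I p :=
  φ p + (α₂ p).smulRight (Z₁ p) - (α₁ p).smulRight (Z₂ p)

/-- A contact pair structure is normal if the Nijenhuis tensors of `J` and `T` vanish. -/
def IsNormalContactPair (α₁ α₂ : OneForm I M) (Z₁ Z₂ : SmoothField I M) (φ : EndoField I M) :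
    Prop :=
  NijenhuisVanishes I (assocJ α₁ α₂ Z₁ Z₂ φ) ∧ NijenhuisVanishes I (assocT α₁ α₂ Z₁ Z₂ φ)

/-- The distribution `ker α ∩ ker dα`, tangent to the characteristic foliation of `α`. -/
def charDist (α : OneForm I M) (p : M) : Submodule ℝ (TangentSpace I p) :=
  (α p).toLinearMap.ker ⊓ (α.d p).toLinearMap.ker

/-- `φ` is decomposable: it preserves the tangent distributions of both characteristic
foliations. -/
def IsDecomposable (α₁ α₂ : OneForm I M) (φ : EndoField I M) : Prop :=
  (∀ p, ∀ v ∈ charDist α₁ p, φ p v ∈ charDist α₁ p) ∧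
  (∀ p, ∀ v ∈ charDist α₂ p, φ p v ∈ charDist α₂ p)

end Structures

section Leaves

variable {E : Type*} [NormedAddCommGroup E] [NormedSpace ℝ E]
  {H : Type*} [TopologicalSpace H] {I : ModelWithCorners ℝ E H}
  {M : Type u} [TopologicalSpace M] [ChartedSpace H M]

/-- `ι : L → M` is an (injectively immersed) `r`-dimensional integral manifold of the
distribution `D`. -/
structure IsIntegralManifold (D : ∀ p : M, Submodule ℝ (TangentSpace I p)) (r : ℕ)
    {L : Type u} [TopologicalSpace L] [ChartedSpace (EuclideanSpace ℝ (Fin r)) L]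
    (ι : L → M) : Prop where
  smooth : ContMDiff (𝓡 r) I ∞ ι
  injective : Function.Injective ι
  immersion : ∀ x, Function.Injective (mfderiv (𝓡 r) I ι x)
  tangent : ∀ x, (mfderiv (𝓡 r) I ι x).toLinearMap.range = D (ι x)

/-- `ι : L → M` is a leaf of the distribution `D` of rank `r`: a maximal connected
integral manifold. -/
structure IsLeaf (D : ∀ p : M, Submodule ℝ (TangentSpace I p)) (r : ℕ)
    {L : Type u} [TopologicalSpace L] [ChartedSpace (EuclideanSpace ℝ (Fin r)) L]
    (ι : L → M) : Prop where
  connected : ConnectedSpace L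
  integral : IsIntegralManifold D r ι
  maximal : ∀ (L' : Type u) [TopologicalSpace L'] [ChartedSpace (EuclideanSpace ℝ (Fin r)) L']
    [IsManifold (𝓡 r) ∞ L'] [ConnectedSpace L'] (ι' : L' → M), IsIntegralManifold D r ι' →
    range ι ⊆ range ι' → range ι' ⊆ range ι

variable [IsManifold I ∞ M]

/-- The almost contact structure `S` on `L` is induced by `(α, Z, φ)` through the immersion
`ι : L → M`: it consists of the pullback of `α` and the restrictions of `Z` and `φ`. -/
structure IsInduced (α : OneForm I M) (Z : SmoothField I M) (φ : EndoField I M) {r : ℕ}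
    {L : Type u} [TopologicalSpace L] [ChartedSpace (EuclideanSpace ℝ (Fin r)) L]
    [IsManifold (𝓡 r) ∞ L] (ι : L → M) (S : AlmostContactStructure (𝓡 r) L) : Prop where
  α_eq : ∀ x v, S.α x v = α (ι x) (mfderiv (𝓡 r) I ι x v)
  Z_eq : ∀ x, mfderiv (𝓡 r) I ι x (S.Z x) = Z (ι x)
  φ_eq : ∀ x v, mfderiv (𝓡 r) I ι x (S.φ x v) = φ (ι x) (mfderiv (𝓡 r) I ι x v)

/-- On every leaf of the rank `r` distribution `D`, the triple `(α, Z, φ)` induces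
a normal almost contact structure. -/
def InducesNormalOnLeaves (D : ∀ p : M, Submodule ℝ (TangentSpace I p)) (r : ℕ)
    (α : OneForm I M) (Z : SmoothField I M) (φ : EndoField I M) : Prop :=
  ∀ (L : Type u) [TopologicalSpace L] [ChartedSpace (EuclideanSpace ℝ (Fin r)) L]
    [IsManifold (𝓡 r) ∞ L] (ι : L → M), IsLeaf D r ι →
    ∃ S : AlmostContactStructure (𝓡 r) L, IsInduced α Z φ ι S ∧ S.IsNormal

end Leaves

end ContactPair

end

set_option linter.unusedSectionVars false

namespace ContactPair

open Filter
open scoped Topology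

section WedgeAlgebra

variable {V : Type*} [AddCommGroup V] [Module ℝ V]

lemma wedge_eq_zero_of_mem {m n : ℕ} {a : V [⋀^Fin m]→ₗ[ℝ] ℝ} {b : V [⋀^Fin n]→ₗ[ℝ] ℝ} {v : V}
    (ha : ∀ w, (∃ i, w i = v) → a w = 0) (hb : ∀ w, (∃ i, w i = v) → b w = 0) :
    ∀ w, (∃ i, w i = v) → wedge a b w = 0 := by
  rintro w ⟨i, hi⟩
  simp only [wedge, AlternatingMap.domDomCongr_apply, LinearMap.compAlternatingMap_apply]
  rw [AlternatingMap.domCoprod_apply, sum_apply, map_sum]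
  refine Finset.sum_eq_zero fun σ _ ↦ ?_
  induction σ using Quotient.inductionOn' with | _ σ
  rw [AlternatingMap.domCoprod.summand_mk'']
  simp only [smul_apply, MultilinearMap.domDomCongr_apply,
    MultilinearMap.domCoprod_apply, AlternatingMap.coe_multilinearMap]
  rcases hj : σ⁻¹ (finSumFinEquiv.symm i) with j | j
  · rw [Equiv.Perm.inv_eq_iff_eq] at hj
    rw [ha _ ⟨j, by simp [← hj, hi]⟩]
    simp
  · rw [Equiv.Perm.inv_eq_iff_eq] at hj
    rw [hb _ ⟨j, by simp [← hj, hi]⟩]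
    simp

lemma wedgePow_eq_zero_of_mem {η : V [⋀^Fin 2]→ₗ[ℝ] ℝ} {v : V}
    (h : ∀ w, (∃ i, w i = v) → η w = 0) (n : ℕ) :
    ∀ w, (∃ i, w i = v) → wedgePow η n w = 0 := by
  induction n with
  | zero => rintro w ⟨i, -⟩; exact i.elim0
  | succ n ih => exact wedge_eq_zero_of_mem ih h

lemma alternatization_domDomCongr {ι κ : Type*} [Fintype ι] [DecidableEq ι] [Fintype κ]
    [DecidableEq κ] (e : ι ≃ κ) (m : MultilinearMap ℝ (fun _ : ι ↦ V) ℝ) :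
    MultilinearMap.alternatization (m.domDomCongr e)
      = (MultilinearMap.alternatization m).domDomCongr e := by
  ext v
  simp only [MultilinearMap.alternatization_apply, AlternatingMap.domDomCongr_apply,
    MultilinearMap.domDomCongr_apply]
  refine Fintype.sum_equiv (e.permCongr.symm) _ _ fun σ ↦ ?_
  have h : Equiv.Perm.sign (e.permCongr.symm σ) = Equiv.Perm.sign σ :=
    Equiv.Perm.sign_permCongr e.symm σ
  rw [h]
  congr 2
  ext i
  simp [Equiv.permCongr_symm]

/-- The exterior power of a two-form, up to a factor, as an alternating sum of products. -/
lemma exists_smul_wedgePow_eq_alternatization (η : V [⋀^Fin 2]→ₗ[ℝ] ℝ) (n : ℕ) :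
    ∃ (e : Fin n × Fin 2 ≃ Fin (2 * n)) (m : MultilinearMap ℝ (fun _ : Fin (2 * n) ↦ V) ℝ),
      (∀ v, m v = ∏ i, η fun j ↦ v (e (i, j))) ∧
        (2 ^ n : ℕ) • wedgePow η n = MultilinearMap.alternatization m := by
  induction n with
  | zero =>
    have : IsEmpty (Fin (2 * 0)) := inferInstanceAs (IsEmpty (Fin 0))
    refine ⟨Equiv.equivOfIsEmpty _ _,
      (AlternatingMap.constOfIsEmpty ℝ V (Fin 0) 1 : V [⋀^Fin 0]→ₗ[ℝ] ℝ), fun v ↦ by simp, ?_⟩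
    rw [AlternatingMap.coe_alternatization]
    simp [wedgePow]
  | succ n ih =>
    obtain ⟨e, m, hm, hn⟩ := ih
    let e' : Fin (n + 1) × Fin 2 ≃ Fin (2 * n + 2) :=
      ((Equiv.prodCongr finSumFinEquiv.symm (Equiv.refl _)).trans
        ((Equiv.sumProdDistrib (Fin n) (Fin 1) (Fin 2)).trans
          (Equiv.sumCongr e (Equiv.uniqueProd (Fin 2) (Fin 1))))).trans finSumFinEquiv
    refine ⟨e', ((LinearMap.mul' ℝ ℝ).compMultilinearMap
      (m.domCoprod (η : MultilinearMap ℝ (fun _ : Fin 2 ↦ V) ℝ))).domDomCongr finSumFinEquiv,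
      fun v ↦ ?_, ?_⟩
    · rw [Fin.prod_univ_castSucc]
      simp only [MultilinearMap.domDomCongr_apply, LinearMap.compMultilinearMap_apply,
        MultilinearMap.domCoprod_apply, LinearMap.mul'_apply, hm]
      have h1 : ∀ (i : Fin n) (j : Fin 2), e' (i.castSucc, j) = finSumFinEquiv (Sum.inl (e (i, j))) :=
        fun i j ↦ by
          have : (finSumFinEquiv.symm i.castSucc : Fin n ⊕ Fin 1) = Sum.inl i :=
            finSumFinEquiv.symm_apply_eq.2 rfl
          simp [e', this]
      have h2 : ∀ j : Fin 2, e' (Fin.last n, j) = finSumFinEquiv (Sum.inr j) := fun j ↦ by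
        have : (finSumFinEquiv.symm (Fin.last n) : Fin n ⊕ Fin 1) = Sum.inr 0 :=
          finSumFinEquiv.symm_apply_eq.2 rfl
        simp [e', this]
      simp only [h1, h2]
      rfl
    · rw [alternatization_domDomCongr, LinearMap.compMultilinearMap_alternatization,
        MultilinearMap.domCoprod_alternization, ← hn, AlternatingMap.coe_alternatization]
      have h : (2 ^ n • wedgePow η n).domCoprod ((Fintype.card (Fin 2)).factorial • η)
          = (2 ^ (n + 1)) • (wedgePow η n).domCoprod η := by
        rw [← AlternatingMap.domCoprod'_apply, ← AlternatingMap.domCoprod'_apply,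
          ← TensorProduct.smul_tmul', TensorProduct.tmul_smul, smul_smul, map_nsmul]
        simp [pow_succ]
      rw [h]
      ext v
      simp [wedgePow, wedge]

/-- A family of pairs of vectors that is symplectic for `η`. -/
structure IsSymplecticFamily (η : V →ₗ[ℝ] V →ₗ[ℝ] ℝ) {n : ℕ} (u : Fin n × Fin 2 → V) : Prop where
  one : ∀ i, η (u (i, 0)) (u (i, 1)) = 1
  zero : ∀ a b, a.1 ≠ b.1 → η (u a) (u b) = 0

lemma sign_mul_prod_nonneg {η : V →ₗ[ℝ] V →ₗ[ℝ] ℝ} (hη : η.IsAlt) {n : ℕ} {u : Fin n × Fin 2 → V}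
    (hu : IsSymplecticFamily η u) (τ : Equiv.Perm (Fin n × Fin 2)) :
    0 ≤ ((Equiv.Perm.sign τ : ℤ) : ℝ) * ∏ i, η (u (τ (i, 0))) (u (τ (i, 1))) := by
  classical
  by_cases h : ∃ i, η (u (τ (i, 0))) (u (τ (i, 1))) = 0
  · obtain ⟨i, hi⟩ := h
    rw [Finset.prod_eq_zero (Finset.mem_univ i) hi, mul_zero]
  push Not at h
  have h1 : ∀ i, (τ (i, 0)).1 = (τ (i, 1)).1 := fun i ↦ by
    by_contra hne
    exact h i (hu.zero _ _ hne)
  have h2 : ∀ i, (τ (i, 0)).2 ≠ (τ (i, 1)).2 := fun i he ↦ by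
    have : τ (i, 0) = τ (i, 1) := Prod.ext (h1 i) he
    simpa using τ.injective this
  let κ : Fin n → Equiv.Perm (Fin 2) := fun i ↦ if (τ (i, 0)).2 = 0 then 1 else Equiv.swap 0 1
  have hκ0 : ∀ i, κ i 0 = (τ (i, 0)).2 := fun i ↦ by
    simp only [κ]; split_ifs with hi
    · simp [hi]
    · rw [Equiv.swap_apply_left]; omega
  have hκ1 : ∀ i, κ i 1 = (τ (i, 1)).2 := fun i ↦ by
    have := h2 i
    simp only [κ]; split_ifs with hi
    · rw [Equiv.Perm.one_apply]; omega
    · rw [Equiv.swap_apply_right]; omega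
  let ρ : Fin n → Fin n := fun i ↦ (τ (i, 0)).1
  have hτ : ∀ i j, τ (i, j) = (ρ i, κ i j) := fun i j ↦ by
    fin_cases j
    · exact Prod.ext rfl (hκ0 i).symm
    · exact Prod.ext (h1 i).symm (hκ1 i).symm
  have hρ : Function.Surjective ρ := fun k ↦ by
    obtain ⟨⟨i, j⟩, hij⟩ := τ.surjective (k, 0)
    exact ⟨i, by rw [hτ] at hij; exact congrArg Prod.fst hij⟩
  let ρ' : Equiv.Perm (Fin n) := Equiv.ofBijective ρ (Finite.surjective_iff_bijective.1 hρ)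
  have hfac : τ = Equiv.prodCongrLeft (fun _ : Fin 2 ↦ ρ') * Equiv.prodCongrRight κ := by
    ext x : 1
    obtain ⟨i, j⟩ := x
    rw [hτ]
    simp [ρ']
  have hs : Equiv.Perm.sign τ = ∏ i, Equiv.Perm.sign (κ i) := by
    rw [hfac, Equiv.Perm.sign_mul, Equiv.Perm.sign_prodCongrLeft, Equiv.Perm.sign_prodCongrRight]
    simp [Int.units_sq]
  have hval : ∀ i, η (u (τ (i, 0))) (u (τ (i, 1))) = ((Equiv.Perm.sign (κ i) : ℤ) : ℝ) := fun i ↦ by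
    rw [hτ, hτ]
    simp only [κ]
    split_ifs
    · simp [hu.one]
    · rw [Equiv.swap_apply_left, Equiv.swap_apply_right, ← hη.neg, hu.one,
        Equiv.Perm.sign_swap (by decide)]
      simp
  rw [Finset.prod_congr rfl fun i _ ↦ hval i, hs]
  push_cast
  rw [← Finset.prod_mul_distrib]
  exact Finset.prod_nonneg fun i _ ↦ mul_self_nonneg _

lemma wedgePow_ne_zero_of_isSymplecticFamily {η : V [⋀^Fin 2]→ₗ[ℝ] ℝ} {β : V →ₗ[ℝ] V →ₗ[ℝ] ℝ}
    (hβ : β.IsAlt) (h : ∀ v, η v = β (v 0) (v 1)) {n : ℕ} {u : Fin n × Fin 2 → V}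
    (hu : IsSymplecticFamily β u) : wedgePow η n ≠ 0 := by
  obtain ⟨e, m, hm, hn⟩ := exists_smul_wedgePow_eq_alternatization η n
  intro h0
  rw [h0, smul_zero] at hn
  have h1 := congrArg (fun a ↦ a (u ∘ e.symm)) hn
  simp only [AlternatingMap.zero_apply, MultilinearMap.alternatization_apply,
    MultilinearMap.domDomCongr_apply, hm, h, Function.comp_apply] at h1
  have hterm : ∀ σ : Equiv.Perm (Fin (2 * n)), 0 ≤ Equiv.Perm.sign σ •
      ∏ i, β (u (e.symm (σ (e (i, 0))))) (u (e.symm (σ (e (i, 1))))) := fun σ ↦ by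
    have := sign_mul_prod_nonneg hβ hu (e.symm.permCongr σ)
    rw [Equiv.Perm.sign_permCongr] at this
    simpa [Units.smul_def] using this
  have h2 := (Finset.sum_eq_zero_iff_of_nonneg fun σ _ ↦ hterm σ).1 h1.symm 1 (Finset.mem_univ _)
  simp [hu.one] at h2

variable [FiniteDimensional ℝ V]

/-- If `η ^ (h + 1) = 0` then the kernel of the two-form `η` has codimension at most `2h`. -/
lemma finrank_le_finrank_ker_add {η : V [⋀^Fin 2]→ₗ[ℝ] ℝ} {β : V →ₗ[ℝ] V →ₗ[ℝ] ℝ}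
    (hβ : β.IsAlt) (hη : ∀ v, η v = β (v 0) (v 1)) {h : ℕ} (h0 : wedgePow η (h + 1) = 0) :
    Module.finrank ℝ V ≤ Module.finrank ℝ β.ker + 2 * h := by
  classical
  have hbd : ∀ n (u : Fin n × Fin 2 → V), IsSymplecticFamily β u → n ≤ h := fun n u hu ↦ by
    by_contra! hlt
    refine wedgePow_ne_zero_of_isSymplecticFamily hβ hη
      (u := fun x : Fin (h + 1) × Fin 2 ↦ u (Fin.castLE hlt x.1, x.2)) ⟨fun i ↦ hu.one _,
        fun a b hab ↦ hu.zero _ _ fun hc ↦ hab (by simpa using hc)⟩ h0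
  obtain ⟨n, ⟨u, hu⟩, hmax⟩ : ∃ n, (∃ u : Fin n × Fin 2 → V, IsSymplecticFamily β u) ∧
      ∀ n', (∃ u : Fin n' × Fin 2 → V, IsSymplecticFamily β u) → n' ≤ n := by
    let P : ℕ → Prop := fun n ↦ ∃ u : Fin n × Fin 2 → V, IsSymplecticFamily β u
    have hP0 : P 0 := ⟨fun x ↦ 0, ⟨fun i ↦ i.elim0, fun a ↦ a.1.elim0⟩⟩
    refine ⟨Nat.findGreatest P h, Nat.findGreatest_spec (P := P) (Nat.zero_le h) hP0,
      fun n' hn' ↦ ?_⟩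
    obtain ⟨u', hu'⟩ := hn'
    exact Nat.le_findGreatest (hbd n' u' hu') ⟨u', hu'⟩
  have hnh := hbd n u hu
  let Φ : V →ₗ[ℝ] (Fin n × Fin 2 → ℝ) := LinearMap.pi fun a ↦ β (u a)
  have hW : ∀ v ∈ Φ.ker, ∀ a, β (u a) v = 0 := fun v hv a ↦ by
    have := congrFun (LinearMap.mem_ker.1 hv) a
    simpa [Φ] using this
  have hker : Φ.ker ≤ β.ker := by
    intro w hw
    have hww : ∀ w' ∈ Φ.ker, β w w' = 0 := by
      intro w' hw'
      by_contra hne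
      have := hmax (n + 1) ⟨fun x ↦ Fin.lastCases (motive := fun _ ↦ V)
        (if x.2 = 0 then w else (β w w')⁻¹ • w') (fun i ↦ u (i, x.2)) x.1, ?_⟩
      · omega
      constructor
      · intro i
        induction i using Fin.lastCases with
        | last => simp [inv_mul_cancel₀ hne]
        | cast i => simp [hu.one]
      · rintro ⟨i, x⟩ ⟨j, y⟩ hij
        induction i using Fin.lastCases with
        | last =>
          induction j using Fin.lastCases with
          | last => exact absurd rfl hij
          | cast j =>
            simp only [Fin.lastCases_last, Fin.lastCases_castSucc]
            split_ifs
            · rw [← hβ.neg, hW w hw, neg_zero]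
            · rw [← hβ.neg, map_smul, hW w' hw', smul_zero, neg_zero]
        | cast i =>
          induction j using Fin.lastCases with
          | last =>
            simp only [Fin.lastCases_last, Fin.lastCases_castSucc]
            split_ifs
            · exact hW w hw _
            · rw [map_smul, hW w' hw', smul_zero]
          | cast j =>
            simp only [Fin.lastCases_castSucc]
            exact hu.zero _ _ fun hc ↦ hij (by simpa using hc)
    refine LinearMap.mem_ker.2 (LinearMap.ext fun v ↦ ?_)
    let v' : V := v - ∑ i, (β (u (i, 0)) v • u (i, 1) - β (u (i, 1)) v • u (i, 0))
    have hv' : v' ∈ Φ.ker := by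
      refine LinearMap.mem_ker.2 (funext fun a ↦ ?_)
      obtain ⟨i, x⟩ := a
      simp only [Φ, LinearMap.pi_apply, Pi.zero_apply, v', map_sub, map_sum, map_smul, smul_eq_mul]
      rw [Finset.sum_eq_single i]
      · fin_cases x
        · simp [hu.one, hβ.self_eq_zero]
        · have h1 : β (u (i, 1)) (u (i, 0)) = -1 := by rw [← hβ.neg, hu.one]
          simp [h1, hβ.self_eq_zero]
      · intro j _ hj
        rw [hu.zero (i, x) (j, 1) hj.symm, hu.zero (i, x) (j, 0) hj.symm]
        simp
      · simp
    have hv : v = v' + ∑ i, (β (u (i, 0)) v • u (i, 1) - β (u (i, 1)) v • u (i, 0)) := by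
      simp [v']
    have hwu : ∀ a, β w (u a) = 0 := fun a ↦ by rw [← hβ.neg, hW w hw, neg_zero]
    rw [hv, map_add, hww v' hv']
    simp [hwu]
  have h1 := Φ.finrank_range_add_finrank_ker
  have h2 : Module.finrank ℝ Φ.range ≤ 2 * n := by
    refine (Submodule.finrank_le _).trans ?_
    simp [mul_comm]
  have h3 := Submodule.finrank_mono hker
  omega

lemma alternatingMap_eq_zero_of_mem {N : ℕ} (hN : Module.finrank ℝ V = N)
    {a : V [⋀^Fin N]→ₗ[ℝ] ℝ} {v : V} (hv : v ≠ 0) (ha : ∀ w, (∃ i, w i = v) → a w = 0) :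
    a = 0 := by
  have hli : LinearIndepOn ℝ id ({v} : Set V) := LinearIndepOn.singleton (by simpa using hv)
  let b := Module.Basis.extend hli
  have hmem : v ∈ hli.extend (Set.subset_univ _) := hli.subset_extend _ rfl
  have := Module.Basis.finite_index_of_rank_lt_aleph0 b (Module.rank_lt_aleph0 ℝ V)
  have := Fintype.ofFinite (hli.extend (Set.subset_univ ({v} : Set V)))
  refine b.ext_alternating fun w hw ↦ ?_
  have hsurj : Function.Surjective w := ((Fintype.bijective_iff_injective_and_card w).2
    ⟨hw, by rw [Fintype.card_fin, ← hN, Module.finrank_eq_card_basis b]⟩).2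
  obtain ⟨i, hi⟩ := hsurj ⟨v, hmem⟩
  rw [ha _ ⟨i, by rw [hi]; simp [b]⟩, AlternatingMap.zero_apply]

end WedgeAlgebra

section Splitting

variable {E : Type*} [NormedAddCommGroup E] [NormedSpace ℝ E] [FiniteDimensional ℝ E]
  {H : Type*} [TopologicalSpace H] {I : ModelWithCorners ℝ E H}
  {M : Type*} [TopologicalSpace M] [ChartedSpace H M] [IsManifold I ∞ M]

instance finiteDimensional_tangentSpace (p : M) : FiniteDimensional ℝ (TangentSpace I p) :=
  inferInstanceAs (FiniteDimensional ℝ E)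

lemma mem_charDist {α : OneForm I M} {p : M} {v : TangentSpace I p} :
    v ∈ charDist α p ↔ α p v = 0 ∧ ∀ w, α.d p v w = 0 := by
  simp [charDist, ContinuousLinearMap.ext_iff]

lemma OneForm.d_swap (α : OneForm I M) (p : M) (v w : TangentSpace I p) :
    α.d p v w = - α.d p w v := by
  have h := α.d_self p (v + w)
  simp only [map_add, add_apply, α.d_self] at h
  linarith

lemma OneForm.alt_eq_zero {α : OneForm I M} {p : M} {v : TangentSpace I p}
    (hv : v ∈ charDist α p) : ∀ w, (∃ i, w i = v) → α.alt p w = 0 := by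
  rintro w ⟨i, rfl⟩
  rw [Subsingleton.elim i 0] at hv
  exact (mem_charDist.1 hv).1

lemma OneForm.dAlt_eq_zero {α : OneForm I M} {p : M} {v : TangentSpace I p}
    (hv : v ∈ charDist α p) : ∀ w, (∃ i, w i = v) → α.dAlt p w = 0 := by
  rintro w ⟨i, rfl⟩
  rw [mem_charDist] at hv
  change α.d p (w 0) (w 1) = 0
  fin_cases i
  · exact hv.2 _
  · rw [α.d_swap]; simpa using hv.2 _

lemma le_finrank_charDist (α : OneForm I M) (p : M) {h m : ℕ}
    (hE : Module.finrank ℝ E = 2 * h + m + 1) (h0 : wedgePow (α.dAlt p) (h + 1) = 0) :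
    m ≤ Module.finrank ℝ (charDist α p) := by
  let β : TangentSpace I p →ₗ[ℝ] TangentSpace I p →ₗ[ℝ] ℝ :=
    LinearMap.mk₂ ℝ (fun v w ↦ α.d p v w) (by simp) (by simp) (by simp) (by simp)
  have h1 := finrank_le_finrank_ker_add (η := α.dAlt p) (β := β) (fun v ↦ α.d_self p v)
    (fun v ↦ rfl) h0
  have hker : β.ker = (α.d p).toLinearMap.ker := by
    ext v
    simp [β, LinearMap.ext_iff, ContinuousLinearMap.ext_iff]
  have h2 := (α p).toLinearMap.finrank_range_add_finrank_ker
  have h3 : Module.finrank ℝ (α p).toLinearMap.range ≤ 1 := by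
    simpa using Submodule.finrank_le (α p).toLinearMap.range
  have h4 := Submodule.finrank_sup_add_finrank_inf_eq (α p).toLinearMap.ker
    (α.d p).toLinearMap.ker
  have h5 := Submodule.finrank_le ((α p).toLinearMap.ker ⊔ (α.d p).toLinearMap.ker)
  have h6 : Module.finrank ℝ (TangentSpace I p) = 2 * h + m + 1 := hE
  rw [hker] at h1
  change m ≤ Module.finrank ℝ ↥((α p).toLinearMap.ker ⊓ (α.d p).toLinearMap.ker)
  omega

variable {h k : ℕ} {α₁ α₂ : OneForm I M}

lemma IsContactPair.disjoint (hc : IsContactPair h k α₁ α₂) (p : M) :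
    Disjoint (charDist α₁ p) (charDist α₂ p) := by
  rw [Submodule.disjoint_def]
  intro v h1 h2
  by_contra hv
  have hE : Module.finrank ℝ (TangentSpace I p) = 2 * h + 2 * k + 2 := hc.finrank_eq
  refine hc.volume_form p (alternatingMap_eq_zero_of_mem (v := v) (by omega) hv ?_)
  exact wedge_eq_zero_of_mem (wedge_eq_zero_of_mem (wedge_eq_zero_of_mem (OneForm.alt_eq_zero h1)
    (wedgePow_eq_zero_of_mem (OneForm.dAlt_eq_zero h1) h)) (OneForm.alt_eq_zero h2))
    (wedgePow_eq_zero_of_mem (OneForm.dAlt_eq_zero h2) k)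

lemma IsContactPair.finrank_charDist (hc : IsContactPair h k α₁ α₂) (p : M) :
    Module.finrank ℝ (charDist α₁ p) = 2 * k + 1 ∧
      Module.finrank ℝ (charDist α₂ p) = 2 * h + 1 := by
  have h1 := le_finrank_charDist α₁ p (m := 2 * k + 1) (by rw [hc.finrank_eq]; omega)
    (hc.d_pow₁ p)
  have h2 := le_finrank_charDist α₂ p (m := 2 * h + 1) (by rw [hc.finrank_eq]; omega)
    (hc.d_pow₂ p)
  have h3 := Submodule.finrank_add_finrank_le_of_disjoint (hc.disjoint p)
  have h4 : Module.finrank ℝ (TangentSpace I p) = 2 * h + 2 * k + 2 := hc.finrank_eq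
  omega

lemma IsContactPair.isCompl (hc : IsContactPair h k α₁ α₂) (p : M) :
    IsCompl (charDist α₁ p) (charDist α₂ p) := by
  refine ⟨hc.disjoint p, codisjoint_iff.2 (Submodule.eq_top_of_finrank_eq ?_)⟩
  have h3 := Submodule.finrank_sup_add_finrank_inf_eq (charDist α₁ p) (charDist α₂ p)
  rw [(hc.disjoint p).eq_bot, finrank_bot, (hc.finrank_charDist p).1,
    (hc.finrank_charDist p).2] at h3
  have h4 : Module.finrank ℝ (TangentSpace I p) = 2 * h + 2 * k + 2 := hc.finrank_eq
  omega

end Splitting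

section Coordinates

variable {E : Type*} [NormedAddCommGroup E] [NormedSpace ℝ E]
  {H : Type*} [TopologicalSpace H] {I : ModelWithCorners ℝ E H}
  {M : Type*} [TopologicalSpace M] [ChartedSpace H M]
  {E' : Type*} [NormedAddCommGroup E'] [NormedSpace ℝ E']
  {H' : Type*} [TopologicalSpace H'] {I' : ModelWithCorners ℝ E' H'}
  {N : Type*} [TopologicalSpace N] [ChartedSpace H' N]
  {V : Type*} [NormedAddCommGroup V] [NormedSpace ℝ V]

lemma mvfderiv_apply_eq_mfderiv (F : M → V) (p : M) (v : TangentSpace I p) :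
    mvfderiv I F p v = mfderiv I 𝓘(ℝ, V) F p v := rfl

lemma mvfderiv_comp_apply' {F : M → V} {f : N → M} {x : N} (hF : MDiffAt F (f x))
    (hf : MDiffAt f x) (v : TangentSpace I' x) :
    mvfderiv I' (fun y ↦ F (f y)) x v = mvfderiv I F (f x) (mfderiv I' I f x v) :=
  mfderiv_comp_apply x hF hf v

lemma _root_.Filter.EventuallyEq.mvfderiv_eq {F G : M → V} {p : M} (h : F =ᶠ[𝓝 p] G)
    (v : TangentSpace I p) : mvfderiv I F p v = mvfderiv I G p v := by
  rw [mvfderiv_apply_eq_mfderiv, mvfderiv_apply_eq_mfderiv, h.mfderiv_eq]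
  rfl

lemma mvfderiv_eq_fderiv (F : E → V) (x : E) (v : TangentSpace 𝓘(ℝ, E) x) :
    mvfderiv 𝓘(ℝ, E) F x v = fderiv ℝ F x v := by
  rw [mvfderiv_apply_eq_mfderiv, mfderiv_eq_fderiv]
  rfl

variable [I.Boundaryless] [IsManifold I ∞ M]

lemma mdifferentiableAt_extChartAt_symm' {p : M} {e : E} (he : e ∈ (extChartAt I p).target) :
    MDiffAt (extChartAt I p).symm e :=
  ((contMDiffOn_extChartAt_symm (n := ∞) p).contMDiffAt
    (extChartAt_target_mem_nhds' he)).mdifferentiableAt (by simp)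

omit [I.Boundaryless] in
lemma mdifferentiableAt_extChartAt' {p q : M} (hq : q ∈ (chartAt H p).source) :
    MDiffAt (extChartAt I p) q :=
  (contMDiffAt_extChartAt' (n := ∞) hq).mdifferentiableAt (by simp)

lemma contDiffAt_comp_extChartAt_symm {n : ℕ∞ω} (hn : n ≤ ∞) {F : M → V} {p : M}
    (hF : CMDiffAt n F p) :
    ContDiffAt ℝ n (fun e ↦ F ((extChartAt I p).symm e)) (extChartAt I p p) := by
  rw [← contMDiffAt_iff_contDiffAt]
  have h1 : CMDiffAt n (extChartAt I p).symm (extChartAt I p p) :=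
    ((contMDiffOn_extChartAt_symm (n := ∞) p).contMDiffAt (extChartAt_target_mem_nhds p)).of_le hn
  exact ContMDiffAt.comp _ (by rwa [extChartAt_to_inv]) h1

lemma mvfderiv_eq_fderiv_extChartAt {F : M → V} {p q : M} (hq : q ∈ (chartAt H p).source)
    (hF : MDiffAt F q) (v : TangentSpace I q) :
    mvfderiv I F q v = fderiv ℝ (fun e ↦ F ((extChartAt I p).symm e)) (extChartAt I p q)
      (mvfderiv I (extChartAt I p) q v) := by
  have hq' : q ∈ (extChartAt I p).source := by rwa [extChartAt_source]
  have h1 : F =ᶠ[𝓝 q] fun q' ↦ (fun e ↦ F ((extChartAt I p).symm e)) (extChartAt I p q') := by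
    filter_upwards [extChartAt_source_mem_nhds' (I := I) hq'] with q' hq''
    rw [(extChartAt I p).left_inv hq'']
  rw [h1.mvfderiv_eq]
  have h2 : MDiffAt (fun e ↦ F ((extChartAt I p).symm e)) (extChartAt I p q) := by
    refine MDifferentiableAt.comp (I' := I) (g := F) _ ?_
      (mdifferentiableAt_extChartAt_symm' ((extChartAt I p).map_source hq'))
    rwa [(extChartAt I p).left_inv hq']
  exact (mvfderiv_comp_apply' h2 (mdifferentiableAt_extChartAt' hq) v).trans
    (mvfderiv_eq_fderiv _ _ _)

omit [I.Boundaryless] in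
lemma mvfderiv_extChartAt_injective {p q : M} (hq : q ∈ (chartAt H p).source) :
    Function.Injective (mvfderiv I (extChartAt I p) q) :=
  (isInvertible_mfderiv_extChartAt (I := I) (x := p) (y := q) (by rwa [extChartAt_source])).injective

omit [I.Boundaryless] in
lemma mvfderiv_extChartAt_surjective {p q : M} (hq : q ∈ (chartAt H p).source) :
    Function.Surjective (mvfderiv I (extChartAt I p) q) :=
  (isInvertible_mfderiv_extChartAt (I := I) (x := p) (y := q) (by rwa [extChartAt_source])).surjective

omit [I.Boundaryless] in
lemma eventually_trivializationAt_eq (X : ∀ p : M, TangentSpace I p) (p : M) :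
    (fun q ↦ (trivializationAt E (TangentSpace I) p ⟨q, X q⟩).2) =ᶠ[𝓝 p]
      fun q ↦ mvfderiv I (extChartAt I p) q (X q) := by
  filter_upwards [(chartAt H p).open_source.mem_nhds (mem_chart_source H p)] with q hq
  have h := congrArg (fun A ↦ A (X q)) (TangentBundle.continuousLinearMapAt_trivializationAt
    (I := I) hq)
  refine Eq.trans ?_ h
  rw [Trivialization.continuousLinearMapAt_apply, Trivialization.linearMapAt_apply, if_pos]
  exact hq

omit [I.Boundaryless] in
lemma contMDiffAt_vectorField_iff {n : ℕ∞ω} {X : ∀ p : M, TangentSpace I p} {p : M} :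
    CMDiffAt n (T% X) p ↔ CMDiffAt n (fun q ↦ mvfderiv I (extChartAt I p) q (X q)) p := by
  rw [contMDiffAt_section]
  exact (eventually_trivializationAt_eq X p).contMDiffAt_iff

omit [I.Boundaryless] in
lemma mdifferentiableAt_vectorField_iff {X : ∀ p : M, TangentSpace I p} {p : M} :
    MDiffAt (T% X) p ↔ MDiffAt (fun q ↦ mvfderiv I (extChartAt I p) q (X q)) p := by
  rw [mdifferentiableAt_section]
  exact (eventually_trivializationAt_eq X p).mdifferentiableAt_iff

/-- The derivative of a smooth map, read in a chart of the source. -/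
lemma exists_mvfderiv_eq {F : M → V} {p : M} (hF : CMDiffAt ∞ F p) :
    ∃ B : M → E →L[ℝ] V, CMDiffAt ∞ B p ∧ ∀ᶠ q in 𝓝 p, ∀ v : TangentSpace I q,
      mvfderiv I F q v = B q (mvfderiv I (extChartAt I p) q v) := by
  refine ⟨fun q ↦ fderiv ℝ (fun e ↦ F ((extChartAt I p).symm e)) (extChartAt I p q), ?_, ?_⟩
  · have h1 := (contDiffAt_comp_extChartAt_symm le_rfl hF).fderiv_right (m := ∞) (by simp)
    exact ContMDiffAt.comp p h1.contMDiffAt (contMDiffAt_extChartAt (I := I))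
  · have h1 : ∀ᶠ q in 𝓝 p, CMDiffAt 1 F q := (contMDiffAt_iff_contMDiffAt_nhds (by simp)).1 (hF.of_le (by simp))
    filter_upwards [h1, (chartAt H p).open_source.mem_nhds (mem_chart_source H p)] with q hq hq' v
    exact mvfderiv_eq_fderiv_extChartAt hq' (hq.mdifferentiableAt (by simp)) v

lemma _root_.ContMDiffAt.mvfderiv_vectorField {n : ℕ∞ω} (hn : n ≤ ∞) {F : M → V} {p : M}
    (hF : CMDiffAt ∞ F p) {X : ∀ p : M, TangentSpace I p} (hX : CMDiffAt n (T% X) p) :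
    CMDiffAt n (fun q ↦ mvfderiv I F q (X q)) p := by
  obtain ⟨B, hB, h⟩ := exists_mvfderiv_eq (I := I) hF
  exact ((hB.of_le hn).clm_apply (contMDiffAt_vectorField_iff.1 hX)).congr_of_eventuallyEq
    (h.mono fun q hq ↦ hq _)

lemma _root_.MDifferentiableAt.mvfderiv_vectorField {F : M → V} {p : M}
    (hF : CMDiffAt ∞ F p) {X : ∀ p : M, TangentSpace I p} (hX : MDiffAt (T% X) p) :
    MDiffAt (fun q ↦ mvfderiv I F q (X q)) p := by
  obtain ⟨B, hB, h⟩ := exists_mvfderiv_eq (I := I) hF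
  exact ((hB.mdifferentiableAt (by simp)).clm_apply
    (mdifferentiableAt_vectorField_iff.1 hX)).congr_of_eventuallyEq (h.mono fun q hq ↦ hq _)

variable [FiniteDimensional ℝ E]

/-- A vector field is smooth if its image under an immersion is smooth. -/
lemma contMDiffAt_of_mvfderiv_injective [FiniteDimensional ℝ V] {n : ℕ∞ω} (hn : n ≤ ∞) {F : M → V} {p : M}
    (hF : CMDiffAt ∞ F p) (hinj : Function.Injective (mvfderiv I F p))
    {X : ∀ p : M, TangentSpace I p} (hX : CMDiffAt n (fun q ↦ mvfderiv I F q (X q)) p) :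
    CMDiffAt n (T% X) p := by
  obtain ⟨B, hB, h⟩ := exists_mvfderiv_eq (I := I) hF
  have hBp : Function.Injective (B p) := by
    intro v w hvw
    obtain ⟨v, rfl⟩ := mvfderiv_extChartAt_surjective (I := I) (mem_chart_source H p) v
    obtain ⟨w, rfl⟩ := mvfderiv_extChartAt_surjective (I := I) (mem_chart_source H p) w
    rw [← h.self_of_nhds, ← h.self_of_nhds] at hvw
    rw [hinj hvw]
  obtain ⟨L, hL⟩ : ∃ L : V →L[ℝ] E, L.comp (B p) = ContinuousLinearMap.id ℝ E := by
    obtain ⟨L, hL⟩ := ContinuousLinearMap.HasLeftInverse.of_injective_of_finiteDimensional hBp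
    exact ⟨L, ContinuousLinearMap.ext hL⟩
  have hC : CMDiffAt ∞ (fun q ↦ L.comp (B q)) p :=
    contMDiffAt_const.clm_comp hB
  have hunit : ∀ᶠ q in 𝓝 p, IsUnit (L.comp (B q)) := by
    have h1 : IsUnit (L.comp (B p)) := by rw [hL]; exact isUnit_one
    exact hC.continuousAt.eventually (Units.isOpen.mem_nhds h1)
  have hinv : CMDiffAt ∞ (fun q ↦ Ring.inverse (L.comp (B q))) p := by
    have h1 : ContDiffAt ℝ ∞ (Ring.inverse : (E →L[ℝ] E) → E →L[ℝ] E) (L.comp (B p)) := by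
      rw [hL]; exact contDiffAt_ringInverse ℝ (1 : (E →L[ℝ] E)ˣ)
    exact ContMDiffAt.comp p h1.contMDiffAt hC
  rw [contMDiffAt_vectorField_iff]
  refine ((hinv.of_le hn).clm_apply ((contMDiffAt_const (c := L)).clm_apply hX)).congr_of_eventuallyEq ?_
  filter_upwards [h, hunit] with q hq hu
  rw [hq]
  exact (congrArg (fun A : E →L[ℝ] E ↦ A (mvfderiv I (extChartAt I p) q (X q)))
    (Ring.inverse_mul_cancel _ hu)).symm

/-- The derivation along `[X, Y]` is the commutator of the derivations along `X` and `Y`. -/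
lemma mvfderiv_mlieBracket {F : M → V} {p : M} (hF : CMDiffAt ∞ F p)
    {X Y : ∀ p : M, TangentSpace I p} (hX : MDiffAt (T% X) p) (hY : MDiffAt (T% Y) p) :
    mvfderiv I F p (mlieBracket I X Y p) = mvfderiv I (fun q ↦ mvfderiv I F q (Y q)) p (X p)
      - mvfderiv I (fun q ↦ mvfderiv I F q (X q)) p (Y p) := by
  set χ := extChartAt I p with hχ
  let G : E → V := fun e ↦ F (χ.symm e)
  let hat : (∀ p : M, TangentSpace I p) → E → E :=
    fun X ↦ mpullbackWithin 𝓘(ℝ, E) I χ.symm X (range I)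
  have hp : p ∈ (chartAt H p).source := mem_chart_source H p
  have hG : ContDiffAt ℝ ∞ G (χ p) := contDiffAt_comp_extChartAt_symm le_rfl hF
  have hdiff : ∀ {X : ∀ p : M, TangentSpace I p}, MDiffAt (T% X) p →
      DifferentiableAt ℝ (hat X) (χ p) := fun {X} hX ↦ by
    have h := MDifferentiableWithinAt.differentiableWithinAt_mpullbackWithin_vectorField
      (s := univ) (I := I) hX.mdifferentiableWithinAt
    rw [preimage_univ, univ_inter, I.range_eq_univ] at h
    rw [← differentiableWithinAt_univ]
    simpa only [hat, I.range_eq_univ] using h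
  have hbr : mvfderiv I χ p (mlieBracket I X Y p) = lieBracket ℝ (hat X) (hat Y) (χ p) := by
    have hinv : (mfderiv I 𝓘(ℝ, E) χ p).IsInvertible :=
      isInvertible_mfderiv_extChartAt (I := I) (x := p) (y := p) (mem_extChartAt_source p)
    have h := hinv.self_apply_inverse (lieBracketWithin ℝ (hat X) (hat Y)
      (χ.symm ⁻¹' univ ∩ range I) (χ p) : E)
    refine Eq.trans h ?_
    rw [I.range_eq_univ, preimage_univ, inter_univ, lieBracketWithin_univ]
  have hhat : ∀ X : ∀ p : M, TangentSpace I p, ∀ e ∈ χ.target,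
      mvfderiv I χ (χ.symm e) (X (χ.symm e)) = hat X e := by
    intro X e he
    refine Eq.symm (((isInvertible_mfderivWithin_extChartAt_symm (I := I) he).inverse_apply_eq).2 ?_)
    exact congrArg (fun A ↦ A (X (χ.symm e)))
      (mfderivWithin_extChartAt_symm_comp_mfderiv_extChartAt (I := I) he).symm
  have hFX : ∀ {X : ∀ p : M, TangentSpace I p}, 
      (fun e ↦ (fun q ↦ mvfderiv I F q (X q)) (χ.symm e)) =ᶠ[𝓝 (χ p)]
        fun e ↦ fderiv ℝ G e (hat X e) := fun {X} ↦ by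
    have h1 : ∀ᶠ q in 𝓝 p, CMDiffAt 1 F q :=
      (contMDiffAt_iff_contMDiffAt_nhds (by simp)).1 (hF.of_le (by simp))
    have h2 : Tendsto χ.symm (𝓝 (χ p)) (𝓝 p) := by
      have := continuousAt_extChartAt_symm (I := I) p
      rwa [ContinuousAt, extChartAt_to_inv] at this
    filter_upwards [h2.eventually h1, extChartAt_target_mem_nhds (I := I) p] with e he he'
    have := mvfderiv_eq_fderiv_extChartAt (I := I) (p := p) (q := χ.symm e)
      (by simpa [hχ] using χ.map_target he') (he.mdifferentiableAt (by simp)) (X (χ.symm e))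
    rw [← hχ, hhat X e he', χ.right_inv he'] at this
    exact this
  have hD : ∀ {X Y : ∀ p : M, TangentSpace I p}, MDiffAt (T% X) p →
      mvfderiv I (fun q ↦ mvfderiv I F q (X q)) p (Y p)
        = fderiv ℝ (fun e ↦ fderiv ℝ G e (hat X e)) (χ p) (hat Y (χ p)) := fun {X Y} hX ↦ by
    rw [mvfderiv_eq_fderiv_extChartAt hp (hX.mvfderiv_vectorField hF), ← hχ, hFX.fderiv_eq]
    congr 1
    have := hhat Y (χ p) (mem_extChartAt_target p)
    rw [extChartAt_to_inv] at this
    exact this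
  rw [mvfderiv_eq_fderiv_extChartAt hp (hF.mdifferentiableAt (by simp)), ← hχ, hbr, hD hY, hD hX]
  exact fderiv_apply_lieBracket hG (by simp; exact WithTop.coe_le_coe.2 le_top) (hdiff hY) (hdiff hX)

end Coordinates

section Fields

variable {E : Type*} [NormedAddCommGroup E] [NormedSpace ℝ E] [FiniteDimensional ℝ E]
  {H : Type*} [TopologicalSpace H] {I : ModelWithCorners ℝ E H}
  {M : Type*} [TopologicalSpace M] [ChartedSpace H M] [IsManifold I ∞ M]
  {E' : Type*} [NormedAddCommGroup E'] [NormedSpace ℝ E'] [FiniteDimensional ℝ E']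
  {H' : Type*} [TopologicalSpace H'] {I' : ModelWithCorners ℝ E' H'}
  {N : Type*} [TopologicalSpace N] [ChartedSpace H' N] [IsManifold I' ∞ N]
  {V : Type*} [NormedAddCommGroup V] [NormedSpace ℝ V]

/-- Lie brackets of related vector fields are related. -/
lemma mfderiv_mlieBracket_of_related [I.Boundaryless] [I'.Boundaryless] {f : N → M} {x : N}
    (hf : CMDiffAt ∞ f x)
    {X Y : ∀ x : N, TangentSpace I' x} (hX : MDiffAt (T% X) x) (hY : MDiffAt (T% Y) x)
    {X' Y' : ∀ p : M, TangentSpace I p} (hX' : MDiffAt (T% X') (f x)) (hY' : MDiffAt (T% Y') (f x))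
    (h₁ : ∀ᶠ y in 𝓝 x, mfderiv I' I f y (X y) = X' (f y))
    (h₂ : ∀ᶠ y in 𝓝 x, mfderiv I' I f y (Y y) = Y' (f y)) :
    mfderiv I' I f x (mlieBracket I' X Y x) = mlieBracket I X' Y' (f x) := by
  apply mvfderiv_extChartAt_injective (I := I) (mem_chart_source H (f x))
  set χ := extChartAt I (f x) with hχ
  have hχs : CMDiffAt ∞ χ (f x) := contMDiffAt_extChartAt
  have hfx : MDiffAt f x := hf.mdifferentiableAt (by simp)
  have hF : CMDiffAt ∞ (fun y ↦ χ (f y)) x := ContMDiffAt.comp x hχs hf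
  rw [mvfderiv_mlieBracket hχs hX' hY']
  rw [← mvfderiv_comp_apply' (hχs.mdifferentiableAt (by simp)) hfx, mvfderiv_mlieBracket hF hX hY]
  have hcomp : ∀ {X : ∀ x : N, TangentSpace I' x} {X' : ∀ p : M, TangentSpace I p},
      (∀ᶠ y in 𝓝 x, mfderiv I' I f y (X y) = X' (f y)) →
      (fun y ↦ mvfderiv I' (fun z ↦ χ (f z)) y (X y)) =ᶠ[𝓝 x]
        fun y ↦ (fun q ↦ mvfderiv I χ q (X' q)) (f y) := fun {X X'} h ↦ by
    have h1 : ∀ᶠ y in 𝓝 x, CMDiffAt 1 f y :=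
      (contMDiffAt_iff_contMDiffAt_nhds (by simp)).1 (hf.of_le (by simp))
    have h2 : ∀ᶠ y in 𝓝 x, f y ∈ (chartAt H (f x)).source :=
      hf.continuousAt.eventually ((chartAt H (f x)).open_source.mem_nhds (mem_chart_source H _))
    filter_upwards [h, h1, h2] with y hy hy1 hy2
    rw [mvfderiv_comp_apply' (mdifferentiableAt_extChartAt' hy2)
      (hy1.mdifferentiableAt (by simp)), hy]
  rw [(hcomp h₁).mvfderiv_eq, (hcomp h₂).mvfderiv_eq,
    mvfderiv_comp_apply' (hY'.mvfderiv_vectorField hχs) hfx,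
    mvfderiv_comp_apply' (hX'.mvfderiv_vectorField hχs) hfx, h₁.self_of_nhds, h₂.self_of_nhds]

omit [FiniteDimensional ℝ E] [IsManifold I ∞ M] in
lemma contMDiffAt_clm_of_apply {n : ℕ∞ω} {G : M → E' →L[ℝ] V} {p : M}
    (h : ∀ e, CMDiffAt n (fun q ↦ G q e) p) : CMDiffAt n G p := by
  let d := Module.finrank ℝ E'
  have hd : d = Module.finrank ℝ (Fin d → ℝ) := (Module.finrank_fin_fun ℝ).symm
  let e₁ := ContinuousLinearEquiv.ofFinrankEq hd
  let e₂ := (e₁.arrowCongr (1 : V ≃L[ℝ] V)).trans (ContinuousLinearEquiv.piRing (Fin d))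
  have h1 : ContMDiffAt I 𝓘(ℝ, Fin d → V) n (fun q ↦ e₂ (G q)) p := contMDiffAt_pi_space.2 fun i ↦ h _
  have h2 := (e₂.symm.contDiff (n := n)).contMDiff.contMDiffAt.comp p h1
  refine h2.congr_of_eventuallyEq (Eventually.of_forall fun q ↦ ?_)
  exact (e₂.symm_apply_apply (G q)).symm

omit [FiniteDimensional ℝ E] in
lemma contMDiffOn_symmL_tangent (p : M) (e : E) :
    CMDiff[(chartAt H p).source] ∞
      (T% (fun q : M ↦ (trivializationAt E (TangentSpace I) p).symmL ℝ q e)) := by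
  let t := trivializationAt E (TangentSpace I : M → Type _) p
  suffices CMDiff[t.baseSet] ∞ (fun x ↦ (t ⟨x, t.symmL ℝ x e⟩).2) by
    intro x hx
    rw [t.contMDiffWithinAt_section _ hx]
    exact this x hx
  have : CMDiff[t.baseSet] ∞ (fun (_x : M) ↦ e) := contMDiffOn_const
  exact this.congr (fun x hx ↦ by
    rw [Trivialization.symmL_apply _ hx, t.apply_mk_symm hx])

omit [FiniteDimensional ℝ E] in
lemma contMDiffAt_symmL_tangent (p : M) (e : E) :
    CMDiffAt ∞ (T% (fun q : M ↦ (trivializationAt E (TangentSpace I) p).symmL ℝ q e)) p :=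
  (contMDiffOn_symmL_tangent p e).contMDiffAt
    ((chartAt H p).open_source.mem_nhds (mem_chart_source H p))

/-- A field of endomorphisms is smooth if it maps smooth vector fields to smooth vector fields. -/
lemma contMDiffAt_endo {A : ∀ p : M, TangentSpace I p →L[ℝ] TangentSpace I p} {p : M}
    (h : ∀ X : ∀ p : M, TangentSpace I p, CMDiffAt ∞ (T% X) p →
      CMDiffAt ∞ (T% (fun q ↦ A q (X q))) p) :
    CMDiffAt ∞ (fun q ↦ TotalSpace.mk' (E →L[ℝ] E)
      (E := fun q : M ↦ TangentSpace I q →L[ℝ] TangentSpace I q) q (A q)) p := by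
  rw [contMDiffAt_hom_bundle]
  refine ⟨contMDiffAt_id, contMDiffAt_clm_of_apply fun e ↦ ?_⟩
  have h1 := h _ (contMDiffAt_symmL_tangent p e)
  rw [contMDiffAt_section] at h1
  refine h1.congr_of_eventuallyEq ?_
  filter_upwards [(chartAt H p).open_source.mem_nhds (mem_chart_source H p)] with q hq
  simp only [ContinuousLinearMap.inCoordinates, ContinuousLinearMap.comp_apply]
  rw [Trivialization.continuousLinearMapAt_apply, Trivialization.linearMapAt_apply, if_pos]
  exact hq

/-- A one-form is smooth if its values on smooth vector fields are smooth. -/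
lemma contMDiffAt_oneForm {α : ∀ p : M, TangentSpace I p →L[ℝ] ℝ} {p : M}
    (h : ∀ X : ∀ p : M, TangentSpace I p, CMDiffAt ∞ (T% X) p → CMDiffAt ∞ (fun q ↦ α q (X q)) p) :
    CMDiffAt ∞ (fun q ↦ TotalSpace.mk' (E →L[ℝ] ℝ)
      (E := fun x : M ↦ TangentSpace I x →L[ℝ] Bundle.Trivial M ℝ x) q (α q)) p := by
  rw [contMDiffAt_hom_bundle]
  refine ⟨contMDiffAt_id, contMDiffAt_clm_of_apply fun e ↦ ?_⟩
  have h1 := h _ (contMDiffAt_symmL_tangent p e)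
  refine h1.congr_of_eventuallyEq (Eventually.of_forall fun q ↦ ?_)
  simp only [ContinuousLinearMap.inCoordinates, ContinuousLinearMap.comp_apply]
  rw [Trivialization.continuousLinearMapAt_apply, Trivialization.linearMapAt_apply, if_pos]
  · rfl
  · exact mem_univ _

omit [FiniteDimensional ℝ E] in
lemma EndoField.mdifferentiableAt_apply (A : EndoField I M) {X : ∀ p : M, TangentSpace I p} {p : M}
    (hX : MDiffAt (T% X) p) : MDiffAt (T% (fun q ↦ A q (X q))) p :=
  MDifferentiableAt.clm_bundle_apply (b := id) ((A.contMDiff p).mdifferentiableAt (by simp)) hX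

omit [FiniteDimensional ℝ E] in
lemma OneForm.contMDiffAt_apply (α : OneForm I M) {n : ℕ∞ω} (hn : n ≤ ∞)
    {X : ∀ p : M, TangentSpace I p} {p : M}
    (hX : CMDiffAt n (T% X) p) : CMDiffAt n (fun q ↦ α q (X q)) p := by
  have h1 := (α.smooth p).of_le hn
  have h2 := ContMDiffAt.clm_bundle_apply (b := id)
    (E₁ := (TangentSpace I : M → Type _)) (E₂ := Bundle.Trivial M ℝ) h1 hX
  exact (contMDiffAt_section _).1 h2

omit [FiniteDimensional ℝ E] in
lemma SmoothField.contMDiffAt (X : SmoothField I M) (p : M) :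
    CMDiffAt ∞ (T% (fun q ↦ X q)) p :=
  X.contMDiff p

omit [FiniteDimensional ℝ E] in
lemma SmoothField.mdifferentiableAt (X : SmoothField I M) (p : M) :
    MDiffAt (T% (fun q ↦ X q)) p :=
  (X.contMDiff p).mdifferentiableAt (by simp)

/-- Cutting off a vector field that is smooth near a point. -/
lemma exists_smoothField [T2Space M] {X : ∀ p : M, TangentSpace I p} {p : M} {u : Set M}
    (hu : IsOpen u) (hpu : p ∈ u) (hX : CMDiff[u] ∞ (T% X)) :
    ∃ (Y : SmoothField I M) (ψ : M → ℝ), ψ p = 1 ∧ (∀ q ∉ u, ψ q = 0) ∧ ∀ q, Y q = ψ q • X q := by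
  obtain ⟨f, -, hf⟩ := (SmoothBumpFunction.nhds_basis_tsupport (I := I) p).mem_iff.1
    (hu.mem_nhds hpu)
  refine ⟨⟨(f : M → ℝ) • X, ContMDiffOn.smul_section_of_tsupport f.contMDiff.contMDiffOn hu
    hf hX⟩, f, f.eq_one, fun q hq ↦ ?_, fun q ↦ rfl⟩
  exact image_eq_zero_of_notMem_tsupport fun h ↦ hq (hf h)

end Fields

section Closed

variable {E : Type*} [NormedAddCommGroup E] [NormedSpace ℝ E] [FiniteDimensional ℝ E]
  {H : Type*} [TopologicalSpace H] {I : ModelWithCorners ℝ E H} [I.Boundaryless]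
  {M : Type*} [TopologicalSpace M] [ChartedSpace H M] [IsManifold I ∞ M]

instance isManifold_minSmoothness_two : IsManifold I (minSmoothness ℝ 2) M := by
  rw [minSmoothness_of_isRCLikeNormedField]; infer_instance

instance isManifold_minSmoothness_three : IsManifold I (minSmoothness ℝ 3) M := by
  rw [minSmoothness_of_isRCLikeNormedField]; infer_instance

omit [FiniteDimensional ℝ E] [I.Boundaryless] [IsManifold I ∞ M] in
lemma mvfderiv_eq_zero_of_eventually_const {V : Type*} [NormedAddCommGroup V] [NormedSpace ℝ V]
    {F : M → V} {p : M} {c : V} (h : ∀ᶠ q in 𝓝 p, F q = c)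
    (v : TangentSpace I p) : mvfderiv I F p v = 0 := by
  have h1 : F =ᶠ[𝓝 p] fun _ ↦ c := h
  rw [h1.mvfderiv_eq, mvfderiv_const]
  rfl

omit [FiniteDimensional ℝ E] [I.Boundaryless] in
lemma eventually_mdifferentiableAt {X : ∀ p : M, TangentSpace I p} {p : M}
    (hX : CMDiffAt ∞ (T% X) p) : ∀ᶠ q in 𝓝 p, MDiffAt (T% X) q := by
  have h : ∀ᶠ q in 𝓝 p, CMDiffAt 1 (T% X) q :=
    (contMDiffAt_iff_contMDiffAt_nhds (by simp)).1 (hX.of_le (by simp))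
  exact h.mono fun q hq ↦ hq.mdifferentiableAt (by simp)

omit [I.Boundaryless] in
lemma contMDiffAt_mlieBracket {X Y : ∀ p : M, TangentSpace I p} {p : M}
    (hX : CMDiffAt ∞ (T% X) p) (hY : CMDiffAt ∞ (T% Y) p) :
    CMDiffAt ∞ (T% (fun q ↦ mlieBracket I X Y q)) p := by
  have : IsManifold I (((⊤ : ℕ∞) : ℕ∞ω) + 1) M := inferInstanceAs (IsManifold I ∞ M)
  exact ContMDiffAt.mlieBracket_vectorField (m := ⊤) (n := ⊤) hX hY (by simp)

namespace OneForm

omit [I.Boundaryless] in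
lemma apply_mlieBracket (α : OneForm I M) {X W : ∀ p : M, TangentSpace I p} {p : M} {c : ℝ}
    (hX : MDiffAt (T% X) p) (hW : MDiffAt (T% W) p)
    (h : ∀ᶠ q in 𝓝 p, α q (X q) = c) (hd : α.d p (X p) (W p) = 0) :
    α p (mlieBracket I X W p) = mvfderiv I (fun q ↦ α q (W q)) p (X p) := by
  have h1 := α.d_apply hX hW
  rw [hd, mvfderiv_eq_zero_of_eventually_const h] at h1
  linarith

omit [I.Boundaryless] in
lemma apply_mlieBracket_eq_zero (α : OneForm I M) {X Y : ∀ p : M, TangentSpace I p} {p : M} {c c' : ℝ}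
    (hX : MDiffAt (T% X) p) (hY : MDiffAt (T% Y) p)
    (h : ∀ᶠ q in 𝓝 p, α q (X q) = c) (hd : α.d p (X p) (Y p) = 0)
    (h' : ∀ᶠ q in 𝓝 p, α q (Y q) = c') :
    α p (mlieBracket I X Y p) = 0 := by
  rw [α.apply_mlieBracket hX hY h hd, mvfderiv_eq_zero_of_eventually_const h']

/-- The characteristic vector fields of a one-form are closed under the bracket. -/
lemma d_mlieBracket_eq_zero (α : OneForm I M) {X Y : ∀ p : M, TangentSpace I p} {p : M} {c c' : ℝ}
    (hX : CMDiffAt ∞ (T% X) p) (hY : CMDiffAt ∞ (T% Y) p)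
    (h : ∀ᶠ q in 𝓝 p, α q (X q) = c) (hd : ∀ᶠ q in 𝓝 p, ∀ w, α.d q (X q) w = 0)
    (h' : ∀ᶠ q in 𝓝 p, α q (Y q) = c') (hd' : ∀ᶠ q in 𝓝 p, ∀ w, α.d q (Y q) w = 0)
    (w : TangentSpace I p) :
    α.d p (mlieBracket I X Y p) w = 0 := by
  let W := FiberBundle.extend E w
  have hW : CMDiffAt ∞ (T% W) p := FiberBundle.contMDiffAt_extend I E w
  have hWp : W p = w := FiberBundle.extend_apply_self E w
  have e1 := eventually_mdifferentiableAt hX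
  have e2 := eventually_mdifferentiableAt hY
  have e3 := eventually_mdifferentiableAt hW
  have hU : MDiffAt (T% (fun q ↦ mlieBracket I X Y q)) p :=
    (contMDiffAt_mlieBracket hX hY).mdifferentiableAt (by simp)
  have hYW : MDiffAt (T% (fun q ↦ mlieBracket I Y W q)) p :=
    (contMDiffAt_mlieBracket hY hW).mdifferentiableAt (by simp)
  have hXW : MDiffAt (T% (fun q ↦ mlieBracket I X W q)) p :=
    (contMDiffAt_mlieBracket hX hW).mdifferentiableAt (by simp)
  have hαU : ∀ᶠ q in 𝓝 p, α q (mlieBracket I X Y q) = 0 := by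
    filter_upwards [e1, e2, h.eventually_nhds, hd, h'.eventually_nhds] with q a1 a2 a3 a4 a5
    exact α.apply_mlieBracket_eq_zero a1 a2 a3 (a4 _) a5
  have hαYW : (fun q ↦ α q (mlieBracket I Y W q)) =ᶠ[𝓝 p]
      fun q ↦ mvfderiv I (fun q ↦ α q (W q)) q (Y q) := by
    filter_upwards [e2, e3, h'.eventually_nhds, hd'] with q a1 a2 a3 a4
    exact α.apply_mlieBracket a1 a2 a3 (a4 _)
  have hαXW : (fun q ↦ α q (mlieBracket I X W q)) =ᶠ[𝓝 p]
      fun q ↦ mvfderiv I (fun q ↦ α q (W q)) q (X q) := by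
    filter_upwards [e1, e3, h.eventually_nhds, hd] with q a1 a2 a3 a4
    exact α.apply_mlieBracket a1 a2 a3 (a4 _)
  have hmin : minSmoothness ℝ 2 ≤ (∞ : ℕ∞ω) := by simp; exact WithTop.coe_le_coe.2 le_top
  have hJ := leibniz_identity_mlieBracket_apply (I := I) (hX.of_le hmin) (hY.of_le hmin)
    (hW.of_le hmin)
  have hJ' := congrArg (α p) hJ
  rw [map_add] at hJ'
  have h1 := α.apply_mlieBracket e1.self_of_nhds hYW h (hd.self_of_nhds _)
  have h2 := α.apply_mlieBracket e2.self_of_nhds hXW h' (hd'.self_of_nhds _)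
  rw [hαYW.mvfderiv_eq] at h1
  rw [hαXW.mvfderiv_eq] at h2
  have h3 := mvfderiv_mlieBracket (α.contMDiffAt_apply le_rfl hW) e1.self_of_nhds e2.self_of_nhds
  have h4 := α.d_apply hU e3.self_of_nhds
  rw [mvfderiv_eq_zero_of_eventually_const hαU, hWp] at h4
  have h5 : α p (mlieBracket I X (mlieBracket I Y W) p) = _ := h1
  have h6 : α p (mlieBracket I Y (mlieBracket I X W) p) = _ := h2
  have h7 : α.d p (mlieBracket I X Y p) w = mvfderiv I (fun q ↦ α q (W q)) p (mlieBracket I X Y p)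
    - 0 - α p (mlieBracket I (mlieBracket I X Y) W p) := h4
  linarith

/-- The distribution `ker α ∩ ker dα` is involutive. -/
lemma mlieBracket_mem_charDist (α : OneForm I M) {X Y : ∀ p : M, TangentSpace I p} {p : M}
    (hX : CMDiffAt ∞ (T% X) p) (hY : CMDiffAt ∞ (T% Y) p)
    (h : ∀ᶠ q in 𝓝 p, X q ∈ charDist α q) (h' : ∀ᶠ q in 𝓝 p, Y q ∈ charDist α q) :
    mlieBracket I X Y p ∈ charDist α p := by
  simp only [mem_charDist] at h h' ⊢
  exact ⟨α.apply_mlieBracket_eq_zero (hX.mdifferentiableAt (by simp))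
      (hY.mdifferentiableAt (by simp)) (h.mono fun q hq ↦ hq.1) (h.self_of_nhds.2 _)
      (h'.mono fun q hq ↦ hq.1),
    α.d_mlieBracket_eq_zero hX hY (h.mono fun q hq ↦ hq.1) (h.mono fun q hq ↦ hq.2)
      (h'.mono fun q hq ↦ hq.1) (h'.mono fun q hq ↦ hq.2)⟩

/-- The bilinear form `dα + α ⊗ α` in the coordinates given by a chart. -/
noncomputable def coordForm (α : OneForm I M) (p q : M) : E →L[ℝ] E →L[ℝ] ℝ :=
  let S := (trivializationAt E (TangentSpace I : M → Type _) p).symmL ℝ q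
  LinearMap.toContinuousLinearMap
    { toFun := fun a ↦ (α.d q (S a)).comp S + α q (S a) • (α q).comp S
      map_add' := fun a b ↦ by ext; simp; ring
      map_smul' := fun a b ↦ by ext; simp; ring }

omit [I.Boundaryless] in
lemma coordForm_apply (α : OneForm I M) (p q : M) (a b : E) :
    α.coordForm p q a b =
      α.d q ((trivializationAt E (TangentSpace I : M → Type _) p).symmL ℝ q a)
        ((trivializationAt E (TangentSpace I : M → Type _) p).symmL ℝ q b)
      + α q ((trivializationAt E (TangentSpace I : M → Type _) p).symmL ℝ q a)
        * α q ((trivializationAt E (TangentSpace I : M → Type _) p).symmL ℝ q b) := rfl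

omit [FiniteDimensional ℝ E] [I.Boundaryless] in
lemma contMDiffAt_symmL_of_mem {p q : M} (hq : q ∈ (chartAt H p).source) (a : E) :
    CMDiffAt ∞ (T% (fun q : M ↦ (trivializationAt E (TangentSpace I) p).symmL ℝ q a)) q :=
  (contMDiffOn_symmL_tangent p a).contMDiffAt ((chartAt H p).open_source.mem_nhds hq)

lemma contMDiffAt_d_apply (α : OneForm I M) {X Y : ∀ p : M, TangentSpace I p} {p : M}
    (hX : ∀ᶠ q in 𝓝 p, CMDiffAt ∞ (T% X) q) (hY : ∀ᶠ q in 𝓝 p, CMDiffAt ∞ (T% Y) q) :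
    CMDiffAt ∞ (fun q ↦ α.d q (X q) (Y q)) p := by
  have hX' := hX.self_of_nhds
  have hY' := hY.self_of_nhds
  have h1 := ContMDiffAt.mvfderiv_vectorField le_rfl (α.contMDiffAt_apply le_rfl hY') hX'
  have h2 := ContMDiffAt.mvfderiv_vectorField le_rfl (α.contMDiffAt_apply le_rfl hX') hY'
  have h3 := α.contMDiffAt_apply le_rfl (contMDiffAt_mlieBracket hX' hY')
  refine ContMDiffAt.congr_of_eventuallyEq ((h1.sub h2).sub h3) ?_
  filter_upwards [hX, hY] with q hq hq'
  exact α.d_apply (hq.mdifferentiableAt (by simp)) (hq'.mdifferentiableAt (by simp))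

lemma contMDiffAt_coordForm (α : OneForm I M) {p q : M} (hq : q ∈ (chartAt H p).source) :
    CMDiffAt ∞ (α.coordForm p) q := by
  refine contMDiffAt_clm_of_apply fun a ↦ contMDiffAt_clm_of_apply fun b ↦ ?_
  have hX : ∀ a, ∀ᶠ q' in 𝓝 q, CMDiffAt ∞ (T% (fun q : M ↦
      (trivializationAt E (TangentSpace I) p).symmL ℝ q a)) q' := fun a ↦
    Filter.mem_of_superset ((chartAt H p).open_source.mem_nhds hq)
      fun q' hq' ↦ contMDiffAt_symmL_of_mem hq' a
  have h1 := α.contMDiffAt_d_apply (hX a) (hX b)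
  have h2 := (α.contMDiffAt_apply le_rfl (hX a).self_of_nhds).mul
    (α.contMDiffAt_apply le_rfl (hX b).self_of_nhds)
  exact h1.add h2

end OneForm

omit [I.Boundaryless] in
lemma IsReebPair.symm {α₁ α₂ : OneForm I M} {Z₁ Z₂ : SmoothField I M}
    (hr : IsReebPair α₁ α₂ Z₁ Z₂) : IsReebPair α₂ α₁ Z₂ Z₁ :=
  ⟨hr.α₂_Z₂, hr.α₁_Z₁, hr.α₂_Z₁, hr.α₁_Z₂, hr.dα₂_Z₂, hr.dα₁_Z₂, hr.dα₂_Z₁, hr.dα₁_Z₁⟩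

omit [I.Boundaryless] in
lemma mem_charDist_of_reeb {α : OneForm I M} {p : M} {z v : TangentSpace I p} (hz : α p z = 1)
    (hdz : ∀ w, α.d p z w = 0) (h : ∀ w, α.d p v w + α p v * α p w = 0) :
    v ∈ charDist α p := by
  have h1 : α p v = 0 := by
    have := h z
    rw [hz, α.d_swap, hdz] at this
    linarith
  refine mem_charDist.2 ⟨h1, fun w ↦ ?_⟩
  have := h w
  rw [h1] at this
  linarith

omit [I.Boundaryless] in
lemma exists_mem_charDist_sub {α₁ α₂ : OneForm I M} {q : M}
    (hc : IsCompl (charDist α₁ q) (charDist α₂ q)) (w : TangentSpace I q) :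
    ∃ y ∈ charDist α₂ q, w - y ∈ charDist α₁ q := by
  have hw : w ∈ charDist α₁ q ⊔ charDist α₂ q := by rw [hc.sup_eq_top]; trivial
  obtain ⟨x, hx, y, hy, rfl⟩ := Submodule.mem_sup.1 hw
  exact ⟨y, hy, by simpa using hx⟩

/-- Every characteristic vector extends to a characteristic vector field. -/
lemma exists_smoothField_mem_charDist [T2Space M] {α₁ α₂ : OneForm I M} {Z₁ Z₂ : SmoothField I M}
    (hr : IsReebPair α₁ α₂ Z₁ Z₂) (hc : ∀ q, IsCompl (charDist α₁ q) (charDist α₂ q)) {p : M}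
    {v : TangentSpace I p} (hv : v ∈ charDist α₂ p) :
    ∃ X : SmoothField I M, (∀ q, X q ∈ charDist α₂ q) ∧ X p = v := by
  let t := trivializationAt E (TangentSpace I : M → Type _) p
  have hp : p ∈ (chartAt H p).source := mem_chart_source H p
  let a : E := t.continuousLinearMapAt ℝ p v
  choose proj hproj hproj' using fun q ↦ exists_mem_charDist_sub (hc q)
  let Y : ∀ q : M, TangentSpace I q := fun q ↦ proj q (t.symmL ℝ q a)
  have hYp : Y p = v := by
    have h1 : t.symmL ℝ p a = v := t.symmL_continuousLinearMapAt hp v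
    have h2 : v - Y p ∈ charDist α₁ p := by
      have h3 : t.symmL ℝ p a - Y p ∈ charDist α₁ p := hproj' p (t.symmL ℝ p a)
      exact h1 ▸ h3
    exact (sub_eq_zero.1 (Submodule.disjoint_def.1 (hc p).disjoint _ h2
      (Submodule.sub_mem _ hv (hproj _ _)))).symm
  have hY : CMDiff[(chartAt H p).source] ∞ (T% Y) := by
    intro q hq
    refine ContMDiffAt.contMDiffWithinAt ?_
    rw [t.contMDiffAt_section_iff (n := ∞) (IB := I) hq]
    let B : M → E →L[ℝ] E →L[ℝ] ℝ := fun q ↦ α₁.coordForm p q + α₂.coordForm p q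
    have hB : CMDiffAt ∞ B q := (α₁.contMDiffAt_coordForm hq).add (α₂.contMDiffAt_coordForm hq)
    have hBv : ∀ q ∈ (chartAt H p).source, ∀ v w : TangentSpace I q,
        B q (t.continuousLinearMapAt ℝ q v) (t.continuousLinearMapAt ℝ q w) =
          (α₁.d q v w + α₁ q v * α₁ q w) + (α₂.d q v w + α₂ q v * α₂ q w) := fun q hq v w ↦ by
      have h1 := t.symmL_continuousLinearMapAt (R := ℝ) hq v
      have h2 := t.symmL_continuousLinearMapAt (R := ℝ) hq w
      change α₁.coordForm p q _ _ + α₂.coordForm p q _ _ = _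
      rw [OneForm.coordForm_apply, OneForm.coordForm_apply, h1, h2]
    have hinv : ∀ q ∈ (chartAt H p).source, (B q).IsInvertible := by
      intro q hq
      have hinj : Function.Injective (B q) := by
        rw [injective_iff_map_eq_zero]
        intro e he
        obtain ⟨v, rfl⟩ : ∃ v : TangentSpace I q, t.continuousLinearMapAt ℝ q v = e :=
          ⟨t.symmL ℝ q e, t.continuousLinearMapAt_symmL hq e⟩
        have h0 : ∀ w, (α₁.d q v w + α₁ q v * α₁ q w) + (α₂.d q v w + α₂ q v * α₂ q w) = 0 :=
          fun w ↦ by rw [← hBv q hq, he]; rfl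
        have hd1 : ∀ w ∈ charDist α₁ q, α₁.d q v w + α₁ q v * α₁ q w = 0 := fun w hw ↦ by
          rw [mem_charDist] at hw
          rw [α₁.d_swap, hw.1, hw.2]; simp
        have hd2 : ∀ w ∈ charDist α₂ q, α₂.d q v w + α₂ q v * α₂ q w = 0 := fun w hw ↦ by
          rw [mem_charDist] at hw
          rw [α₂.d_swap, hw.1, hw.2]; simp
        have h1 : v ∈ charDist α₁ q := by
          refine mem_charDist_of_reeb (hr.α₁_Z₁ q) (hr.dα₁_Z₁ q) fun w ↦ ?_
          have h3 := hd1 _ (hproj' q w)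
          have h4 := hd2 _ (hproj q w)
          have h5 := h0 (proj q w)
          simp only [map_sub] at h3
          linarith
        have h2 : v ∈ charDist α₂ q := by
          refine mem_charDist_of_reeb (hr.α₂_Z₂ q) (hr.dα₂_Z₂ q) fun w ↦ ?_
          have h5 := h0 w
          rw [mem_charDist] at h1
          rw [h1.1, h1.2] at h5
          linarith
        rw [Submodule.disjoint_def.1 (hc q).disjoint _ h1 h2, map_zero]
      let e := LinearEquiv.ofInjectiveOfFinrankEq (B q).toLinearMap hinj (by
        rw [(LinearMap.toContinuousLinearMap : (E →ₗ[ℝ] ℝ) ≃ₗ[ℝ] (E →L[ℝ] ℝ)).symm.finrank_eq,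
          Module.finrank_linearMap, Module.finrank_self, mul_one])
      exact ⟨e.toContinuousLinearEquiv, by ext; rfl⟩
    have hinvs : CMDiffAt ∞ (fun q ↦ (B q).inverse) q :=
      ((hinv q hq).contDiffAt_map_inverse (n := ∞)).contMDiffAt.comp q hB
    refine (hinvs.clm_apply ((α₁.contMDiffAt_coordForm hq).clm_apply
      (contMDiffAt_const (c := a)))).congr_of_eventuallyEq ?_
    filter_upwards [(chartAt H p).open_source.mem_nhds hq] with q' hq'
    refine Eq.symm (((hinv q' hq').inverse_apply_eq).2 ?_)
    have h1 : (t ⟨q', Y q'⟩).2 = t.continuousLinearMapAt ℝ q' (Y q') := by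
      rw [Trivialization.continuousLinearMapAt_apply, Trivialization.linearMapAt_apply, if_pos]
      exact hq'
    rw [h1]
    ext b
    obtain ⟨w, rfl⟩ : ∃ w : TangentSpace I q', t.continuousLinearMapAt ℝ q' w = b :=
      ⟨t.symmL ℝ q' b, t.continuousLinearMapAt_symmL hq' b⟩
    rw [hBv q' hq', OneForm.coordForm_apply, t.symmL_continuousLinearMapAt (R := ℝ) hq' w]
    have h2 := mem_charDist.1 (hproj' q' (t.symmL ℝ q' a))
    have h3 := mem_charDist.1 (hproj q' (t.symmL ℝ q' a))
    have h4 := h2.1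
    have h5 := h2.2 w
    simp only [map_sub, sub_apply] at h4 h5
    have h6 : α₂ q' (Y q') = 0 := h3.1
    have h7 : α₂.d q' (Y q') w = 0 := h3.2 w
    rw [h6, h7, sub_eq_zero.1 h4, sub_eq_zero.1 h5]
    simp [Y]
  obtain ⟨X, ψ, h1, h2, h3⟩ := exists_smoothField (chartAt H p).open_source hp hY
  refine ⟨X, fun q ↦ ?_, by rw [h3, h1, one_smul, hYp]⟩
  rw [h3]
  exact Submodule.smul_mem _ _ (hproj _ _)

end Closed

section Nijenhuis

variable {E : Type*} [NormedAddCommGroup E] [NormedSpace ℝ E] [FiniteDimensional ℝ E]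
  {H : Type*} [TopologicalSpace H] {I : ModelWithCorners ℝ E H}
  {M : Type*} [TopologicalSpace M] [ChartedSpace H M] [IsManifold I ∞ M]

omit [FiniteDimensional ℝ E] [IsManifold I ∞ M] in
lemma nijenhuis_swap (A : ∀ p : M, TangentSpace I p →L[ℝ] TangentSpace I p)
    (X Y : ∀ p : M, TangentSpace I p) (p : M) : nijenhuis I A X Y p = -nijenhuis I A Y X p := by
  unfold nijenhuis
  rw [mlieBracket_swap_apply (V := X) (W := Y), mlieBracket_swap_apply (V := fun q ↦ A q (X q)) (W := Y),
    mlieBracket_swap_apply (V := X), mlieBracket_swap_apply (V := fun q ↦ A q (X q))]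
  simp only [map_neg]
  abel

/-- The field of endomorphisms `A` maps vector fields differentiable at `p` to
vector fields differentiable at `p`. -/
def PreservesMDiffAt (A : ∀ p : M, TangentSpace I p →L[ℝ] TangentSpace I p) (p : M) : Prop :=
  ∀ X : ∀ p : M, TangentSpace I p, MDiffAt (T% X) p → MDiffAt (T% (fun q ↦ A q (X q))) p

variable {A : ∀ p : M, TangentSpace I p →L[ℝ] TangentSpace I p} {p : M}

lemma nijenhuis_tensorial_left (hA : PreservesMDiffAt A p)
    (Y : ∀ p : M, TangentSpace I p) :
    TensorialAt I E (fun X ↦ nijenhuis I A X Y p) p where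
  smul {f X} hf hX := by
    have h2 : IsManifold I 2 M := inferInstance
    have e : (fun q ↦ A q ((f • X) q)) = f • fun q ↦ A q (X q) := by ext q; simp
    unfold nijenhuis
    rw [e, mlieBracket_smul_left hf hX, mlieBracket_smul_left hf (hA X hX),
      mlieBracket_smul_left hf (hA X hX), mlieBracket_smul_left hf hX]
    simp only [map_add, map_smul]
    module
  add {X X'} hX hX' := by
    have h2 : IsManifold I 2 M := inferInstance
    have e : (fun q ↦ A q ((X + X') q)) = (fun q ↦ A q (X q)) + fun q ↦ A q (X' q) := by ext q; simp
    unfold nijenhuis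
    rw [e, mlieBracket_add_left hX hX', mlieBracket_add_left (hA X hX) (hA X' hX'),
      mlieBracket_add_left (hA X hX) (hA X' hX'), mlieBracket_add_left hX hX']
    simp only [map_add]
    module

lemma nijenhuis_tensorial_right (hA : PreservesMDiffAt A p)
    (X : ∀ p : M, TangentSpace I p) :
    TensorialAt I E (fun Y ↦ nijenhuis I A X Y p) p where
  smul {f Y} hf hY := by
    rw [nijenhuis_swap A X, nijenhuis_swap A X, (nijenhuis_tensorial_left hA X).smul hf hY,
      smul_neg]
  add {Y Y'} hY hY' := by
    rw [nijenhuis_swap A X, nijenhuis_swap A X, nijenhuis_swap A X,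
      (nijenhuis_tensorial_left hA X).add hY hY', neg_add]

/-- The Nijenhuis tensor at a point. -/
noncomputable def nijenhuisAt (hA : PreservesMDiffAt A p) :
    TangentSpace I p →L[ℝ] TangentSpace I p →L[ℝ] TangentSpace I p :=
  TensorialAt.mkHom₂ (fun X Y ↦ nijenhuis I A X Y p) p
    (fun Y _ ↦ nijenhuis_tensorial_left hA Y) (fun X _ ↦ nijenhuis_tensorial_right hA X)

lemma nijenhuisAt_apply (hA : PreservesMDiffAt A p) {X Y : ∀ p : M, TangentSpace I p}
    (hX : MDiffAt (T% X) p) (hY : MDiffAt (T% Y) p) :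
    nijenhuisAt hA (X p) (Y p) = nijenhuis I A X Y p :=
  TensorialAt.mkHom₂_apply _ _ hX hY

lemma nijenhuisAt_swap (hA : PreservesMDiffAt A p) (v w : TangentSpace I p) :
    nijenhuisAt hA v w = -nijenhuisAt hA w v :=
  nijenhuis_swap A (FiberBundle.extend E v) (FiberBundle.extend E w) p

lemma nijenhuisAt_self (hA : PreservesMDiffAt A p) (v : TangentSpace I p) :
    nijenhuisAt hA v v = 0 := by
  have h := nijenhuisAt_swap hA v v
  have h2 : (2 : ℝ) • nijenhuisAt hA v v = 0 := by rw [two_smul]; nth_rewrite 1 [h]; simp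
  simpa using h2

omit [FiniteDimensional ℝ E] [IsManifold I ∞ M] in
lemma exists_mdifferentiableAt_eq [IsManifold I 1 M] (v : TangentSpace I p) :
    ∃ X : ∀ p : M, TangentSpace I p, MDiffAt (T% X) p ∧ X p = v :=
  ⟨FiberBundle.extend E v, FiberBundle.mdifferentiableAt_extend I E v,
    FiberBundle.extend_apply_self E v⟩

lemma nijenhuisAt_apply_left (hA : PreservesMDiffAt A p)
    (hsq : ∀ q (v : TangentSpace I q), A q (A q v) = -v) (v w : TangentSpace I p) :
    nijenhuisAt hA (A p v) w = -A p (nijenhuisAt hA v w) := by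
  obtain ⟨X, hX, rfl⟩ := exists_mdifferentiableAt_eq v
  obtain ⟨Y, hY, rfl⟩ := exists_mdifferentiableAt_eq w
  have h1 := nijenhuisAt_apply hA (X := fun q ↦ A q (X q)) (hA X hX) hY
  have e : (fun q ↦ A q (A q (X q))) = (-1 : ℝ) • X := by ext q; simp [hsq]
  unfold nijenhuis at h1
  rw [e, mlieBracket_const_smul_left hX, mlieBracket_const_smul_left hX] at h1
  rw [h1, nijenhuisAt_apply hA hX hY]
  unfold nijenhuis
  simp only [map_add, map_sub, map_neg, map_smul, hsq]
  module

lemma NijenhuisVanishes.nijenhuisAt_eq_zero [T2Space M] (h : NijenhuisVanishes I A)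
    (hA : PreservesMDiffAt A p) (v w : TangentSpace I p) : nijenhuisAt hA v w = 0 := by
  have key : ∀ v : TangentSpace I p, ∃ X : SmoothField I M, X p = v := fun v ↦ by
    let t := trivializationAt E (TangentSpace I : M → Type _) p
    obtain ⟨Y, ψ, h1, -, h3⟩ := exists_smoothField (chartAt H p).open_source (mem_chart_source H p)
      (contMDiffOn_symmL_tangent (I := I) p (t.continuousLinearMapAt ℝ p v))
    refine ⟨Y, ?_⟩
    rw [h3, h1, one_smul]
    exact t.symmL_continuousLinearMapAt (mem_chart_source H p) v
  obtain ⟨X, rfl⟩ := key v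
  obtain ⟨Y, rfl⟩ := key w
  exact (nijenhuisAt_apply hA (X.mdifferentiableAt p) (Y.mdifferentiableAt p)).trans (h X Y p)

lemma nijenhuisVanishes_of_nijenhuisAt (hA : ∀ p, PreservesMDiffAt A p)
    (h : ∀ p v w, nijenhuisAt (hA p) v w = 0) : NijenhuisVanishes I A := fun X Y p ↦
  (nijenhuisAt_apply (hA p) (X.mdifferentiableAt p) (Y.mdifferentiableAt p)).symm.trans (h p _ _)

end Nijenhuis

section Pair

variable {E : Type*} [NormedAddCommGroup E] [NormedSpace ℝ E] [FiniteDimensional ℝ E]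
  {H : Type*} [TopologicalSpace H] {I : ModelWithCorners ℝ E H}
  {M : Type*} [TopologicalSpace M] [ChartedSpace H M] [IsManifold I ∞ M]

/-- The algebraic and infinitesimal conditions on a contact pair structure that do not mention
its type. -/
structure IsAlmostContactPair (α₁ α₂ : OneForm I M) (Z₁ Z₂ : SmoothField I M)
    (φ : EndoField I M) : Prop where
  reeb : IsReebPair α₁ α₂ Z₁ Z₂
  φ_sq : ∀ p (v : TangentSpace I p), φ p (φ p v) = -v + α₁ p v • Z₁ p + α₂ p v • Z₂ p
  φ_Z₁ : ∀ p, φ p (Z₁ p) = 0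
  φ_Z₂ : ∀ p, φ p (Z₂ p) = 0
  isCompl : ∀ p, IsCompl (charDist α₁ p) (charDist α₂ p)

lemma EndoField.preservesMDiffAt (φ : EndoField I M) (p : M) :
    PreservesMDiffAt (fun q ↦ φ q) p := fun _ hX ↦ φ.mdifferentiableAt_apply hX

/-- The tensor `[φ, φ] + dα₁ ⊗ Z₁ + dα₂ ⊗ Z₂`. -/
noncomputable def pairTensor (α₁ α₂ : OneForm I M) (Z₁ Z₂ : SmoothField I M) (φ : EndoField I M)
    (p : M) (v w : TangentSpace I p) : TangentSpace I p :=
  nijenhuisAt (φ.preservesMDiffAt p) v w + α₁.d p v w • Z₁ p + α₂.d p v w • Z₂ p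

/-- The obstruction for `dα` to be `φ`-invariant. -/
noncomputable def invarianceDefect (α : OneForm I M) (φ : EndoField I M) (p : M) (v w : TangentSpace I p) : ℝ :=
  α.d p (φ p v) w + α.d p v (φ p w)

variable {α₁ α₂ : OneForm I M} {Z₁ Z₂ : SmoothField I M} {φ : EndoField I M} {p : M}

lemma pairTensor_comm (v w : TangentSpace I p) :
    pairTensor α₁ α₂ Z₁ Z₂ φ p v w = pairTensor α₂ α₁ Z₂ Z₁ φ p v w := by
  unfold pairTensor; abel

lemma pairTensor_swap (v w : TangentSpace I p) :
    pairTensor α₁ α₂ Z₁ Z₂ φ p v w = -pairTensor α₁ α₂ Z₁ Z₂ φ p w v := by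
  unfold pairTensor
  rw [nijenhuisAt_swap, α₁.d_swap, α₂.d_swap]
  module

lemma pairTensor_add_left (u v w : TangentSpace I p) :
    pairTensor α₁ α₂ Z₁ Z₂ φ p (u + v) w =
      pairTensor α₁ α₂ Z₁ Z₂ φ p u w + pairTensor α₁ α₂ Z₁ Z₂ φ p v w := by
  unfold pairTensor
  simp only [map_add, add_apply]
  module

lemma pairTensor_smul_left (c : ℝ) (v w : TangentSpace I p) :
    pairTensor α₁ α₂ Z₁ Z₂ φ p (c • v) w = c • pairTensor α₁ α₂ Z₁ Z₂ φ p v w := by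
  unfold pairTensor
  simp only [map_smul, smul_apply, smul_eq_mul]
  module

lemma assocT_eq_assocJ : assocT α₁ α₂ Z₁ Z₂ φ = assocJ α₂ α₁ Z₂ Z₁ φ := by
  ext p v
  simp only [assocT, assocJ, add_apply, sub_apply]
  exact add_sub_right_comm _ _ _

lemma assocJ_apply (v : TangentSpace I p) :
    assocJ α₁ α₂ Z₁ Z₂ φ p v = φ p v - α₂ p v • Z₁ p + α₁ p v • Z₂ p := rfl

lemma _root_.MDifferentiableAt.smul_vectorField {f : M → ℝ} {X : ∀ p : M, TangentSpace I p}
    (hf : MDiffAt f p) (hX : MDiffAt (T% X) p) : MDiffAt (T% (fun q ↦ f q • X q)) p :=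
  MDifferentiableAt.smul_section hf hX

lemma assocJ_preservesMDiffAt : PreservesMDiffAt (assocJ α₁ α₂ Z₁ Z₂ φ) p := fun _ hX ↦
  mdifferentiableAt_add_section
    (mdifferentiableAt_sub_section (φ.mdifferentiableAt_apply hX)
      ((α₂.mdifferentiableAt_apply hX).smul_vectorField (Z₁.mdifferentiableAt p)))
    ((α₁.mdifferentiableAt_apply hX).smul_vectorField (Z₂.mdifferentiableAt p))

namespace IsAlmostContactPair

lemma symm (h : IsAlmostContactPair α₁ α₂ Z₁ Z₂ φ) : IsAlmostContactPair α₂ α₁ Z₂ Z₁ φ :=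
  ⟨h.reeb.symm, fun p v ↦ by rw [h.φ_sq]; abel, h.φ_Z₂, h.φ_Z₁, fun p ↦ (h.isCompl p).symm⟩

lemma α₁_φ (h : IsAlmostContactPair α₁ α₂ Z₁ Z₂ φ) (v : TangentSpace I p) : α₁ p (φ p v) = 0 := by
  have h1 := h.φ_sq p (φ p v)
  have h2 := congrArg (φ p) (h.φ_sq p v)
  simp only [map_add, map_neg, map_smul, h.φ_Z₁, h.φ_Z₂, smul_zero, add_zero] at h2
  rw [h2] at h1
  have h3 := congrArg (α₁ p) h1
  simpa [h.reeb.α₁_Z₁, h.reeb.α₁_Z₂] using h3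

lemma α₂_φ (h : IsAlmostContactPair α₁ α₂ Z₁ Z₂ φ) (v : TangentSpace I p) : α₂ p (φ p v) = 0 :=
  h.symm.α₁_φ v

lemma assocJ_Z₁ (h : IsAlmostContactPair α₁ α₂ Z₁ Z₂ φ) (p : M) :
    assocJ α₁ α₂ Z₁ Z₂ φ p (Z₁ p) = Z₂ p := by
  simp [assocJ_apply, h.φ_Z₁, h.reeb.α₁_Z₁, h.reeb.α₂_Z₁]

lemma assocJ_assocJ (h : IsAlmostContactPair α₁ α₂ Z₁ Z₂ φ) (p : M) (v : TangentSpace I p) :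
    assocJ α₁ α₂ Z₁ Z₂ φ p (assocJ α₁ α₂ Z₁ Z₂ φ p v) = -v := by
  simp only [assocJ_apply, map_add, map_sub, map_smul, h.φ_sq, h.φ_Z₁, h.φ_Z₂, h.α₁_φ, h.α₂_φ,
    h.reeb.α₁_Z₁, h.reeb.α₂_Z₁, h.reeb.α₁_Z₂, h.reeb.α₂_Z₂]
  module

lemma exists_horizontal (h : IsAlmostContactPair α₁ α₂ Z₁ Z₂ φ) {v : TangentSpace I p}
    (h₁ : α₁ p v = 0) (h₂ : α₂ p v = 0) : ∃ X : ∀ p : M, TangentSpace I p,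
      MDiffAt (T% X) p ∧ (∀ q, α₁ q (X q) = 0) ∧ (∀ q, α₂ q (X q) = 0) ∧ X p = v := by
  obtain ⟨X, hX, rfl⟩ := exists_mdifferentiableAt_eq v
  refine ⟨fun q ↦ X q - α₁ q (X q) • Z₁ q - α₂ q (X q) • Z₂ q, ?_, fun q ↦ ?_, fun q ↦ ?_, ?_⟩
  · exact mdifferentiableAt_sub_section (mdifferentiableAt_sub_section hX
      ((α₁.mdifferentiableAt_apply hX).smul_vectorField (Z₁.mdifferentiableAt p)))
      ((α₂.mdifferentiableAt_apply hX).smul_vectorField (Z₂.mdifferentiableAt p))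
  · simp [h.reeb.α₁_Z₁, h.reeb.α₁_Z₂]
  · simp [h.reeb.α₂_Z₁, h.reeb.α₂_Z₂]
  · simp [h₁, h₂]

lemma _root_.ContactPair.OneForm.d_of_eq_zero (α : OneForm I M) {X Y : ∀ p : M, TangentSpace I p}
    (hX : MDiffAt (T% X) p) (hY : MDiffAt (T% Y) p) (h : ∀ q, α q (X q) = 0)
    (h' : ∀ q, α q (Y q) = 0) : α p (mlieBracket I X Y p) = -α.d p (X p) (Y p) := by
  rw [α.d_apply hX hY, mvfderiv_eq_zero_of_eventually_const (.of_forall h),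
    mvfderiv_eq_zero_of_eventually_const (.of_forall h')]
  ring

lemma nijenhuisAt_assocJ (h : IsAlmostContactPair α₁ α₂ Z₁ Z₂ φ) {v w : TangentSpace I p}
    (hv₁ : α₁ p v = 0) (hv₂ : α₂ p v = 0) (hw₁ : α₁ p w = 0) (hw₂ : α₂ p w = 0) :
    nijenhuisAt (assocJ_preservesMDiffAt (α₁ := α₁) (α₂ := α₂) (Z₁ := Z₁) (Z₂ := Z₂) (φ := φ)) v w =
      pairTensor α₁ α₂ Z₁ Z₂ φ p v w - invarianceDefect α₂ φ p v w • Z₁ p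
        + invarianceDefect α₁ φ p v w • Z₂ p := by
  obtain ⟨X, hX, hX₁, hX₂, rfl⟩ := h.exists_horizontal hv₁ hv₂
  obtain ⟨Y, hY, hY₁, hY₂, rfl⟩ := h.exists_horizontal hw₁ hw₂
  have hφX := φ.mdifferentiableAt_apply hX
  have hφY := φ.mdifferentiableAt_apply hY
  have eX : (fun q ↦ assocJ α₁ α₂ Z₁ Z₂ φ q (X q)) = fun q ↦ φ q (X q) := by
    ext q; simp [assocJ_apply, hX₁, hX₂]
  have eY : (fun q ↦ assocJ α₁ α₂ Z₁ Z₂ φ q (Y q)) = fun q ↦ φ q (Y q) := by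
    ext q; simp [assocJ_apply, hY₁, hY₂]
  have d1 := α₁.d_of_eq_zero hφX hY (fun q ↦ h.α₁_φ _) hY₁
  have d2 := α₁.d_of_eq_zero hX hφY hX₁ (fun q ↦ h.α₁_φ _)
  have d3 := α₂.d_of_eq_zero hφX hY (fun q ↦ h.α₂_φ _) hY₂
  have d4 := α₂.d_of_eq_zero hX hφY hX₂ (fun q ↦ h.α₂_φ _)
  unfold pairTensor invarianceDefect
  rw [nijenhuisAt_apply _ hX hY, nijenhuisAt_apply _ hX hY]
  unfold nijenhuis
  rw [eX, eY, h.assocJ_assocJ, h.φ_sq, α₁.d_of_eq_zero hX hY hX₁ hY₁,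
    α₂.d_of_eq_zero hX hY hX₂ hY₂, assocJ_apply, assocJ_apply, d1, d2, d3, d4]
  module

lemma α₁_pairTensor (h : IsAlmostContactPair α₁ α₂ Z₁ Z₂ φ) {v w : TangentSpace I p}
    (hv₁ : α₁ p v = 0) (hv₂ : α₂ p v = 0) (hw₁ : α₁ p w = 0) (hw₂ : α₂ p w = 0) :
    α₁ p (pairTensor α₁ α₂ Z₁ Z₂ φ p (φ p v) w) = invarianceDefect α₁ φ p v w := by
  obtain ⟨X, hX, hX₁, hX₂, rfl⟩ := h.exists_horizontal hv₁ hv₂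
  obtain ⟨Y, hY, hY₁, hY₂, rfl⟩ := h.exists_horizontal hw₁ hw₂
  have hφX := φ.mdifferentiableAt_apply hX
  have hφY := φ.mdifferentiableAt_apply hY
  have eX : (fun q ↦ φ q (φ q (X q))) = (-1 : ℝ) • X := by
    ext q; simp [h.φ_sq, hX₁, hX₂]
  have d2 := α₁.d_of_eq_zero hX hφY hX₁ (fun q ↦ h.α₁_φ _)
  have h1 := nijenhuisAt_apply (φ.preservesMDiffAt p) hφX hY
  unfold nijenhuis at h1
  rw [eX, mlieBracket_const_smul_left hX] at h1
  unfold pairTensor invarianceDefect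
  rw [h1]
  simp only [map_add, map_sub, map_smul, h.α₁_φ, d2, h.reeb.α₁_Z₁, h.reeb.α₁_Z₂, smul_eq_mul]
  ring

lemma bracket_Z₁_horizontal (h : IsAlmostContactPair α₁ α₂ Z₁ Z₂ φ)
    {Y : ∀ p : M, TangentSpace I p} (hY : MDiffAt (T% Y) p) (hY₁ : ∀ q, α₁ q (Y q) = 0)
    (hY₂ : ∀ q, α₂ q (Y q) = 0) :
    α₁ p (mlieBracket I (fun q ↦ Z₁ q) Y p) = 0 ∧ α₂ p (mlieBracket I (fun q ↦ Z₁ q) Y p) = 0 :=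
  ⟨α₁.apply_mlieBracket_eq_zero (c := 1) (c' := 0) (Z₁.mdifferentiableAt p) hY
      (.of_forall h.reeb.α₁_Z₁) (h.reeb.dα₁_Z₁ _ _) (.of_forall hY₁),
    α₂.apply_mlieBracket_eq_zero (c := 0) (c' := 0) (Z₁.mdifferentiableAt p) hY
      (.of_forall h.reeb.α₂_Z₁) (h.reeb.dα₂_Z₁ _ _) (.of_forall hY₂)⟩

lemma nijenhuisAt_assocJ_Z₁ (h : IsAlmostContactPair α₁ α₂ Z₁ Z₂ φ)
    {Y : ∀ p : M, TangentSpace I p} (hY : MDiffAt (T% Y) p) (hY₁ : ∀ q, α₁ q (Y q) = 0)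
    (hY₂ : ∀ q, α₂ q (Y q) = 0) :
    nijenhuisAt (assocJ_preservesMDiffAt (α₁ := α₁) (α₂ := α₂) (Z₁ := Z₁) (Z₂ := Z₂) (φ := φ))
        (Z₁ p) (Y p) =
      (mlieBracket I (fun q ↦ Z₂ q) (fun q ↦ φ q (Y q)) p
          - φ p (mlieBracket I (fun q ↦ Z₂ q) Y p))
        - φ p (mlieBracket I (fun q ↦ Z₁ q) (fun q ↦ φ q (Y q)) p
          - φ p (mlieBracket I (fun q ↦ Z₁ q) Y p)) := by
  have hφY := φ.mdifferentiableAt_apply hY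
  have eZ : (fun q ↦ assocJ α₁ α₂ Z₁ Z₂ φ q (Z₁ q)) = fun q ↦ Z₂ q := by
    ext q; rw [h.assocJ_Z₁]
  have eY : (fun q ↦ assocJ α₁ α₂ Z₁ Z₂ φ q (Y q)) = fun q ↦ φ q (Y q) := by
    ext q; simp [assocJ_apply, hY₁, hY₂]
  have h1 := h.bracket_Z₁_horizontal hY hY₁ hY₂
  have h2 := h.symm.bracket_Z₁_horizontal hY hY₂ hY₁
  have h3 := h.bracket_Z₁_horizontal hφY (fun q ↦ h.α₁_φ _) (fun q ↦ h.α₂_φ _)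
  refine (nijenhuisAt_apply _ (X := fun q ↦ Z₁ q) (Z₁.mdifferentiableAt p) hY).trans ?_
  unfold nijenhuis
  rw [eZ, eY, h.assocJ_assocJ, assocJ_apply, assocJ_apply, h2.1, h2.2, h3.1, h3.2, map_sub,
    h.φ_sq, h1.1, h1.2]
  module

lemma pairTensor_Z₁ (h : IsAlmostContactPair α₁ α₂ Z₁ Z₂ φ)
    {Y : ∀ p : M, TangentSpace I p} (hY : MDiffAt (T% Y) p) :
    pairTensor α₁ α₂ Z₁ Z₂ φ p (Z₁ p) (Y p) =
      -φ p (mlieBracket I (fun q ↦ Z₁ q) (fun q ↦ φ q (Y q)) p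
          - φ p (mlieBracket I (fun q ↦ Z₁ q) Y p)) := by
  have eZ : (fun q ↦ φ q (Z₁ q)) = 0 := by ext q; rw [h.φ_Z₁]; rfl
  have h1 := nijenhuisAt_apply (φ.preservesMDiffAt p) (Z₁.mdifferentiableAt p) hY
  unfold nijenhuis at h1
  rw [eZ, mlieBracket_zero_left, mlieBracket_zero_left] at h1
  unfold pairTensor
  rw [h1, h.reeb.dα₁_Z₁, h.reeb.dα₂_Z₁, map_sub]
  simp

lemma eq_zero_of_horizontal (h : IsAlmostContactPair α₁ α₂ Z₁ Z₂ φ)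
    {B : TangentSpace I p → TangentSpace I p → TangentSpace I p}
    (hadd : ∀ u v w, B (u + v) w = B u w + B v w) (hsmul : ∀ (c : ℝ) v w, B (c • v) w = c • B v w)
    (hswap : ∀ v w, B v w = -B w v)
    (hH : ∀ v w, α₁ p v = 0 → α₂ p v = 0 → α₁ p w = 0 → α₂ p w = 0 → B v w = 0)
    (h₁ : ∀ w, α₁ p w = 0 → α₂ p w = 0 → B (Z₁ p) w = 0)
    (h₂ : ∀ w, α₁ p w = 0 → α₂ p w = 0 → B (Z₂ p) w = 0)
    (h₁₂ : B (Z₁ p) (Z₂ p) = 0) (v w : TangentSpace I p) : B v w = 0 := by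
  have hself : ∀ v, B v v = 0 := fun v ↦ by
    have h2 : (2 : ℝ) • B v v = 0 := by rw [two_smul]; nth_rewrite 1 [hswap]; simp
    simpa using h2
  have hdec : ∀ v : TangentSpace I p,
      v = (-φ p (φ p v)) + α₁ p v • Z₁ p + α₂ p v • Z₂ p := fun v ↦ by rw [h.φ_sq]; module
  have a₁ : ∀ v : TangentSpace I p, α₁ p (-φ p (φ p v)) = 0 := fun v ↦ by rw [map_neg, h.α₁_φ, neg_zero]
  have a₂ : ∀ v : TangentSpace I p, α₂ p (-φ p (φ p v)) = 0 := fun v ↦ by rw [map_neg, h.α₂_φ, neg_zero]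
  have h₂₁ : B (Z₂ p) (Z₁ p) = 0 := by rw [hswap, h₁₂, neg_zero]
  have step : ∀ u, (∀ w, α₁ p w = 0 → α₂ p w = 0 → B w u = 0) → B (Z₁ p) u = 0 → B (Z₂ p) u = 0 →
      ∀ v, B v u = 0 := fun u k k₁ k₂ v ↦ by
    rw [hdec v, hadd, hadd, hsmul, hsmul, k _ (a₁ v) (a₂ v), k₁, k₂]; simp
  have s₁ : ∀ v, B v (Z₁ p) = 0 :=
    step _ (fun w b₁ b₂ ↦ by rw [hswap, h₁ w b₁ b₂, neg_zero]) (hself _) h₂₁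
  have s₂ : ∀ v, B v (Z₂ p) = 0 :=
    step _ (fun w b₁ b₂ ↦ by rw [hswap, h₂ w b₁ b₂, neg_zero]) h₁₂ (hself _)
  refine step w (fun v b₁ b₂ ↦ ?_) ?_ ?_ v
  · rw [hswap, step v (fun w c₁ c₂ ↦ hH w v c₁ c₂ b₁ b₂) (h₁ v b₁ b₂) (h₂ v b₁ b₂), neg_zero]
  · rw [hswap, s₁, neg_zero]
  · rw [hswap, s₂, neg_zero]

lemma mlieBracket_Z₁_Z₂ [I.Boundaryless] (h : IsAlmostContactPair α₁ α₂ Z₁ Z₂ φ) (p : M) :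
    mlieBracket I (fun q ↦ Z₁ q) (fun q ↦ Z₂ q) p = 0 := by
  have d₁ := Z₁.contMDiffAt p
  have d₂ := Z₂.contMDiffAt p
  have e₁ := Z₁.mdifferentiableAt p
  have e₂ := Z₂.mdifferentiableAt p
  refine Submodule.disjoint_def.1 (h.isCompl p).disjoint _ (mem_charDist.2 ⟨?_, ?_⟩)
    (mem_charDist.2 ⟨?_, ?_⟩)
  · exact α₁.apply_mlieBracket_eq_zero e₁ e₂ (.of_forall h.reeb.α₁_Z₁) (h.reeb.dα₁_Z₁ _ _)
      (.of_forall h.reeb.α₁_Z₂)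
  · exact α₁.d_mlieBracket_eq_zero d₁ d₂ (.of_forall h.reeb.α₁_Z₁) (.of_forall h.reeb.dα₁_Z₁)
      (.of_forall h.reeb.α₁_Z₂) (.of_forall h.reeb.dα₁_Z₂)
  · exact α₂.apply_mlieBracket_eq_zero e₁ e₂ (.of_forall h.reeb.α₂_Z₁) (h.reeb.dα₂_Z₁ _ _)
      (.of_forall h.reeb.α₂_Z₂)
  · exact α₂.d_mlieBracket_eq_zero d₁ d₂ (.of_forall h.reeb.α₂_Z₁) (.of_forall h.reeb.dα₂_Z₁)
      (.of_forall h.reeb.α₂_Z₂) (.of_forall h.reeb.dα₂_Z₂)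

lemma nijenhuisAt_assocJ_eq_zero (h : IsAlmostContactPair α₁ α₂ Z₁ Z₂ φ)
    (h0 : ∀ v w : TangentSpace I p, pairTensor α₁ α₂ Z₁ Z₂ φ p v w = 0) (v w : TangentSpace I p) :
    nijenhuisAt (assocJ_preservesMDiffAt (α₁ := α₁) (α₂ := α₂) (Z₁ := Z₁) (Z₂ := Z₂) (φ := φ)) v w
      = 0 := by
  have k₁ : ∀ w, α₁ p w = 0 → α₂ p w = 0 → nijenhuisAt
      (assocJ_preservesMDiffAt (α₁ := α₁) (α₂ := α₂) (Z₁ := Z₁) (Z₂ := Z₂) (φ := φ)) (Z₁ p) w = 0 := by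
    intro w hw₁ hw₂
    obtain ⟨Y, hY, hY₁, hY₂, rfl⟩ := h.exists_horizontal hw₁ hw₂
    have hφY := φ.mdifferentiableAt_apply hY
    rw [h.nijenhuisAt_assocJ_Z₁ hY hY₁ hY₂]
    have p₁ := h.pairTensor_Z₁ hY
    have p₂ := h.symm.pairTensor_Z₁ hY
    rw [h0] at p₁
    rw [pairTensor_comm, h0] at p₂
    have b := h.symm.bracket_Z₁_horizontal hY hY₂ hY₁
    have c := h.symm.bracket_Z₁_horizontal hφY (fun q ↦ h.α₂_φ _) (fun q ↦ h.α₁_φ _)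
    have p₃ := congrArg (φ p) p₂
    rw [map_neg, h.φ_sq, map_sub, map_sub, h.α₁_φ, h.α₂_φ, c.1, c.2] at p₃
    rw [eq_comm, neg_eq_zero] at p₁
    rw [p₁]
    simpa using p₃.symm
  have k₂ : ∀ w, nijenhuisAt
      (assocJ_preservesMDiffAt (α₁ := α₁) (α₂ := α₂) (Z₁ := Z₁) (Z₂ := Z₂) (φ := φ)) (Z₂ p) w =
      -assocJ α₁ α₂ Z₁ Z₂ φ p (nijenhuisAt
      (assocJ_preservesMDiffAt (α₁ := α₁) (α₂ := α₂) (Z₁ := Z₁) (Z₂ := Z₂) (φ := φ)) (Z₁ p) w) := by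
    intro w
    rw [← nijenhuisAt_apply_left _ h.assocJ_assocJ, h.assocJ_Z₁]
  refine h.eq_zero_of_horizontal (fun u v w ↦ by rw [map_add]; rfl)
    (fun c v w ↦ by rw [map_smul]; rfl) (nijenhuisAt_swap _) (fun v w hv₁ hv₂ hw₁ hw₂ ↦ ?_) k₁
    (fun w hw₁ hw₂ ↦ by rw [k₂, k₁ w hw₁ hw₂, map_zero, neg_zero]) ?_ v w
  · rw [h.nijenhuisAt_assocJ hv₁ hv₂ hw₁ hw₂, ← h.α₁_pairTensor hv₁ hv₂ hw₁ hw₂,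
      ← h.symm.α₁_pairTensor hv₂ hv₁ hw₂ hw₁, pairTensor_comm (α₁ := α₂), h0, h0]
    simp
  · rw [nijenhuisAt_swap, k₂, nijenhuisAt_self, map_zero, neg_zero, neg_zero]

lemma pairTensor_Z₁_eq_zero (h : IsAlmostContactPair α₁ α₂ Z₁ Z₂ φ)
    (hJ : ∀ v w : TangentSpace I p, nijenhuisAt
      (assocJ_preservesMDiffAt (α₁ := α₁) (α₂ := α₂) (Z₁ := Z₁) (Z₂ := Z₂) (φ := φ)) v w = 0)
    (hT : ∀ v w : TangentSpace I p, nijenhuisAt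
      (assocJ_preservesMDiffAt (α₁ := α₂) (α₂ := α₁) (Z₁ := Z₂) (Z₂ := Z₁) (φ := φ)) v w = 0)
    (w : TangentSpace I p) (hw₁ : α₁ p w = 0) (hw₂ : α₂ p w = 0) :
    pairTensor α₁ α₂ Z₁ Z₂ φ p (Z₁ p) w = 0 := by
  obtain ⟨Y, hY, hY₁, hY₂, rfl⟩ := h.exists_horizontal hw₁ hw₂
  have hφY := φ.mdifferentiableAt_apply hY
  have b := h.bracket_Z₁_horizontal hY hY₁ hY₂
  have c := h.bracket_Z₁_horizontal hφY (fun q ↦ h.α₁_φ _) (fun q ↦ h.α₂_φ _)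
  have e₁ := h.nijenhuisAt_assocJ_Z₁ hY hY₁ hY₂
  have e₂ := h.symm.nijenhuisAt_assocJ_Z₁ hY hY₂ hY₁
  rw [hJ] at e₁
  rw [hT] at e₂
  rw [h.pairTensor_Z₁ hY]
  have e₃ := congrArg (φ p) e₂
  have d₁ : φ p (φ p (mlieBracket I (fun q ↦ Z₂ q) (fun q ↦ φ q (Y q)) p
          - φ p (mlieBracket I (fun q ↦ Z₂ q) Y p))) = -(mlieBracket I (fun q ↦ Z₂ q) (fun q ↦ φ q (Y q)) p
          - φ p (mlieBracket I (fun q ↦ Z₂ q) Y p)) := by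
    have b := h.symm.bracket_Z₁_horizontal hφY (fun q ↦ h.α₂_φ _) (fun q ↦ h.α₁_φ _)
    rw [h.φ_sq, map_sub, map_sub, h.α₁_φ, h.α₂_φ, b.1, b.2]
    simp
  rw [map_zero, map_sub, d₁] at e₃
  generalize mlieBracket I (fun q ↦ Z₂ q) (fun q ↦ φ q (Y q)) p
          - φ p (mlieBracket I (fun q ↦ Z₂ q) Y p) = L₂ at *
  generalize φ p (mlieBracket I (fun q ↦ Z₁ q) (fun q ↦ φ q (Y q)) p
          - φ p (mlieBracket I (fun q ↦ Z₁ q) Y p)) = L₁ at *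
  have e₄ : (2 : ℝ) • L₁ = 0 := by
    rw [two_smul]
    nth_rewrite 1 [eq_comm.1 (sub_eq_zero.1 e₁.symm)]
    rw [sub_neg_eq_add] at e₃
    rw [add_comm]
    exact e₃.symm
  rw [neg_eq_zero]
  simpa using e₄

/-- Normality in terms of a single tensor. -/
theorem isNormalContactPair_iff [I.Boundaryless] [T2Space M]
    (h : IsAlmostContactPair α₁ α₂ Z₁ Z₂ φ) :
    IsNormalContactPair α₁ α₂ Z₁ Z₂ φ ↔
      ∀ (p : M) (v w : TangentSpace I p), pairTensor α₁ α₂ Z₁ Z₂ φ p v w = 0 := by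
  unfold IsNormalContactPair
  rw [assocT_eq_assocJ]
  constructor
  · rintro ⟨hJ, hT⟩ p
    have hJ' := hJ.nijenhuisAt_eq_zero (p := p) assocJ_preservesMDiffAt
    have hT' := hT.nijenhuisAt_eq_zero (p := p) assocJ_preservesMDiffAt
    refine h.eq_zero_of_horizontal pairTensor_add_left pairTensor_smul_left pairTensor_swap
      (fun v w hv₁ hv₂ hw₁ hw₂ ↦ ?_) (h.pairTensor_Z₁_eq_zero hJ' hT') (fun w hw₁ hw₂ ↦ ?_) ?_
    · have e₁ := h.nijenhuisAt_assocJ hv₁ hv₂ hw₁ hw₂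
      have e₂ := h.symm.nijenhuisAt_assocJ hv₂ hv₁ hw₂ hw₁
      rw [hJ'] at e₁
      rw [hT', pairTensor_comm] at e₂
      have e₃ : (2 : ℝ) • pairTensor α₁ α₂ Z₁ Z₂ φ p v w = 0 := by
        have e := congrArg₂ (· + ·) e₁ e₂
        simp only [add_zero] at e
        rw [e]
        module
      simpa using e₃
    · rw [pairTensor_comm]
      exact h.symm.pairTensor_Z₁_eq_zero hT' hJ' w hw₂ hw₁
    · have e := h.pairTensor_Z₁ (Z₂.mdifferentiableAt p)
      have e' : (fun q ↦ φ q (Z₂ q)) = 0 := by ext q; rw [h.φ_Z₂]; rfl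
      rw [h.mlieBracket_Z₁_Z₂, e', mlieBracket_zero_right] at e
      rw [e]
      simp
  · intro h0
    refine ⟨nijenhuisVanishes_of_nijenhuisAt (fun p ↦ assocJ_preservesMDiffAt)
        fun p ↦ h.nijenhuisAt_assocJ_eq_zero (h0 p),
      nijenhuisVanishes_of_nijenhuisAt (fun p ↦ assocJ_preservesMDiffAt)
        fun p ↦ h.symm.nijenhuisAt_assocJ_eq_zero fun v w ↦ ?_⟩
    rw [pairTensor_comm, h0]

lemma invarianceDefect_eq_zero (h : IsAlmostContactPair α₁ α₂ Z₁ Z₂ φ)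
    (h0 : ∀ v w : TangentSpace I p, pairTensor α₁ α₂ Z₁ Z₂ φ p v w = 0) (v w : TangentSpace I p) :
    invarianceDefect α₁ φ p v w = 0 := by
  have hdec : ∀ v : TangentSpace I p,
      v = (-φ p (φ p v)) + α₁ p v • Z₁ p + α₂ p v • Z₂ p := fun v ↦ by rw [h.φ_sq]; module
  have a₁ : ∀ v : TangentSpace I p, α₁ p (-φ p (φ p v)) = 0 := fun v ↦ by rw [map_neg, h.α₁_φ, neg_zero]
  have a₂ : ∀ v : TangentSpace I p, α₂ p (-φ p (φ p v)) = 0 := fun v ↦ by rw [map_neg, h.α₂_φ, neg_zero]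
  have k := h.α₁_pairTensor (a₁ v) (a₂ v) (a₁ w) (a₂ w)
  rw [h0, map_zero] at k
  have z₁ : ∀ v, α₁.d p v (Z₁ p) = 0 := fun v ↦ by rw [α₁.d_swap, h.reeb.dα₁_Z₁, neg_zero]
  have z₂ : ∀ v, α₁.d p v (Z₂ p) = 0 := fun v ↦ by rw [α₁.d_swap, h.reeb.dα₁_Z₂, neg_zero]
  rw [hdec v, hdec w]
  unfold invarianceDefect at k ⊢
  generalize -φ p (φ p v) = v' at *
  generalize -φ p (φ p w) = w' at *
  simp only [map_add, map_smul, h.φ_Z₁, h.φ_Z₂, add_apply, smul_apply, h.reeb.dα₁_Z₁, h.reeb.dα₁_Z₂, z₁, z₂,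
    smul_zero, add_zero]
  exact k.symm

end IsAlmostContactPair
end Pair

section Frobenius

open Metric

variable {E₁ E₂ : Type*} [NormedAddCommGroup E₁] [NormedSpace ℝ E₁]
  [NormedAddCommGroup E₂] [NormedSpace ℝ E₂]

/-- The solution to the equation `g' = A (x + t u, g) u` on `[0, 1]` with `g 0 = y`, staying in a ball. -/
structure IsRadialSolution (A : E₁ × E₂ → E₁ →L[ℝ] E₂) (x : E₁) (y : E₂) (ρ : ℝ) (u : E₁)
    (g : ℝ → E₂) : Prop where
  zero : g 0 = y
  mem : ∀ t ∈ Icc (0 : ℝ) 1, g t ∈ closedBall y ρ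
  deriv : ∀ t ∈ Icc (0 : ℝ) 1, HasDerivWithinAt g (A (x + t • u, g t) u) (Icc 0 1) t

/-- The remainder in the derivative of radial solutions with respect to the direction satisfies a
linear differential inequality. -/
lemma norm_remainder_le {c ρ W C₁ C₂ a b d w' w v u : ℝ} (hC₁ : 0 ≤ C₁) (hC₂ : 0 ≤ C₂)
    (hw : 0 ≤ w) (hv : 0 ≤ v) (hu : 0 ≤ u) (ha0 : 0 ≤ a)
    (huρ : u ≤ ρ) (hvρ : v ≤ 2 * ρ) (hW : w ≤ W) (ha : a ≤ w + c * v)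
    (hw' : w' ≤ C₂ * a ^ 2 * u + b * v + d) (hb : b ≤ C₁ * a + C₂ * a ^ 2) (hd : d ≤ C₁ * w * u) :
    w' ≤ (6 * C₂ * ρ * W + 3 * C₁ * ρ + 1) * w + (6 * C₂ * ρ * c ^ 2 + C₁ * c) * v ^ 2 := by
  have h1 : a ^ 2 ≤ 2 * W * w + 2 * c ^ 2 * v ^ 2 := by
    have : a ^ 2 ≤ (w + c * v) ^ 2 := by gcongr
    have h3 : w ^ 2 ≤ W * w := by rw [sq]; gcongr
    nlinarith [sq_nonneg (w - c * v)]
  have h2 : a * v ≤ 2 * ρ * w + c * v ^ 2 := by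
    have : a * v ≤ (w + c * v) * v := by gcongr
    have h3 : w * v ≤ w * (2 * ρ) := by gcongr
    nlinarith
  have h4 : C₂ * a ^ 2 * u ≤ C₂ * (2 * W * w + 2 * c ^ 2 * v ^ 2) * ρ := by
    gcongr
    exact mul_nonneg hC₂ ((sq_nonneg a).trans h1)
  have h5 : b * v ≤ C₁ * (a * v) + C₂ * a ^ 2 * v := by
    have : b * v ≤ (C₁ * a + C₂ * a ^ 2) * v := by gcongr
    linarith
  have h6 : C₁ * (a * v) ≤ C₁ * (2 * ρ * w + c * v ^ 2) := by gcongr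
  have h7 : C₂ * a ^ 2 * v ≤ C₂ * (2 * W * w + 2 * c ^ 2 * v ^ 2) * (2 * ρ) := by
    gcongr
    exact mul_nonneg hC₂ ((sq_nonneg a).trans h1)
  have h8 : C₁ * w * u ≤ C₁ * w * ρ := by gcongr
  nlinarith

lemma mem_closedBall_prod_of_radial {x u : E₁} {y z : E₂} {ρ t : ℝ} (ht : t ∈ Icc (0 : ℝ) 1)
    (hu : ‖u‖ ≤ ρ) (hz : z ∈ closedBall y ρ) : (x + t • u, z) ∈ closedBall (x, y) ρ := by
  rw [← closedBall_prod_same]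
  refine ⟨?_, hz⟩
  rw [mem_closedBall, dist_self_add_left, norm_smul, Real.norm_of_nonneg ht.1]
  exact (mul_le_of_le_one_left (norm_nonneg _) ht.2).trans hu

lemma exists_forall_norm_radial_sub_le {A : E₁ × E₂ → E₁ →L[ℝ] E₂} {x : E₁} {y : E₂}
    {ρ C₀ C₁ C₂ : ℝ} (hρ : 0 ≤ ρ)
    (hC₀ : 0 ≤ C₀) (hC₁ : 0 ≤ C₁) (hC₂ : 0 ≤ C₂)
    (hA : ∀ q ∈ closedBall (x, y) ρ, DifferentiableAt ℝ A q)
    (h₀ : ∀ q ∈ closedBall (x, y) ρ, ‖A q‖ ≤ C₀)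
    (h₁ : ∀ q ∈ closedBall (x, y) ρ, ‖fderiv ℝ A q‖ ≤ C₁)
    (h₂ : ∀ q ∈ closedBall (x, y) ρ, ∀ q' ∈ closedBall (x, y) ρ,
      ‖A q' - A q - fderiv ℝ A q (q' - q)‖ ≤ C₂ * ‖q' - q‖ ^ 2)
    (hint : ∀ q ∈ closedBall (x, y) ρ, ∀ a b,
      fderiv ℝ A q (a, A q a) b = fderiv ℝ A q (b, A q b) a) :
    ∃ C, ∀ u v g g', ‖u‖ ≤ ρ → ‖u + v‖ ≤ ρ → IsRadialSolution A x y ρ u g →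
      IsRadialSolution A x y ρ (u + v) g' →
      ‖g' 1 - g 1 - A (x + u, g 1) v‖ ≤ C * ‖v‖ ^ 2 := by
  set W := 2 * ρ + C₀ * (2 * ρ) with hW
  set K := 6 * C₂ * ρ * W + 3 * C₁ * ρ + 1 with hK
  have hK0 : 0 < K := by positivity
  set K' := 6 * C₂ * ρ * (1 + C₀) ^ 2 + C₁ * (1 + C₀) with hK'
  refine ⟨K' / K * (Real.exp (K * 1) - 1), fun u v g g' hu huv hg hg' ↦ ?_⟩
  have hv : ‖v‖ ≤ 2 * ρ := by
    have := norm_sub_le (u + v) u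
    rw [add_sub_cancel_left] at this
    linarith
  let q : ℝ → E₁ × E₂ := fun t ↦ (x + t • u, g t)
  let q' : ℝ → E₁ × E₂ := fun t ↦ (x + t • (u + v), g' t)
  have hq : ∀ t ∈ Icc (0 : ℝ) 1, q t ∈ closedBall (x, y) ρ := fun t ht ↦
    mem_closedBall_prod_of_radial ht hu (hg.mem t ht)
  have hq' : ∀ t ∈ Icc (0 : ℝ) 1, q' t ∈ closedBall (x, y) ρ := fun t ht ↦
    mem_closedBall_prod_of_radial ht huv (hg'.mem t ht)
  let w : ℝ → E₂ := fun t ↦ g' t - g t - t • A (q t) v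
  let dw : ℝ → E₂ := fun t ↦ A (q' t) (u + v) - A (q t) u
    - (t • fderiv ℝ A (q t) (u, A (q t) u) v + A (q t) v)
  have hw : ∀ t ∈ Icc (0 : ℝ) 1, HasDerivWithinAt w (dw t) (Icc 0 1) t := by
    intro t ht
    have d1 : HasDerivWithinAt q (u, A (q t) u) (Icc 0 1) t := by
      refine HasDerivWithinAt.prodMk ?_ (hg.deriv t ht)
      simpa using ((hasDerivWithinAt_id t (Icc 0 1)).smul_const u).const_add x
    have d2 := (hA _ (hq t ht)).hasFDerivAt.comp_hasDerivWithinAt t d1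
    have d3 := d2.clm_apply (hasDerivWithinAt_const t (Icc (0 : ℝ) 1) v)
    have d4 := (hasDerivWithinAt_id t (Icc (0 : ℝ) 1)).smul d3
    have d5 := ((hg'.deriv t ht).sub (hg.deriv t ht)).sub d4
    refine d5.congr_deriv ?_
    simp [dw, q, q']
  have hwt : ∀ t ∈ Icc (0 : ℝ) 1, ‖dw t‖ ≤ K * ‖w t‖ + K' * ‖v‖ ^ 2 := by
    intro t ht
    have et : q' t - q t = (t • v, w t + t • A (q t) v) := by
      ext <;> simp [q, q', w]
    have htn : ‖t‖ ≤ 1 := by rw [Real.norm_of_nonneg ht.1]; exact ht.2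
    have hAv : ‖A (q t) v‖ ≤ C₀ * ‖v‖ := (A (q t)).le_of_opNorm_le (h₀ _ (hq t ht)) v
    have htA : ‖t • A (q t) v‖ ≤ C₀ * ‖v‖ := by
      rw [norm_smul]
      exact (mul_le_of_le_one_left (norm_nonneg _) htn).trans hAv
    have hwW : ‖w t‖ ≤ W := by
      have b1 : ‖g' t - g t‖ ≤ 2 * ρ := by
        have := dist_triangle_right (g' t) (g t) y
        rw [dist_eq_norm] at this
        have m1 := mem_closedBall.1 (hg.mem t ht)
        have m2 := mem_closedBall.1 (hg'.mem t ht)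
        linarith
      have b2 : C₀ * ‖v‖ ≤ C₀ * (2 * ρ) := by gcongr
      exact (norm_sub_le _ _).trans (add_le_add b1 (htA.trans b2))
    have hh : ‖q' t - q t‖ ≤ ‖w t‖ + (1 + C₀) * ‖v‖ := by
      rw [et, Prod.norm_def]
      refine max_le ?_ ?_
      · rw [norm_smul]
        have := mul_le_of_le_one_left (norm_nonneg v) htn
        have : 0 ≤ C₀ * ‖v‖ := by positivity
        have := norm_nonneg (w t)
        linarith
      · have := norm_add_le (w t) (t • A (q t) v)
        have := norm_nonneg v
        simp only
        linarith
    have hT := h₂ _ (hq t ht) _ (hq' t ht)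
    have hD := h₁ _ (hq t ht)
    have e1 : dw t = (A (q' t) - A (q t) - fderiv ℝ A (q t) (q' t - q t)) u
        + (A (q' t) - A (q t)) v + fderiv ℝ A (q t) (0, w t) u := by
      have e2 : q' t - q t = t • (v, A (q t) v) + (0, w t) := by
        rw [et]; ext <;> simp [add_comm]
      simp only [dw]
      rw [hint _ (hq t ht), e2]
      simp only [map_add, map_smul, add_apply, sub_apply, smul_apply]
      abel
    have hw' : ‖dw t‖ ≤ C₂ * ‖q' t - q t‖ ^ 2 * ‖u‖ + ‖A (q' t) - A (q t)‖ * ‖v‖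
        + ‖fderiv ℝ A (q t) (0, w t) u‖ := by
      rw [e1]
      refine (norm_add₃_le).trans ?_
      gcongr
      · exact ContinuousLinearMap.le_of_opNorm_le _ hT u
      · exact ContinuousLinearMap.le_opNorm _ _
    refine norm_remainder_le hC₁ hC₂ (c := 1 + C₀) (norm_nonneg _) (norm_nonneg _)
      (norm_nonneg u) (norm_nonneg _) hu hv hwW hh hw' ?_ ?_
    · have := norm_add_le (A (q' t) - A (q t) - fderiv ℝ A (q t) (q' t - q t))
        (fderiv ℝ A (q t) (q' t - q t))
      rw [sub_add_cancel] at this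
      have := ContinuousLinearMap.le_of_opNorm_le _ hD (q' t - q t)
      linarith
    · refine ContinuousLinearMap.le_of_opNorm_le _ ?_ u
      refine (ContinuousLinearMap.le_of_opNorm_le _ hD _).trans ?_
      simp
  have hG := norm_le_gronwallBound_of_norm_deriv_right_le (f := w) (f' := dw) (δ := 0) (K := K)
    (ε := K' * ‖v‖ ^ 2) (a := 0) (b := 1) (fun t ht ↦ (hw t ht).continuousWithinAt)
    (fun t ht ↦ (hw t (Ico_subset_Icc_self ht)).mono_of_mem_nhdsWithin
      (Icc_mem_nhdsGE_of_mem ht)) (by simp [w, hg.zero, hg'.zero])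
    (fun t ht ↦ hwt t (Ico_subset_Icc_self ht)) 1 (by simp)
  rw [gronwallBound_of_K_ne_0 hK0.ne'] at hG
  have e3 : w 1 = g' 1 - g 1 - A (x + u, g 1) v := by simp [w, q]
  rw [e3] at hG
  refine hG.trans (le_of_eq ?_)
  simp only [sub_zero, zero_mul, zero_add]
  ring

lemma exists_isRadialSolution [CompleteSpace E₂] {A : E₁ × E₂ → E₁ →L[ℝ] E₂} {x : E₁} {y : E₂}
    {ρ C₀ C₁ : ℝ} (hρ : 0 ≤ ρ) (hC₀ : 0 ≤ C₀) (hC₁ : 0 ≤ C₁)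
    (hA : ∀ q ∈ closedBall (x, y) ρ, DifferentiableAt ℝ A q)
    (h₀ : ∀ q ∈ closedBall (x, y) ρ, ‖A q‖ ≤ C₀)
    (h₁ : ∀ q ∈ closedBall (x, y) ρ, ‖fderiv ℝ A q‖ ≤ C₁) {u : E₁} (hu : ‖u‖ ≤ ρ)
    (huC : C₀ * ‖u‖ ≤ ρ) : ∃ g, IsRadialSolution A x y ρ u g := by
  have hP : IsPicardLindelof (fun t z ↦ A (x + t • u, z) u) (tmin := 0) (tmax := 1)
      ⟨0, by simp⟩ y (.mk ρ hρ) 0 (.mk (C₀ * ‖u‖) (by positivity))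
      (.mk (C₁ * ‖u‖) (by positivity)) := by
    refine ⟨fun t ht ↦ ?_, fun z hz t ht ↦ ?_, fun t ht z hz ↦ ?_, ?_⟩
    · refine LipschitzOnWith.of_dist_le_mul fun z hz z' hz' ↦ ?_
      have hc := (convex_closedBall (x, y) ρ).norm_image_sub_le_of_norm_fderiv_le hA h₁
        (mem_closedBall_prod_of_radial ht hu hz') (mem_closedBall_prod_of_radial ht hu hz)
      rw [dist_eq_norm, ← sub_apply, dist_eq_norm]
      refine (ContinuousLinearMap.le_of_opNorm_le _ hc u).trans (le_of_eq ?_)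
      have : ((x + t • u, z) - (x + t • u, z') : E₁ × E₂) = (0, z - z') := by simp
      rw [this]
      simp
      ring
    · have h1 := (hA _ (mem_closedBall_prod_of_radial ht hu hz)).continuousAt
      have h2 : ContinuousAt (fun t : ℝ ↦ (x + t • u, z)) t := by fun_prop
      have h3 : ContinuousAt (fun t : ℝ ↦ A (x + t • u, z)) t := ContinuousAt.comp (f := fun t : ℝ ↦ (x + t • u, z)) h1 h2
      exact (h3.clm_apply continuousAt_const).continuousWithinAt
    · exact ContinuousLinearMap.le_of_opNorm_le _ (h₀ _ (mem_closedBall_prod_of_radial ht hu hz)) u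
    · simpa using huC
  obtain ⟨α, hα⟩ := ODE.FunSpace.exists_isFixedPt_next hP (mem_closedBall_self le_rfl)
  have hmem : ∀ t, α.compProj t ∈ closedBall y ρ := fun t ↦ α.compProj_mem_closedBall hP.mul_max_le
  have h0 : α.compProj 0 = y := by
    have := ODE.FunSpace.compProj_val (α := α) (t := ⟨0, by simp⟩)
    refine this.trans ?_
    rw [← hα, ODE.FunSpace.next_apply₀]
  refine ⟨α.compProj, h0, fun t _ ↦ hmem t, fun t ht ↦ ?_⟩
  refine (ODE.hasDerivWithinAt_picard_Icc (t₀ := 0) (by simp) hP.continuousOn_uncurry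
    α.continuous_compProj.continuousOn (fun t _ ↦ hmem t) y ht).congr_of_mem (fun t' ht' ↦ ?_) ht
  nth_rw 1 [← hα]
  rw [ODE.FunSpace.compProj_of_mem ht', ODE.FunSpace.next_apply]

set_option synthInstance.maxHeartbeats 200000 in
lemma exists_closedBall_bounds {A : E₁ × E₂ → E₁ →L[ℝ] E₂} {q₀ : E₁ × E₂}
    (hA : ContDiffAt ℝ 2 A q₀) {P : E₁ × E₂ → Prop} (hP : ∀ᶠ q in 𝓝 q₀, P q) :
    ∃ ρ > 0, ∃ C₀ ≥ 0, ∃ C₁ ≥ 0, ∃ C₂ ≥ 0,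
      (∀ q ∈ closedBall q₀ ρ, DifferentiableAt ℝ A q) ∧ (∀ q ∈ closedBall q₀ ρ, ‖A q‖ ≤ C₀) ∧
      (∀ q ∈ closedBall q₀ ρ, ‖fderiv ℝ A q‖ ≤ C₁) ∧
      (∀ q ∈ closedBall q₀ ρ, ∀ q' ∈ closedBall q₀ ρ,
        ‖A q' - A q - fderiv ℝ A q (q' - q)‖ ≤ C₂ * ‖q' - q‖ ^ 2) ∧
      ∀ q ∈ closedBall q₀ ρ, P q := by
  have hd : ∀ᶠ q in 𝓝 q₀, DifferentiableAt ℝ A q :=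
    (hA.eventually (by simp)).mono fun q hq ↦ hq.differentiableAt (by simp)
  have hA' : ContDiffAt ℝ 1 (fderiv ℝ A) q₀ := hA.fderiv_right (by norm_num)
  obtain ⟨L, s, hs, hL⟩ := hA'.exists_lipschitzOnWith
  have b0 : ∀ᶠ q in 𝓝 q₀, ‖A q‖ ≤ ‖A q₀‖ + 1 :=
    (hA.continuousAt.norm.eventually_lt_const (lt_add_one _)).mono fun q hq ↦ hq.le
  have b1 : ∀ᶠ q in 𝓝 q₀, ‖fderiv ℝ A q‖ ≤ ‖fderiv ℝ A q₀‖ + 1 :=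
    (hA'.continuousAt.eventually (ball_mem_nhds _ one_pos)).mono fun q hq ↦ by
      have h := mem_ball_iff_norm.1 hq
      have h' := norm_sub_norm_le (fderiv ℝ A q) (fderiv ℝ A q₀)
      linarith
  obtain ⟨ρ, hρ, hball⟩ := Metric.nhds_basis_closedBall.eventually_iff.1
    (hd.and (b0.and (b1.and (hP.and (eventually_mem_set.2 hs)))))
  refine ⟨ρ, hρ, ‖A q₀‖ + 1, by positivity, ‖fderiv ℝ A q₀‖ + 1, by positivity, L, L.2,
    fun q hq ↦ (hball hq).1, fun q hq ↦ (hball hq).2.1, fun q hq ↦ (hball hq).2.2.1,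
    fun q hq q' hq' ↦ ?_, fun q hq ↦ (hball hq).2.2.2.1⟩
  have hc : Convex ℝ (closedBall q₀ ρ ∩ closedBall q ‖q' - q‖) :=
    (convex_closedBall _ _).inter (convex_closedBall _ _)
  have := hc.norm_image_sub_le_of_norm_fderiv_le' (f := A) (φ := fderiv ℝ A q)
    (C := L * ‖q' - q‖) (fun z hz ↦ (hball hz.1).1) (fun z hz ↦ ?_)
    ⟨hq, mem_closedBall_self (norm_nonneg _)⟩ ⟨hq', by rw [mem_closedBall, dist_eq_norm]⟩
  · rwa [mul_assoc, ← sq] at this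
  · refine (hL.norm_sub_le (hball hz.1).2.2.2.2 (hball hq).2.2.2.2).trans ?_
    have := hz.2
    rw [mem_closedBall, dist_eq_norm] at this
    gcongr

/-- The theorem of Frobenius: the total differential equation `df = A (x, f x)` has
local solutions if its integrability condition holds. -/
theorem exists_hasFDerivAt_of_integrable [CompleteSpace E₂] {A : E₁ × E₂ → E₁ →L[ℝ] E₂} {x : E₁}
    {y : E₂} (hA : ContDiffAt ℝ 2 A (x, y))
    (hint : ∀ᶠ q in 𝓝 (x, y), ∀ a b, fderiv ℝ A q (a, A q a) b = fderiv ℝ A q (b, A q b) a) :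
    ∃ f : E₁ → E₂, f x = y ∧ ∀ᶠ z in 𝓝 x, HasFDerivAt f (A (z, f z)) z := by
  obtain ⟨ρ, hρ, C₀, hC₀, C₁, hC₁, C₂, hC₂, hd, h₀, h₁, h₂, hi⟩ := exists_closedBall_bounds hA hint
  obtain ⟨C, hC⟩ := exists_forall_norm_radial_sub_le hρ.le hC₀ hC₁ hC₂ hd h₀ h₁ h₂ hi
  set δ := min ρ (ρ / (C₀ + 1)) with hδ
  have hδ0 : 0 < δ := by positivity
  have hδρ : δ ≤ ρ := min_le_left _ _
  have hδC : C₀ * δ ≤ ρ := by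
    have h : δ ≤ ρ / (C₀ + 1) := min_le_right _ _
    rw [le_div_iff₀ (by positivity)] at h
    linarith
  have hex : ∀ u, ∃ g, ‖u‖ < δ → IsRadialSolution A x y ρ u g := fun u ↦ by
    by_cases hu : ‖u‖ < δ
    · obtain ⟨g, hg⟩ := exists_isRadialSolution hρ.le hC₀ hC₁ hd h₀ h₁ (u := u) (hu.le.trans hδρ)
        ((mul_le_mul_of_nonneg_left hu.le hC₀).trans hδC)
      exact ⟨g, fun _ ↦ hg⟩
    · exact ⟨0, fun h ↦ absurd h hu⟩
  choose g hg using hex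
  refine ⟨fun z ↦ g (z - x) 1, ?_, ?_⟩
  · have h := hg 0 (by simpa)
    have := constant_of_has_deriv_right_zero
      (fun t ht ↦ (h.deriv t ht).continuousWithinAt)
      (fun t ht ↦ ((h.deriv t (Ico_subset_Icc_self ht)).mono_of_mem_nhdsWithin
      (Icc_mem_nhdsGE_of_mem ht)).congr_deriv (map_zero _)) 1 (by simp)
    simp only [sub_self]
    rw [this, h.zero]
  · filter_upwards [ball_mem_nhds x hδ0] with z hz
    have hz' : ‖z - x‖ < δ := by rwa [mem_ball, dist_eq_norm] at hz
    rw [hasFDerivAt_iff_isLittleO_nhds_zero]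
    have hO : (fun v ↦ g (z + v - x) 1 - g (z - x) 1 - A (z, g (z - x) 1) v) =O[𝓝 0]
        fun v ↦ ‖v‖ ^ 2 := by
      refine Asymptotics.IsBigO.of_bound C ?_
      have : ∀ᶠ v in 𝓝 (0 : E₁), ‖z + v - x‖ < δ := by
        have hc : ContinuousAt (fun v : E₁ ↦ ‖z + v - x‖) 0 := by fun_prop
        exact hc.eventually_lt_const (by simpa)
      filter_upwards [this] with v hv
      have e : z + v - x = z - x + v := by abel
      have := hC (z - x) v (g (z - x)) (g (z - x + v)) (hz'.le.trans hδρ)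
        (by rw [← e]; exact hv.le.trans hδρ) (hg _ hz') (hg _ (by rwa [← e]))
      rw [e]
      simpa using this
    exact hO.trans_isLittleO (Asymptotics.isLittleO_norm_pow_id one_lt_two)

lemma contDiffAt_of_hasFDerivAt {A : E₁ × E₂ → E₁ →L[ℝ] E₂} {x : E₁} {f : E₁ → E₂}
    (hA : ContDiffAt ℝ ∞ A (x, f x)) (hf : ∀ᶠ z in 𝓝 x, HasFDerivAt f (A (z, f z)) z) :
    ContDiffAt ℝ ∞ f x := by
  rw [contDiffAt_infty]
  intro n
  induction n with
  | zero =>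
    exact contDiffAt_zero.2 ⟨_, hf, fun z (hz : HasFDerivAt f (A (z, f z)) z) ↦
      hz.continuousAt.continuousWithinAt⟩
  | succ n ih =>
    refine contDiffAt_succ_iff_hasFDerivAt.2 ⟨fun z ↦ A (z, f z), ⟨_, hf, fun z hz ↦ hz⟩, ?_⟩
    exact ContDiffAt.comp x (hA.of_le (by exact_mod_cast le_top)) (contDiffAt_id.prodMk ih)

end Frobenius

section Gronwall

variable {E' V : Type*} [NormedAddCommGroup E'] [NormedSpace ℝ E']
  [NormedAddCommGroup V] [NormedSpace ℝ V]

/-- A function that vanishes at a point and satisfies a linear differential inequality near this point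
vanishes near this point. -/
lemma eventually_eq_zero_of_norm_fderiv_le {c : E' → V} {z₀ : E'} {K : ℝ} (h0 : c z₀ = 0)
    (hd : ∀ᶠ z in 𝓝 z₀, DifferentiableAt ℝ c z)
    (hK : ∀ᶠ z in 𝓝 z₀, ‖fderiv ℝ c z‖ ≤ K * ‖c z‖) : ∀ᶠ z in 𝓝 z₀, c z = 0 := by
  obtain ⟨ε, hε, hb⟩ := Metric.nhds_basis_ball.eventually_iff.1 (hd.and hK)
  filter_upwards [Metric.ball_mem_nhds z₀ hε] with z hz
  have hseg : ∀ t ∈ Icc (0 : ℝ) 1, z₀ + t • (z - z₀) ∈ Metric.ball z₀ ε := fun t ht ↦ by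
    rw [Metric.mem_ball, dist_self_add_left, norm_smul, Real.norm_of_nonneg ht.1]
    rw [Metric.mem_ball, dist_eq_norm] at hz
    exact (mul_le_of_le_one_left (norm_nonneg _) ht.2).trans_lt hz
  have hder : ∀ t ∈ Icc (0 : ℝ) 1, HasDerivAt (fun t : ℝ ↦ c (z₀ + t • (z - z₀)))
      (fderiv ℝ c (z₀ + t • (z - z₀)) (z - z₀)) t := fun t ht ↦ by
    refine (hb (hseg t ht)).1.hasFDerivAt.comp_hasDerivAt t ?_
    simpa using ((hasDerivAt_id t).smul_const (z - z₀)).const_add z₀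
  have := eq_zero_of_abs_deriv_le_mul_abs_self_of_eq_zero_right (K := K * ‖z - z₀‖)
    (fun t ht ↦ (hder t ht).continuousAt.continuousWithinAt)
    (fun t ht ↦ (hder t (Ico_subset_Icc_self ht)).hasDerivWithinAt) (by simpa using h0)
    (fun t ht ↦ by
      refine (ContinuousLinearMap.le_of_opNorm_le _ (hb (hseg t (Ico_subset_Icc_self ht))).2 _).trans ?_
      exact le_of_eq (by ring)) 1 (by simp)
  simpa using this

end Gronwall

section Plaques

variable {E : Type*} [NormedAddCommGroup E] [NormedSpace ℝ E] [FiniteDimensional ℝ E]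
  {H : Type*} [TopologicalSpace H] {I : ModelWithCorners ℝ E H} [I.Boundaryless]
  {M : Type u} [TopologicalSpace M] [ChartedSpace H M] [IsManifold I ∞ M]

/-- A plaque through `p` of a distribution `D` of rank `r`, together with a projection to
its parameter domain, and a function with values in a vector space that vanishes
exactly on the plaque. -/
structure PlaqueChart (D : ∀ p : M, Submodule ℝ (TangentSpace I p)) (r : ℕ) (p : M) where
  C : Submodule ℝ E
  O : Set M
  U : Set (EuclideanSpace ℝ (Fin r))
  proj : M → EuclideanSpace ℝ (Fin r)
  defect : M → C
  plaque : EuclideanSpace ℝ (Fin r) → M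
  K : ℝ
  isOpen_O : IsOpen O
  isOpen_U : IsOpen U
  mem : p ∈ O
  defect_self : defect p = 0
  contMDiffAt_proj : ∀ q ∈ O, ContMDiffAt I (𝓡 r) ∞ proj q
  contMDiffAt_defect : ∀ q ∈ O, ContMDiffAt I 𝓘(ℝ, C) ∞ defect q
  contMDiffAt_plaque : ∀ x ∈ U, ContMDiffAt (𝓡 r) I ∞ plaque x
  plaque_mem : ∀ x ∈ U, plaque x ∈ O
  proj_plaque : ∀ x ∈ U, proj (plaque x) = x
  defect_plaque : ∀ x ∈ U, defect (plaque x) = 0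
  proj_mem : ∀ q ∈ O, defect q = 0 → proj q ∈ U
  plaque_proj : ∀ q ∈ O, defect q = 0 → plaque (proj q) = q
  range_mfderiv : ∀ x ∈ U, (mfderiv (𝓡 r) I plaque x).toLinearMap.range = D (plaque x)
  K_nonneg : 0 ≤ K
  norm_le : ∀ q ∈ O, ∀ v ∈ D q,
    ‖mvfderiv I defect q v‖ ≤ K * ‖defect q‖ * ‖mvfderiv I proj q v‖

namespace PlaqueChart

variable {D : ∀ p : M, Submodule ℝ (TangentSpace I p)} {r : ℕ} {p : M}

/-- A smooth map tangent to the distribution stays locally in a plaque. -/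
lemma eventually_defect_eq_zero (B : PlaqueChart D r p) {E' : Type*} [NormedAddCommGroup E']
    [NormedSpace ℝ E'] {H' : Type*} [TopologicalSpace H'] {I' : ModelWithCorners ℝ E' H'}
    [I'.Boundaryless] {N : Type*} [TopologicalSpace N] [ChartedSpace H' N] [IsManifold I' ∞ N]
    {γ : N → M} {z₀ : N} (hγ : ContMDiffAt I' I ∞ γ z₀)
    (ht : ∀ᶠ z in 𝓝 z₀, ∀ w, mfderiv I' I γ z w ∈ D (γ z)) (hO : γ z₀ ∈ B.O)
    (h0 : B.defect (γ z₀) = 0) : ∀ᶠ z in 𝓝 z₀, B.defect (γ z) = 0 := by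
  set χ := extChartAt I' z₀ with hχ
  have hFγ : ContMDiffAt I' 𝓘(ℝ, B.C) ∞ (fun z ↦ B.defect (γ z)) z₀ :=
    ContMDiffAt.comp z₀ (B.contMDiffAt_defect _ hO) hγ
  have hpγ : ContMDiffAt I' 𝓘(ℝ, EuclideanSpace ℝ (Fin r)) ∞ (fun z ↦ B.proj (γ z)) z₀ :=
    ContMDiffAt.comp z₀ (B.contMDiffAt_proj _ hO) hγ
  have hc := contDiffAt_comp_extChartAt_symm le_rfl hFγ
  have ha := contDiffAt_comp_extChartAt_symm le_rfl hpγ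
  have hev : ∀ᶠ z in 𝓝 z₀, MDiffAt γ z :=
    ((contMDiffAt_iff_contMDiffAt_nhds (n := 1) (by simp)).1 (hγ.of_le (by simp))).mono
      fun z hz ↦ hz.mdifferentiableAt (by simp)
  have hOev : ∀ᶠ z in 𝓝 z₀, γ z ∈ B.O := hγ.continuousAt.eventually (B.isOpen_O.mem_nhds hO)
  have hsrc : ∀ᶠ z in 𝓝 z₀, z ∈ (chartAt H' z₀).source :=
    (chartAt H' z₀).open_source.mem_nhds (mem_chart_source H' z₀)
  have ha' : ContinuousAt (fderiv ℝ fun e ↦ B.proj (γ (χ.symm e))) (χ z₀) :=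
    (ha.fderiv_right (m := 0) (by simp)).continuousAt
  have hab : ∀ᶠ e in 𝓝 (χ z₀), ‖fderiv ℝ (fun e ↦ B.proj (γ (χ.symm e))) e‖ ≤
      ‖fderiv ℝ (fun e ↦ B.proj (γ (χ.symm e))) (χ z₀)‖ + 1 :=
    (ha'.eventually (Metric.ball_mem_nhds _ one_pos)).mono fun q hq ↦ by
      have h := mem_ball_iff_norm.1 hq
      have h' := norm_sub_norm_le (fderiv ℝ (fun e ↦ B.proj (γ (χ.symm e))) q)
        (fderiv ℝ (fun e ↦ B.proj (γ (χ.symm e))) (χ z₀))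
      linarith
  set K₂ := ‖fderiv ℝ (fun e ↦ B.proj (γ (χ.symm e))) (χ z₀)‖ + 1
  have hab' : ∀ᶠ z in 𝓝 z₀, ‖fderiv ℝ (fun e ↦ B.proj (γ (χ.symm e))) (χ z)‖ ≤ K₂ :=
    (continuousAt_extChartAt (I := I') z₀).eventually hab
  have hd : ∀ᶠ e in 𝓝 (χ z₀), DifferentiableAt ℝ (fun e ↦ B.defect (γ (χ.symm e))) e :=
    ((hc.of_le (show (1 : ℕ∞ω) ≤ ∞ by simp)).eventually (by simp)).mono
      fun e he ↦ he.differentiableAt (by simp)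
  have hmap := map_extChartAt_nhds_of_boundaryless (I := I') z₀
  have hkey : ∀ᶠ z in 𝓝 z₀, ‖fderiv ℝ (fun e ↦ B.defect (γ (χ.symm e))) (χ z)‖ ≤
      (B.K * K₂) * ‖B.defect (γ (χ.symm (χ z)))‖ := by
    filter_upwards [hev, hOev, hsrc, hab', ht] with z h1 h2 h3 h4 h5
    have hz : χ.symm (χ z) = z := (extChartAt I' z₀).left_inv (by rwa [extChartAt_source])
    have m1 := (B.contMDiffAt_defect _ h2).mdifferentiableAt (by simp)
    have m2 : MDiffAt B.proj (γ z) := (B.contMDiffAt_proj _ h2).mdifferentiableAt (by simp)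
    have m3 : MDifferentiableAt I' 𝓘(ℝ, B.C) (fun z ↦ B.defect (γ z)) z := MDifferentiableAt.comp z m1 h1
    have m4 : MDiffAt (fun z ↦ B.proj (γ z)) z := MDifferentiableAt.comp z m2 h1
    rw [hz]
    have hK₂ : 0 ≤ K₂ := (norm_nonneg _).trans h4
    refine ContinuousLinearMap.opNorm_le_bound _
      (mul_nonneg (mul_nonneg B.K_nonneg hK₂) (norm_nonneg _)) fun w ↦ ?_
    obtain ⟨v, rfl⟩ := mvfderiv_extChartAt_surjective (I := I') h3 w
    have e1 := mvfderiv_eq_fderiv_extChartAt h3 m3 v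
    have e2 := mvfderiv_eq_fderiv_extChartAt h3 m4 v
    rw [mvfderiv_comp_apply' m1 h1] at e1
    rw [mvfderiv_comp_apply' m2 h1] at e2
    have e3 := B.norm_le _ h2 _ (h5 v)
    have e4 := ContinuousLinearMap.le_of_opNorm_le _ h4 (mvfderiv I' (extChartAt I' z₀) z v)
    rw [← e1]
    rw [← e2] at e4
    refine e3.trans ?_
    calc _ ≤ B.K * ‖B.defect (γ z)‖ * (K₂ * ‖mvfderiv I' (extChartAt I' z₀) z v‖) := by
          have := B.K_nonneg
          gcongr
      _ = _ := by ring
  have hfin := eventually_eq_zero_of_norm_fderiv_le (z₀ := χ z₀) (K := B.K * K₂)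
    (c := fun e ↦ B.defect (γ (χ.symm e))) (by simpa [hχ, extChartAt_to_inv] using h0) hd
    (by rw [← hmap]; exact hkey)
  have := (continuousAt_extChartAt (I := I') z₀).eventually hfin
  filter_upwards [this, hsrc] with z hz h3
  rwa [(extChartAt I' z₀).left_inv (by rwa [extChartAt_source])] at hz

lemma injective_mfderiv (B : PlaqueChart D r p) {x : EuclideanSpace ℝ (Fin r)} (hx : x ∈ B.U) :
    Function.Injective (mfderiv (𝓡 r) I B.plaque x) := by
  have h1 := (B.contMDiffAt_plaque x hx).mdifferentiableAt (by simp)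
  have h2 : MDiffAt B.proj (B.plaque x) :=
    (B.contMDiffAt_proj _ (B.plaque_mem x hx)).mdifferentiableAt (by simp)
  have h3 : (fun x ↦ B.proj (B.plaque x)) =ᶠ[𝓝 x] id := by
    filter_upwards [B.isOpen_U.mem_nhds hx] with y hy using B.proj_plaque y hy
  rw [injective_iff_map_eq_zero]
  intro v hv
  have h4 := mvfderiv_comp_apply' h2 h1 v
  rw [hv, map_zero, h3.mvfderiv_eq, mvfderiv_apply_eq_mfderiv, mfderiv_id] at h4
  exact h4

/-- The chart of the leaf topology given by a plaque. -/
def toPartialEquiv (B : PlaqueChart D r p) : PartialEquiv M (EuclideanSpace ℝ (Fin r)) where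
  toFun := B.proj
  invFun := B.plaque
  source := {q | q ∈ B.O ∧ B.defect q = 0}
  target := B.U
  map_source' q hq := B.proj_mem q hq.1 hq.2
  map_target' x hx := ⟨B.plaque_mem x hx, B.defect_plaque x hx⟩
  left_inv' q hq := B.plaque_proj q hq.1 hq.2
  right_inv' x hx := B.proj_plaque x hx

/-- A smooth map tangent to the distribution stays locally in a plaque. -/
lemma eventually_mem_source (B : PlaqueChart D r p) {E' : Type*} [NormedAddCommGroup E']
    [NormedSpace ℝ E'] {H' : Type*} [TopologicalSpace H'] {I' : ModelWithCorners ℝ E' H'}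
    [I'.Boundaryless] {N : Type*} [TopologicalSpace N] [ChartedSpace H' N] [IsManifold I' ∞ N]
    {γ : N → M} {z₀ : N} (hγ : ContMDiffAt I' I ∞ γ z₀)
    (ht : ∀ᶠ z in 𝓝 z₀, ∀ w, mfderiv I' I γ z w ∈ D (γ z)) (h : γ z₀ ∈ B.toPartialEquiv.source) :
    ∀ᶠ z in 𝓝 z₀, γ z ∈ B.toPartialEquiv.source :=
  (hγ.continuousAt.eventually (B.isOpen_O.mem_nhds h.1)).and
    (B.eventually_defect_eq_zero hγ ht h.1 h.2)

lemma mfderiv_plaque_mem (B : PlaqueChart D r p) {x : EuclideanSpace ℝ (Fin r)} (hx : x ∈ B.U)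
    (w : TangentSpace (𝓡 r) x) : mfderiv (𝓡 r) I B.plaque x w ∈ D (B.plaque x) := by
  rw [← B.range_mfderiv x hx]
  exact ⟨w, rfl⟩

lemma contDiffAt_proj_plaque {q : M} (B : PlaqueChart D r p) (B' : PlaqueChart D r q)
    {x : EuclideanSpace ℝ (Fin r)} (hx : x ∈ B.U) (h : B.plaque x ∈ B'.O) :
    ContDiffAt ℝ ∞ (fun x ↦ B'.proj (B.plaque x)) x :=
  contMDiffAt_iff_contDiffAt.1
    (ContMDiffAt.comp x (B'.contMDiffAt_proj _ h) (B.contMDiffAt_plaque x hx))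

end PlaqueChart

variable {D : ∀ p : M, Submodule ℝ (TangentSpace I p)} {r : ℕ}

/-- The charts of the leaf topology. -/
def leafCore (B : ∀ p, PlaqueChart D r p) : ChartedSpaceCore (EuclideanSpace ℝ (Fin r)) M where
  atlas := range fun p ↦ (B p).toPartialEquiv
  chartAt p := (B p).toPartialEquiv
  mem_chart_source p := ⟨(B p).mem, (B p).defect_self⟩
  chart_mem_atlas := mem_range_self
  open_source := by
    rintro _ _ ⟨p, rfl⟩ ⟨q, rfl⟩
    rw [isOpen_iff_mem_nhds]
    rintro x ⟨hx, hx'⟩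
    have hx : x ∈ (B p).U := hx
    filter_upwards [(B p).isOpen_U.mem_nhds hx, (B q).eventually_mem_source
      ((B p).contMDiffAt_plaque x hx) ((eventually_mem_set.2 ((B p).isOpen_U.mem_nhds hx)).mono
        fun y hy w ↦ (B p).mfderiv_plaque_mem hy w) hx'] with y hy hy'
    exact ⟨hy, hy'⟩
  continuousOn_toFun := by
    rintro _ _ ⟨p, rfl⟩ ⟨q, rfl⟩ x ⟨hx, hx'⟩
    exact ((B p).contDiffAt_proj_plaque (B q) hx hx'.1).continuousAt.continuousWithinAt

/-- The manifold `M` with the leaf topology. -/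
def LeafSpace (_B : ∀ p, PlaqueChart D r p) : Type u := M

namespace LeafSpace

variable (B : ∀ p, PlaqueChart D r p)

instance : TopologicalSpace (LeafSpace B) := (leafCore B).toTopologicalSpace

noncomputable instance : ChartedSpace (EuclideanSpace ℝ (Fin r)) (LeafSpace B) := (leafCore B).toChartedSpace

instance : IsManifold (𝓡 r) ∞ (LeafSpace B) := by
  refine isManifold_of_contDiffOn _ _ _ fun e e' he he' ↦ ?_
  have key : ∀ e ∈ atlas (EuclideanSpace ℝ (Fin r)) (LeafSpace B), ∃ p,
      e = (leafCore B).openPartialHomeomorph (B p).toPartialEquiv ⟨p, rfl⟩ := by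
    intro e he
    obtain ⟨_, ⟨p, rfl⟩, h⟩ := mem_iUnion₂.1 he
    exact ⟨p, h⟩
  obtain ⟨p, rfl⟩ := key e he
  obtain ⟨q, rfl⟩ := key e' he'
  rintro x ⟨hx, -⟩
  exact ((B p).contDiffAt_proj_plaque (B q) hx.1 hx.2.1).contDiffWithinAt

/-- The identity map from the leaf topology to the manifold. -/
def toManifold (x : LeafSpace B) : M := x

/-- The identity map from the manifold to the leaf topology. -/
def ofManifold (x : M) : LeafSpace B := x

lemma continuousAt_ofManifold {N : Type*} [TopologicalSpace N] {E' : Type*} [NormedAddCommGroup E']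
    [NormedSpace ℝ E'] {H' : Type*} [TopologicalSpace H'] {I' : ModelWithCorners ℝ E' H'}
    [I'.Boundaryless] [ChartedSpace H' N] [IsManifold I' ∞ N]
    {γ : N → M} {z₀ : N} (hγ : ContMDiffAt I' I ∞ γ z₀)
    (ht : ∀ᶠ z in 𝓝 z₀, ∀ w, mfderiv I' I γ z w ∈ D (γ z)) :
    ContinuousAt (fun z ↦ ofManifold B (γ z)) z₀ := by
  let e := chartAt (EuclideanSpace ℝ (Fin r)) (ofManifold B (γ z₀))
  have hsrc := (B (γ z₀)).eventually_mem_source hγ ht ⟨(B (γ z₀)).mem, (B (γ z₀)).defect_self⟩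
  refine (e.continuousAt_iff_continuousAt_comp_left (f := fun z ↦ ofManifold B (γ z)) hsrc).2 ?_
  exact ContinuousAt.comp (g := (B (γ z₀)).proj)
    ((B (γ z₀)).contMDiffAt_proj _ (B (γ z₀)).mem).continuousAt hγ.continuousAt

/-- The leaf through a point, as an open subset of the leaf space. -/
noncomputable def leaf (p : M) : TopologicalSpace.Opens (LeafSpace B) :=
  ⟨connectedComponent (ofManifold B p), by
    have := ChartedSpace.locallyConnectedSpace (EuclideanSpace ℝ (Fin r)) (LeafSpace B)
    exact isOpen_connectedComponent⟩

/-- The inclusion of a leaf. -/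
noncomputable def leafInclusion (p : M) (x : leaf B p) : M := toManifold B x.1

lemma leafInclusion_eventuallyEq (p : M) (x : leaf B p) :
    leafInclusion B p =ᶠ[𝓝 x] fun y ↦ (B (toManifold B x.1)).plaque (extChartAt (𝓡 r) x y) := by
  have h : ∀ᶠ y : leaf B p in 𝓝 x, y.1 ∈ (chartAt (EuclideanSpace ℝ (Fin r)) x.1).source :=
    continuous_subtype_val.continuousAt.eventually
      ((chartAt (EuclideanSpace ℝ (Fin r)) x.1).open_source.mem_nhds (mem_chart_source _ x.1))
  filter_upwards [h] with y hy
  exact ((B (toManifold B x.1)).plaque_proj y.1 hy.1 hy.2).symm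

lemma extChartAt_mem (p : M) (x : leaf B p) :
    extChartAt (𝓡 r) x x ∈ (B (toManifold B x.1)).U :=
  (B (toManifold B x.1)).proj_mem _ (B (toManifold B x.1)).mem (B (toManifold B x.1)).defect_self

lemma isIntegralManifold_leafInclusion (p : M) :
    IsIntegralManifold (I := I) D r (leafInclusion B p) := by
  have hder : ∀ x v, mfderiv (𝓡 r) I (leafInclusion B p) x v =
      mfderiv (𝓡 r) I (B (toManifold B x.1)).plaque (extChartAt (𝓡 r) x x)
        (mvfderiv (𝓡 r) (extChartAt (𝓡 r) x) x v) := by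
    intro x v
    rw [(leafInclusion_eventuallyEq B p x).mfderiv_eq]
    exact mfderiv_comp_apply x
      (((B (toManifold B x.1)).contMDiffAt_plaque _ (extChartAt_mem B p x)).mdifferentiableAt (by simp))
      (mdifferentiableAt_extChartAt' (I := 𝓡 r) (mem_chart_source _ x)) v
  have hself : ∀ x, leafInclusion B p x = (B (toManifold B x.1)).plaque (extChartAt (𝓡 r) x x) :=
    fun x ↦ (leafInclusion_eventuallyEq B p x).self_of_nhds
  refine ⟨fun x ↦ ?_, fun x y h ↦ Subtype.ext h, fun x ↦ ?_, fun x ↦ ?_⟩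
  · refine ContMDiffAt.congr_of_eventuallyEq ?_ (leafInclusion_eventuallyEq B p x)
    exact ContMDiffAt.comp x ((B (toManifold B x.1)).contMDiffAt_plaque _ (extChartAt_mem B p x))
      (contMDiffAt_extChartAt (I := 𝓡 r))
  · intro v w h
    rw [hder, hder] at h
    exact mvfderiv_extChartAt_injective (mem_chart_source _ x)
      ((B (toManifold B x.1)).injective_mfderiv (extChartAt_mem B p x) h)
  · have hr := (B (toManifold B x.1)).range_mfderiv _ (extChartAt_mem B p x)
    rw [← hself x] at hr
    rw [← hr]
    ext w
    constructor
    · rintro ⟨v, rfl⟩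
      exact ⟨_, (hder x v).symm⟩
    · rintro ⟨v, rfl⟩
      obtain ⟨v', rfl⟩ := mvfderiv_extChartAt_surjective (I := 𝓡 r) (mem_chart_source _ x) v
      exact ⟨v', hder x v'⟩

lemma range_leafInclusion (p : M) :
    range (leafInclusion B p) = toManifold B '' connectedComponent (ofManifold B p) := by
  ext q
  constructor
  · rintro ⟨x, rfl⟩
    exact ⟨x.1, x.2, rfl⟩
  · rintro ⟨x, hx, rfl⟩
    exact ⟨⟨x, hx⟩, rfl⟩

lemma mem_range_leafInclusion (p : M) : p ∈ range (leafInclusion B p) := by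
  rw [range_leafInclusion]
  exact ⟨ofManifold B p, mem_connectedComponent, rfl⟩

theorem isLeaf_leafInclusion (p : M) : IsLeaf (I := I) D r (leafInclusion B p) where
  connected := isConnected_iff_connectedSpace.1 isConnected_connectedComponent
  integral := isIntegralManifold_leafInclusion B p
  maximal L' _ _ _ _ ι' hι' hsub := by
    obtain ⟨z, hz⟩ := hsub (mem_range_leafInclusion B p)
    have hc : Continuous fun z ↦ ofManifold B (ι' z) := continuous_iff_continuousAt.2 fun z ↦
      continuousAt_ofManifold B (hι'.smooth z) (.of_forall fun y w ↦ by
        rw [← hι'.tangent y]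
        exact ⟨w, rfl⟩)
    have hconn := (isPreconnected_range hc).subset_connectedComponent (x := ofManifold B p)
      ⟨z, congrArg (ofManifold B) hz⟩
    rw [range_leafInclusion]
    rintro _ ⟨y, rfl⟩
    exact ⟨ofManifold B (ι' y), hconn ⟨y, rfl⟩, rfl⟩

end LeafSpace

end Plaques

section Adapted

variable {E : Type*} [NormedAddCommGroup E] [NormedSpace ℝ E] [FiniteDimensional ℝ E]
  {H : Type*} [TopologicalSpace H] {I : ModelWithCorners ℝ E H} [I.Boundaryless]
  {M : Type u} [TopologicalSpace M] [ChartedSpace H M] [IsManifold I ∞ M]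

/-- Linear coordinates on the model space and sections of `D` that span `D p`, whose values at `p`
are the first `r` coordinate vectors. -/
structure AdaptedFrame (D : ∀ p : M, Submodule ℝ (TangentSpace I p)) (r : ℕ) (p : M) where
  C : Submodule ℝ E
  P : E ≃L[ℝ] EuclideanSpace ℝ (Fin r) × C
  X : Fin r → SmoothField I M
  X_mem : ∀ i q, X i q ∈ D q
  X_self : ∀ i, P (mvfderiv I (extChartAt I p) p (X i p)) = (EuclideanSpace.single i 1, 0)

lemma nonempty_adaptedFrame {D : ∀ p : M, Submodule ℝ (TangentSpace I p)} {r : ℕ} {p : M}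
    (hrank : Module.finrank ℝ (D p) = r)
    (hsec : ∀ v ∈ D p, ∃ X : SmoothField I M, (∀ q, X q ∈ D q) ∧ X p = v) :
    Nonempty (AdaptedFrame D r p) := by
  let χ' : TangentSpace I p →ₗ[ℝ] E := (mvfderiv I (extChartAt I p) p).toLinearMap
  have hinj : Function.Injective χ' := mvfderiv_extChartAt_injective (mem_chart_source H p)
  let D₀ : Submodule ℝ E := (D p).map χ'
  obtain ⟨C, hC⟩ := Submodule.exists_isCompl D₀
  have hfin : Module.finrank ℝ D₀ = Module.finrank ℝ (EuclideanSpace ℝ (Fin r)) := by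
    rw [finrank_euclideanSpace_fin, ← hrank]
    exact (Submodule.equivMapOfInjective χ' hinj (D p)).finrank_eq.symm
  let e₀ : D₀ ≃ₗ[ℝ] EuclideanSpace ℝ (Fin r) := LinearEquiv.ofFinrankEq _ _ hfin
  let P := ((Submodule.prodEquivOfIsCompl D₀ C hC).symm.trans
    (e₀.prodCongr (LinearEquiv.refl ℝ C))).toContinuousLinearEquiv
  have hP : ∀ d : D₀, P d = (e₀ d, 0) := fun d ↦ by
    change (e₀.prodCongr (LinearEquiv.refl ℝ C)) ((Submodule.prodEquivOfIsCompl D₀ C hC).symm d) = _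
    rw [Submodule.prodEquivOfIsCompl_symm_apply_left]
    rfl
  have hX : ∀ i : Fin r, ∃ X : SmoothField I M, (∀ q, X q ∈ D q) ∧
      P (mvfderiv I (extChartAt I p) p (X p)) = (EuclideanSpace.single i 1, 0) := fun i ↦ by
    obtain ⟨v, hv, hvi⟩ := (e₀.symm (EuclideanSpace.single i 1)).2
    obtain ⟨X, hX, rfl⟩ := hsec v hv
    refine ⟨X, hX, ?_⟩
    have := hP (e₀.symm (EuclideanSpace.single i 1))
    rw [← hvi, e₀.apply_symm_apply] at this
    exact this
  choose X hX hX' using hX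
  exact ⟨⟨C, P, X, hX, hX'⟩⟩

namespace AdaptedFrame

variable {D : ∀ p : M, Submodule ℝ (TangentSpace I p)} {r : ℕ} {p : M} (F : AdaptedFrame D r p)

/-- The coordinates. -/
noncomputable def coord (q : M) : EuclideanSpace ℝ (Fin r) × F.C := F.P (extChartAt I p q)

/-- The inverse of the coordinates. -/
noncomputable def inv (e : EuclideanSpace ℝ (Fin r) × F.C) : M := (extChartAt I p).symm (F.P.symm e)

/-- The first component of the coordinates. -/
noncomputable def fst (q : M) : EuclideanSpace ℝ (Fin r) := (F.coord q).1

/-- The second component of the coordinates. -/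
noncomputable def snd (q : M) : F.C := (F.coord q).2

lemma inv_coord {q : M} (hq : q ∈ (chartAt H p).source) : F.inv (F.coord q) = q := by
  unfold inv coord
  rw [F.P.symm_apply_apply]
  exact (extChartAt I p).left_inv (by rwa [extChartAt_source])

lemma coord_inv {e : EuclideanSpace ℝ (Fin r) × F.C} (he : F.P.symm e ∈ (extChartAt I p).target) :
    F.coord (F.inv e) = e := by
  unfold inv coord
  rw [(extChartAt I p).right_inv he, F.P.apply_symm_apply]

lemma contMDiffAt_coord {q : M} (hq : q ∈ (chartAt H p).source) :
    ContMDiffAt I 𝓘(ℝ, EuclideanSpace ℝ (Fin r) × F.C) ∞ F.coord q :=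
  ContMDiffAt.comp q F.P.contDiff.contMDiff.contMDiffAt (contMDiffAt_extChartAt' hq)

lemma contMDiffAt_fst {q : M} (hq : q ∈ (chartAt H p).source) :
    ContMDiffAt I (𝓡 r) ∞ F.fst q :=
  ContMDiffAt.comp (I' := 𝓘(ℝ, EuclideanSpace ℝ (Fin r) × F.C)) q
    (contDiff_fst.contMDiff.contMDiffAt) (F.contMDiffAt_coord hq)

lemma contMDiffAt_snd {q : M} (hq : q ∈ (chartAt H p).source) :
    ContMDiffAt I 𝓘(ℝ, F.C) ∞ F.snd q :=
  ContMDiffAt.comp (I' := 𝓘(ℝ, EuclideanSpace ℝ (Fin r) × F.C)) q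
    (contDiff_snd.contMDiff.contMDiffAt) (F.contMDiffAt_coord hq)

lemma contMDiffAt_inv {e : EuclideanSpace ℝ (Fin r) × F.C}
    (he : F.P.symm e ∈ (extChartAt I p).target) :
    ContMDiffAt 𝓘(ℝ, EuclideanSpace ℝ (Fin r) × F.C) I ∞ F.inv e :=
  ContMDiffAt.comp e ((contMDiffOn_extChartAt_symm (n := ∞) p).contMDiffAt
    (extChartAt_target_mem_nhds' he)) F.P.symm.contDiff.contMDiff.contMDiffAt

lemma mvfderiv_coord {q : M} (hq : q ∈ (chartAt H p).source) (v : TangentSpace I q) :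
    mvfderiv I F.coord q v = F.P (mvfderiv I (extChartAt I p) q v) := by
  have h := mvfderiv_comp_apply' (I := 𝓘(ℝ, E)) (F := F.P) (f := extChartAt I p) (x := q)
    (F.P.contDiff.contMDiff.contMDiffAt.mdifferentiableAt (n := ∞) (by simp))
    (mdifferentiableAt_extChartAt' hq) v
  refine h.trans ((mvfderiv_eq_fderiv _ _ _).trans ?_)
  rw [F.P.fderiv]
  rfl

lemma mvfderiv_coord_injective {q : M} (hq : q ∈ (chartAt H p).source) :
    Function.Injective (mvfderiv I F.coord q) := fun v w h ↦ by
  rw [F.mvfderiv_coord hq, F.mvfderiv_coord hq] at h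
  exact mvfderiv_extChartAt_injective hq (F.P.injective h)

lemma mvfderiv_fst {q : M} (hq : q ∈ (chartAt H p).source) (v : TangentSpace I q) :
    mvfderiv I F.fst q v = (mvfderiv I F.coord q v).1 := by
  have h := mvfderiv_comp_apply' (I := 𝓘(ℝ, EuclideanSpace ℝ (Fin r) × F.C)) (F := Prod.fst)
    (f := F.coord) (x := q) (contDiff_fst.contMDiff.contMDiffAt.mdifferentiableAt (n := ∞) (by simp))
    ((F.contMDiffAt_coord hq).mdifferentiableAt (by simp)) v
  refine h.trans ((mvfderiv_eq_fderiv _ _ _).trans ?_)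
  rw [fderiv_fst]
  rfl

lemma mvfderiv_snd {q : M} (hq : q ∈ (chartAt H p).source) (v : TangentSpace I q) :
    mvfderiv I F.snd q v = (mvfderiv I F.coord q v).2 := by
  have h := mvfderiv_comp_apply' (I := 𝓘(ℝ, EuclideanSpace ℝ (Fin r) × F.C)) (F := Prod.snd)
    (f := F.coord) (x := q) (contDiff_snd.contMDiff.contMDiffAt.mdifferentiableAt (n := ∞) (by simp))
    ((F.contMDiffAt_coord hq).mdifferentiableAt (by simp)) v
  refine h.trans ((mvfderiv_eq_fderiv _ _ _).trans ?_)
  rw [fderiv_snd]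
  rfl

/-- The combination of the frame with given coefficients. -/
noncomputable def comb (q : M) (a : EuclideanSpace ℝ (Fin r)) : TangentSpace I q :=
  ∑ i, a i • F.X i q

lemma comb_mem (q : M) (a : EuclideanSpace ℝ (Fin r)) : F.comb q a ∈ D q :=
  Submodule.sum_mem _ fun i _ ↦ Submodule.smul_mem _ _ (F.X_mem i q)

/-- The first components of the frame. -/
noncomputable def left (q : M) : EuclideanSpace ℝ (Fin r) →L[ℝ] EuclideanSpace ℝ (Fin r) :=
  ∑ i, (EuclideanSpace.proj i : EuclideanSpace ℝ (Fin r) →L[ℝ] ℝ).smulRight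
    (mvfderiv I F.fst q (F.X i q))

/-- The second components of the frame. -/
noncomputable def right (q : M) : EuclideanSpace ℝ (Fin r) →L[ℝ] F.C :=
  ∑ i, (EuclideanSpace.proj i : EuclideanSpace ℝ (Fin r) →L[ℝ] ℝ).smulRight
    (mvfderiv I F.snd q (F.X i q))

lemma left_apply (q : M) (a : EuclideanSpace ℝ (Fin r)) :
    F.left q a = mvfderiv I F.fst q (F.comb q a) := by
  unfold left comb
  rw [map_sum, sum_apply]
  exact Finset.sum_congr rfl fun i _ ↦ (map_smul (mvfderiv I F.fst q) (a i) _).symm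

lemma right_apply (q : M) (a : EuclideanSpace ℝ (Fin r)) :
    F.right q a = mvfderiv I F.snd q (F.comb q a) := by
  unfold right comb
  rw [map_sum, sum_apply]
  exact Finset.sum_congr rfl fun i _ ↦ (map_smul (mvfderiv I F.snd q) (a i) _).symm

lemma left_self : F.left p = 1 := by
  ext a : 1
  have h : ∀ i, mvfderiv I F.fst p (F.X i p) = EuclideanSpace.single i 1 := fun i ↦ by
    rw [F.mvfderiv_fst (mem_chart_source H p), F.mvfderiv_coord (mem_chart_source H p), F.X_self]
  unfold left
  simp only [h]
  ext j
  simp [Pi.single_apply]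

lemma contMDiffAt_left {q : M} (hq : q ∈ (chartAt H p).source) : CMDiffAt ∞ F.left q := by
  refine contMDiffAt_clm_of_apply fun a ↦ ?_
  have : (fun q ↦ F.left q a) = fun q ↦ ∑ i, a i • mvfderiv I F.fst q (F.X i q) := by
    ext q : 1
    unfold left
    rw [sum_apply]
    rfl
  rw [this]
  refine ContMDiffAt.sum fun i _ ↦ ?_
  exact (contMDiffAt_const (I := I) (I' := 𝓘(ℝ, ℝ)) (c := a i)).smul
    (ContMDiffAt.mvfderiv_vectorField le_rfl (F.contMDiffAt_fst hq) ((F.X i).contMDiffAt q))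

lemma contMDiffAt_right {q : M} (hq : q ∈ (chartAt H p).source) :
    ContMDiffAt I 𝓘(ℝ, EuclideanSpace ℝ (Fin r) →L[ℝ] F.C) ∞ F.right q := by
  refine contMDiffAt_clm_of_apply fun a ↦ ?_
  have : (fun q ↦ F.right q a) = fun q ↦ ∑ i, a i • mvfderiv I F.snd q (F.X i q) := by
    ext q : 1
    unfold right
    rw [sum_apply]
    rfl
  rw [this]
  refine ContMDiffAt.sum fun i _ ↦ ?_
  exact (contMDiffAt_const (I := I) (I' := 𝓘(ℝ, ℝ)) (c := a i)).smul
    (ContMDiffAt.mvfderiv_vectorField le_rfl (F.contMDiffAt_snd hq) ((F.X i).contMDiffAt q))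

/-- The points near `p` where the distribution is a graph over the first `r` coordinates. -/
def good : Set M := (chartAt H p).source ∩ F.left ⁻¹' {A | IsUnit A}

lemma isOpen_good : IsOpen F.good :=
  ContinuousOn.isOpen_inter_preimage
    (fun _ hq ↦ (F.contMDiffAt_left hq).continuousAt.continuousWithinAt) (chartAt H p).open_source
    Units.isOpen

lemma mem_good : p ∈ F.good := ⟨mem_chart_source H p, by simp [F.left_self]⟩

/-- The linear map with graph `D q`. -/
noncomputable def slope (q : M) : EuclideanSpace ℝ (Fin r) →L[ℝ] F.C :=
  (F.right q).comp (Ring.inverse (F.left q))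

lemma contMDiffAt_ringInverse_left {q : M} (hq : q ∈ F.good) :
    CMDiffAt ∞ (fun q ↦ Ring.inverse (F.left q)) q := by
  obtain ⟨A, hA⟩ : IsUnit (F.left q) := hq.2
  have h := contDiffAt_ringInverse ℝ (n := ∞) A
  rw [hA] at h
  exact ContMDiffAt.comp q h.contMDiffAt (F.contMDiffAt_left hq.1)

lemma contMDiffAt_slope {q : M} (hq : q ∈ F.good) :
    ContMDiffAt I 𝓘(ℝ, EuclideanSpace ℝ (Fin r) →L[ℝ] F.C) ∞ F.slope q :=
  (F.contMDiffAt_right hq.1).clm_comp (F.contMDiffAt_ringInverse_left hq)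

lemma ringInverse_left_apply {q : M} (hq : q ∈ F.good) (a : EuclideanSpace ℝ (Fin r)) :
    Ring.inverse (F.left q) (F.left q a) = a :=
  congrArg (fun A : EuclideanSpace ℝ (Fin r) →L[ℝ] EuclideanSpace ℝ (Fin r) ↦ A a)
    (Ring.inverse_mul_cancel _ hq.2)

lemma left_ringInverse_apply {q : M} (hq : q ∈ F.good) (a : EuclideanSpace ℝ (Fin r)) :
    F.left q (Ring.inverse (F.left q) a) = a :=
  congrArg (fun A : EuclideanSpace ℝ (Fin r) →L[ℝ] EuclideanSpace ℝ (Fin r) ↦ A a)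
    (Ring.mul_inverse_cancel _ hq.2)

/-- The sections of the distribution that project to constant vectors. -/
noncomputable def lift (a : EuclideanSpace ℝ (Fin r)) (q : M) : TangentSpace I q :=
  F.comb q (Ring.inverse (F.left q) a)

lemma lift_mem (a : EuclideanSpace ℝ (Fin r)) (q : M) : F.lift a q ∈ D q := F.comb_mem q _

lemma mvfderiv_fst_lift {q : M} (hq : q ∈ F.good) (a : EuclideanSpace ℝ (Fin r)) :
    mvfderiv I F.fst q (F.lift a q) = a := by
  unfold lift
  rw [← F.left_apply, F.left_ringInverse_apply hq]

lemma mvfderiv_snd_lift (q : M) (a : EuclideanSpace ℝ (Fin r)) :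
    mvfderiv I F.snd q (F.lift a q) = F.slope q a := by
  unfold lift
  rw [← F.right_apply]
  rfl

lemma mvfderiv_coord_lift {q : M} (hq : q ∈ F.good) (a : EuclideanSpace ℝ (Fin r)) :
    mvfderiv I F.coord q (F.lift a q) = (a, F.slope q a) :=
  Prod.ext ((F.mvfderiv_fst hq.1 _).symm.trans (F.mvfderiv_fst_lift hq a))
    ((F.mvfderiv_snd hq.1 _).symm.trans (F.mvfderiv_snd_lift q a))

lemma contMDiffAt_lift {q : M} (hq : q ∈ F.good) (a : EuclideanSpace ℝ (Fin r)) :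
    CMDiffAt ∞ (T% (fun q ↦ F.lift a q)) q := by
  refine ContMDiffAt.sum_section (s := Finset.univ)
    (t := fun i q ↦ (Ring.inverse (F.left q) a) i • F.X i q) fun i _ ↦
    ContMDiffAt.smul_section (s := fun q ↦ F.X i q)
      (f := fun q ↦ (Ring.inverse (F.left q) a : EuclideanSpace ℝ (Fin r)) i) ?_
      ((F.X i).contMDiffAt q)
  have h := (F.contMDiffAt_ringInverse_left hq).clm_apply (contMDiffAt_const (c := a))
  exact ContMDiffAt.comp (I' := 𝓡 r) q
    (EuclideanSpace.proj (𝕜 := ℝ) i).contDiff.contMDiff.contMDiffAt h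

lemma mem_iff (hrank : ∀ q, Module.finrank ℝ (D q) = r) {q : M} (hq : q ∈ F.good)
    (v : TangentSpace I q) :
    v ∈ D q ↔ mvfderiv I F.snd q v = F.slope q (mvfderiv I F.fst q v) := by
  constructor
  · intro hv
    let S : EuclideanSpace ℝ (Fin r) →ₗ[ℝ] D q :=
      { toFun := fun a ↦ ⟨F.comb q a, F.comb_mem q a⟩
        map_add' := fun a b ↦ Subtype.ext (by simp [comb, add_smul, Finset.sum_add_distrib])
        map_smul' := fun c a ↦ Subtype.ext (by simp [comb, mul_smul, Finset.smul_sum]) }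
    have hS : Function.Injective S := fun a b hab ↦ by
      have h := congrArg (fun v : D q ↦ mvfderiv I F.fst q v) hab
      have h' : mvfderiv I F.fst q (F.comb q a) = mvfderiv I F.fst q (F.comb q b) := h
      rw [← F.left_apply, ← F.left_apply] at h'
      rw [← F.ringInverse_left_apply hq a, h', F.ringInverse_left_apply hq]
    have : FiniteDimensional ℝ (D q) := inferInstance
    obtain ⟨a, ha⟩ := (LinearMap.injective_iff_surjective_of_finrank_eq_finrank
      (by rw [hrank, finrank_euclideanSpace_fin])).1 hS ⟨v, hv⟩
    have ha' : F.comb q a = v := congrArg Subtype.val ha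
    rw [← ha', ← F.left_apply, ← F.right_apply]
    unfold slope
    rw [ContinuousLinearMap.comp_apply, F.ringInverse_left_apply hq]
  · intro h
    have : v = F.lift (mvfderiv I F.fst q v) q := by
      refine F.mvfderiv_coord_injective hq.1 ?_
      rw [F.mvfderiv_coord_lift hq, ← h, F.mvfderiv_fst hq.1, F.mvfderiv_snd hq.1]
    rw [this]
    exact F.lift_mem _ q

end AdaptedFrame

end Adapted

section PlaqueExistence

variable {E : Type*} [NormedAddCommGroup E] [NormedSpace ℝ E] [FiniteDimensional ℝ E]
  {H : Type*} [TopologicalSpace H] {I : ModelWithCorners ℝ E H} [I.Boundaryless]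
  {M : Type u} [TopologicalSpace M] [ChartedSpace H M] [IsManifold I ∞ M]

/-- A distribution closed under brackets of smooth sections. -/
def IsInvolutive (D : ∀ p : M, Submodule ℝ (TangentSpace I p)) : Prop :=
  ∀ (q : M) (X Y : ∀ p : M, TangentSpace I p), CMDiffAt ∞ (T% X) q → CMDiffAt ∞ (T% Y) q →
    (∀ᶠ q' in 𝓝 q, X q' ∈ D q') → (∀ᶠ q' in 𝓝 q, Y q' ∈ D q') → mlieBracket I X Y q ∈ D q

namespace AdaptedFrame

variable {D : ∀ p : M, Submodule ℝ (TangentSpace I p)} {r : ℕ} {p : M} (F : AdaptedFrame D r p)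

/-- The slope of the distribution in coordinates. -/
noncomputable def coordSlope (e : EuclideanSpace ℝ (Fin r) × F.C) :
    EuclideanSpace ℝ (Fin r) →L[ℝ] F.C := F.slope (F.inv e)

/-- The coordinate domain where the distribution is a graph. -/
def coordGood : Set (EuclideanSpace ℝ (Fin r) × F.C) :=
  {e | F.P.symm e ∈ (extChartAt I p).target ∧ F.inv e ∈ F.good}

lemma isOpen_coordGood : IsOpen F.coordGood := by
  rw [isOpen_iff_mem_nhds]
  rintro e ⟨he, he'⟩
  have h1 : ∀ᶠ e in 𝓝 e, F.P.symm e ∈ (extChartAt I p).target :=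
    F.P.symm.continuous.continuousAt.eventually (extChartAt_target_mem_nhds' he)
  have h2 : ∀ᶠ e in 𝓝 e, F.inv e ∈ F.good :=
    (F.contMDiffAt_inv he).continuousAt.eventually (F.isOpen_good.mem_nhds he')
  exact h1.and h2

lemma coord_mem_coordGood {q : M} (hq : q ∈ F.good) : F.coord q ∈ F.coordGood := by
  refine ⟨?_, by rwa [F.inv_coord hq.1]⟩
  unfold coord
  rw [F.P.symm_apply_apply]
  exact (extChartAt I p).map_source (by rw [extChartAt_source]; exact hq.1)

lemma contDiffAt_coordSlope {e : EuclideanSpace ℝ (Fin r) × F.C} (he : e ∈ F.coordGood) :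
    ContDiffAt ℝ ∞ F.coordSlope e :=
  contMDiffAt_iff_contDiffAt.1
    (ContMDiffAt.comp e (F.contMDiffAt_slope he.2) (F.contMDiffAt_inv he.1))

lemma mvfderiv_slope {q : M} (hq : q ∈ F.good) (b : EuclideanSpace ℝ (Fin r))
    (v : TangentSpace I q) : mvfderiv I (fun q ↦ F.slope q b) q v =
      fderiv ℝ F.coordSlope (F.coord q) (mvfderiv I F.coord q v) b := by
  have h1 : (fun q ↦ F.slope q b) =ᶠ[𝓝 q] fun q ↦ F.coordSlope (F.coord q) b := by
    filter_upwards [(chartAt H p).open_source.mem_nhds hq.1] with q' hq'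
    unfold coordSlope
    rw [F.inv_coord hq']
  have hd : DifferentiableAt ℝ F.coordSlope (F.coord q) :=
    (F.contDiffAt_coordSlope (F.coord_mem_coordGood hq)).differentiableAt (by simp)
  have hd' : HasFDerivAt (fun e ↦ F.coordSlope e b)
      ((fderiv ℝ F.coordSlope (F.coord q)).flip b) (F.coord q) := by
    simpa using hd.hasFDerivAt.clm_apply (hasFDerivAt_const b (F.coord q))
  rw [h1.mvfderiv_eq]
  have h := mvfderiv_comp_apply' (I := 𝓘(ℝ, EuclideanSpace ℝ (Fin r) × F.C))
    (F := fun e ↦ F.coordSlope e b) (f := F.coord) (x := q)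
    (mdifferentiableAt_iff_differentiableAt.2 hd'.differentiableAt)
    ((F.contMDiffAt_coord hq.1).mdifferentiableAt (by simp)) v
  refine h.trans ((mvfderiv_eq_fderiv _ _ _).trans ?_)
  rw [hd'.fderiv]
  rfl

lemma integrable (hrank : ∀ q, Module.finrank ℝ (D q) = r) (hinv : IsInvolutive D)
    {e : EuclideanSpace ℝ (Fin r) × F.C} (he : e ∈ F.coordGood) (a b : EuclideanSpace ℝ (Fin r)) :
    fderiv ℝ F.coordSlope e (a, F.coordSlope e a) b =
      fderiv ℝ F.coordSlope e (b, F.coordSlope e b) a := by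
  obtain ⟨q, hq, rfl⟩ : ∃ q ∈ F.good, F.coord q = e := ⟨F.inv e, he.2, F.coord_inv he.1⟩
  have sa := F.contMDiffAt_lift hq a
  have sb := F.contMDiffAt_lift hq b
  have da := sa.mdifferentiableAt (by simp)
  have db := sb.mdifferentiableAt (by simp)
  have hW := hinv q _ _ sa sb (.of_forall (F.lift_mem a)) (.of_forall (F.lift_mem b))
  have hgood : ∀ᶠ q' in 𝓝 q, q' ∈ F.good := F.isOpen_good.mem_nhds hq
  have hc : ∀ a : EuclideanSpace ℝ (Fin r),
      ∀ᶠ q' in 𝓝 q, mvfderiv I F.fst q' (F.lift a q') = a := fun a ↦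
    hgood.mono fun q' hq' ↦ F.mvfderiv_fst_lift hq' a
  have hs : ∀ a : EuclideanSpace ℝ (Fin r),
      (fun q' ↦ mvfderiv I F.snd q' (F.lift a q')) = fun q' ↦ F.slope q' a := fun a ↦
    funext fun q' ↦ F.mvfderiv_snd_lift q' a
  have h1 := mvfderiv_mlieBracket (F.contMDiffAt_fst hq.1) da db
  rw [mvfderiv_eq_zero_of_eventually_const (hc a), mvfderiv_eq_zero_of_eventually_const (hc b),
    sub_zero] at h1
  have h2 := mvfderiv_mlieBracket (F.contMDiffAt_snd hq.1) da db
  rw [(F.mem_iff hrank hq _).1 hW, h1, map_zero, hs, hs, F.mvfderiv_slope hq, F.mvfderiv_slope hq,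
    F.mvfderiv_coord_lift hq, F.mvfderiv_coord_lift hq, eq_comm, sub_eq_zero] at h2
  have e1 : F.coordSlope (F.coord q) = F.slope q := by unfold coordSlope; rw [F.inv_coord hq.1]
  rw [e1]
  exact h2

include F in
/-- An integrable distribution has plaques. -/
theorem nonempty_plaqueChart (hrank : ∀ q, Module.finrank ℝ (D q) = r) (hinv : IsInvolutive D) :
    Nonempty (PlaqueChart D r p) := by
  have hpg := F.coord_mem_coordGood F.mem_good
  have hA := F.contDiffAt_coordSlope hpg
  obtain ⟨f, hf0, hf⟩ := exists_hasFDerivAt_of_integrable (x := F.fst p) (y := F.snd p)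
    (hA.of_le (WithTop.coe_le_coe.2 le_top))
    ((eventually_mem_set.2 (F.isOpen_coordGood.mem_nhds hpg)).mono fun e he a b ↦
      F.integrable hrank hinv he a b)
  obtain ⟨K, s, hs, hK⟩ := (hA.of_le (show (1 : ℕ∞ω) ≤ ∞ by simp)).exists_lipschitzOnWith
  obtain ⟨s', hs's, hs'o, hs'p⟩ := mem_nhds_iff.1 hs
  set W := F.coordGood ∩ s'
  have hWo : IsOpen W := F.isOpen_coordGood.inter hs'o
  have hfc : ContinuousAt f (F.fst p) := hf.self_of_nhds.continuousAt
  have hxW : ∀ᶠ x in 𝓝 (F.fst p), (x, f x) ∈ W := by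
    have : ContinuousAt (fun x ↦ (x, f x)) (F.fst p) := continuousAt_id.prodMk hfc
    have hp : (F.fst p, f (F.fst p)) ∈ W := by
      rw [hf0]
      exact ⟨hpg, hs'p⟩
    exact this.eventually (hWo.mem_nhds hp)
  obtain ⟨U, hU, hUo, hUp⟩ := mem_nhds_iff.1 (hxW.and hf.eventually_nhds)
  have hUW : ∀ x ∈ U, (x, f x) ∈ W := fun x hx ↦ (hU hx).1
  have hUf : ∀ x ∈ U, HasFDerivAt f (F.coordSlope (x, f x)) x := fun x hx ↦ (hU hx).2.self_of_nhds
  have hUs : ∀ x ∈ U, ContDiffAt ℝ ∞ f x := fun x hx ↦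
    contDiffAt_of_hasFDerivAt (F.contDiffAt_coordSlope (hUW x hx).1) (hU hx).2
  let O : Set M := F.good ∩ F.coord ⁻¹' (s' ∩ (U ×ˢ univ))
  have hO : IsOpen O := ContinuousOn.isOpen_inter_preimage
    (fun q hq ↦ (F.contMDiffAt_coord hq.1).continuousAt.continuousWithinAt) F.isOpen_good
    (hs'o.inter (hUo.prod isOpen_univ))
  let plaque : EuclideanSpace ℝ (Fin r) → M := fun x ↦ F.inv (x, f x)
  have hcoord : ∀ x ∈ U, F.coord (plaque x) = (x, f x) := fun x hx ↦ F.coord_inv (hUW x hx).1.1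
  have hplaque : ∀ x ∈ U, plaque x ∈ O := fun x hx ↦
    ⟨(hUW x hx).1.2, by rw [mem_preimage, hcoord x hx]; exact ⟨(hUW x hx).2, hx, trivial⟩⟩
  have hsm : ∀ x ∈ U, ContMDiffAt (𝓡 r) I ∞ plaque x := fun x hx ↦
    ContMDiffAt.comp (I' := 𝓘(ℝ, EuclideanSpace ℝ (Fin r) × F.C)) (g := F.inv)
      (f := fun x ↦ (x, f x)) x (F.contMDiffAt_inv (hUW x hx).1.1)
      (contDiffAt_id.prodMk (hUs x hx)).contMDiffAt
  have hdiff : ∀ q ∈ O, ContMDiffAt I 𝓘(ℝ, F.C) ∞ (fun q ↦ f (F.fst q)) q := fun q hq ↦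
    ContMDiffAt.comp q (hUs _ hq.2.2.1).contMDiffAt (F.contMDiffAt_fst hq.1.1)
  have hdf : ∀ q ∈ O, ∀ v, mvfderiv I (fun q ↦ f (F.fst q)) q v =
      F.coordSlope (F.fst q, f (F.fst q)) (mvfderiv I F.fst q v) := fun q hq v ↦ by
    have h := mvfderiv_comp_apply' (I := 𝓡 r) (F := f) (f := F.fst) (x := q)
      (mdifferentiableAt_iff_differentiableAt.2 (hUf _ hq.2.2.1).differentiableAt)
      ((F.contMDiffAt_fst hq.1.1).mdifferentiableAt (by simp)) v
    refine h.trans ((mvfderiv_eq_fderiv _ _ _).trans ?_)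
    have hq' : F.fst q ∈ U := hq.2.2.1
    exact congrArg (fun T : EuclideanSpace ℝ (Fin r) →L[ℝ] F.C ↦ T (mvfderiv I F.fst q v))
      (hUf _ hq').fderiv
  have hdc : ∀ x ∈ U, ∀ w, mvfderiv I F.coord (plaque x) (mfderiv (𝓡 r) I plaque x w) =
      (w, F.coordSlope (x, f x) w) := fun x hx w ↦ by
    have h := mvfderiv_comp_apply' (I := I) (F := F.coord) (f := plaque) (x := x)
      ((F.contMDiffAt_coord (hplaque x hx).1.1).mdifferentiableAt (by simp))
      ((hsm x hx).mdifferentiableAt (by simp)) w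
    have he : (fun x ↦ F.coord (plaque x)) =ᶠ[𝓝 x] fun x ↦ (x, f x) := by
      filter_upwards [hUo.mem_nhds hx] with y hy using hcoord y hy
    rw [he.mvfderiv_eq] at h
    refine h.symm.trans ((mvfderiv_eq_fderiv _ _ _).trans ?_)
    have hd : HasFDerivAt (fun x ↦ (x, f x)) _ x := (hasFDerivAt_id x).prodMk (hUf x hx)
    exact congrArg (fun T : EuclideanSpace ℝ (Fin r) →L[ℝ] EuclideanSpace ℝ (Fin r) × F.C ↦ T w)
      hd.fderiv
  exact ⟨{
    C := F.C
    O := O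
    U := U
    proj := F.fst
    defect := fun q ↦ F.snd q - f (F.fst q)
    plaque := plaque
    K := K
    isOpen_O := hO
    isOpen_U := hUo
    mem := ⟨F.mem_good, hs'p, hUp, trivial⟩
    defect_self := by rw [hf0, sub_self]
    contMDiffAt_proj := fun q hq ↦ F.contMDiffAt_fst hq.1.1
    contMDiffAt_defect := fun q hq ↦ (F.contMDiffAt_snd hq.1.1).sub (hdiff q hq)
    contMDiffAt_plaque := hsm
    plaque_mem := hplaque
    proj_plaque := fun x hx ↦ congrArg Prod.fst (hcoord x hx)
    defect_plaque := fun x hx ↦ by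
      have h1 : F.fst (plaque x) = x := congrArg Prod.fst (hcoord x hx)
      have h2 : F.snd (plaque x) = f x := congrArg Prod.snd (hcoord x hx)
      rw [h1, h2, sub_self]
    proj_mem := fun q hq _ ↦ hq.2.2.1
    plaque_proj := fun q hq h ↦ by
      have h1 : (F.fst q, f (F.fst q)) = F.coord q := Prod.ext rfl (sub_eq_zero.1 h).symm
      change F.inv (F.fst q, f (F.fst q)) = q
      rw [h1, F.inv_coord hq.1.1]
    range_mfderiv := fun x hx ↦ by
      have hg := (hplaque x hx).1
      have hsl : F.coordSlope (x, f x) = F.slope (plaque x) := rfl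
      have hd : ∀ w, mfderiv (𝓡 r) I plaque x w ∈ D (plaque x) := fun w ↦ by
        rw [F.mem_iff hrank hg, F.mvfderiv_fst hg.1, F.mvfderiv_snd hg.1, hdc x hx, hsl]
      refine le_antisymm ?_ fun v hv ↦ ?_
      · rintro _ ⟨w, rfl⟩
        exact hd w
      · refine ⟨mvfderiv I F.fst (plaque x) v, F.mvfderiv_coord_injective hg.1 ?_⟩
        refine (hdc x hx _).trans ?_
        rw [hsl, ← (F.mem_iff hrank hg v).1 hv, F.mvfderiv_fst hg.1, F.mvfderiv_snd hg.1]
        rfl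
    K_nonneg := K.2
    norm_le := fun q hq v hv ↦ by
      have hsl : F.slope q = F.coordSlope (F.coord q) := by
        unfold coordSlope; rw [F.inv_coord hq.1.1]
      have h1 : mvfderiv I (fun q ↦ F.snd q - f (F.fst q)) q v =
          (F.coordSlope (F.coord q) - F.coordSlope (F.fst q, f (F.fst q)))
            (mvfderiv I F.fst q v) := by
        have h := mvfderiv_fun_sub ((F.contMDiffAt_snd hq.1.1).mdifferentiableAt (by simp))
          ((hdiff q hq).mdifferentiableAt (by simp))
        rw [h, sub_apply, hdf q hq, (F.mem_iff hrank hq.1 v).1 hv, hsl]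
        rfl
      rw [h1]
      refine ContinuousLinearMap.le_of_opNorm_le _ ?_ _
      refine (hK.norm_sub_le (hs's hq.2.1) (hs's (hUW _ hq.2.2.1).2)).trans (le_of_eq ?_)
      have h2 : F.coord q - (F.fst q, f (F.fst q)) = (0, F.snd q - f (F.fst q)) :=
        Prod.ext (sub_self _) rfl
      change _ * ‖F.coord q - (F.fst q, f (F.fst q))‖ = _
      rw [h2]
      simp }⟩

end AdaptedFrame

/-- The theorem of Frobenius: there is a leaf of an involutive distribution through every point. -/
theorem exists_isLeaf {D : ∀ p : M, Submodule ℝ (TangentSpace I p)} {r : ℕ}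
    (hrank : ∀ q, Module.finrank ℝ (D q) = r) (hinv : IsInvolutive D)
    (hsec : ∀ p, ∀ v ∈ D p, ∃ X : SmoothField I M, (∀ q, X q ∈ D q) ∧ X p = v) (p : M) :
    ∃ (L : Type u) (_ : TopologicalSpace L) (_ : ChartedSpace (EuclideanSpace ℝ (Fin r)) L)
      (_ : IsManifold (𝓡 r) ∞ L) (ι : L → M), IsLeaf D r ι ∧ p ∈ range ι := by
  have h : ∀ p, Nonempty (PlaqueChart D r p) := fun p ↦ by
    obtain ⟨F⟩ := nonempty_adaptedFrame (hrank p) (hsec p)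
    exact F.nonempty_plaqueChart hrank hinv
  let B : ∀ p, PlaqueChart D r p := fun p ↦ (h p).some
  exact ⟨LeafSpace.leaf B p, inferInstance, inferInstance, inferInstance,
    LeafSpace.leafInclusion B p, LeafSpace.isLeaf_leafInclusion B p,
    LeafSpace.mem_range_leafInclusion B p⟩

end PlaqueExistence

section Product

variable {E : Type*} [NormedAddCommGroup E] [NormedSpace ℝ E] [FiniteDimensional ℝ E]
  {H : Type*} [TopologicalSpace H] {I : ModelWithCorners ℝ E H}
  {N : Type*} [TopologicalSpace N] [ChartedSpace H N] [IsManifold I ∞ N]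

/-- The vector field `A + f d/dt` on `N × ℝ`, for a vector field `A` and a function `f` along
the projection to `N`. -/
def productField (A : ∀ q : N × ℝ, TangentSpace I q.1) (f : N × ℝ → ℝ) (q : N × ℝ) :
    TangentSpace (I.prod 𝓘(ℝ, ℝ)) q :=
  (A q, f q)

/-- The vector tangent to `N × ℝ` with the given component tangent to `N`. -/
def productLift (q : N × ℝ) (v : TangentSpace I q.1) : TangentSpace (I.prod 𝓘(ℝ, ℝ)) q :=
  (v, (0 : ℝ))

lemma mdifferentiableAt_productField {A : ∀ q : N × ℝ, TangentSpace I q.1} {f : N × ℝ → ℝ}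
    {q : N × ℝ}
    (hA : MDifferentiableAt (I.prod 𝓘(ℝ, ℝ)) I.tangent
      (fun q : N × ℝ ↦ (⟨q.1, A q⟩ : TangentBundle I N)) q)
    (hf : MDifferentiableAt (I.prod 𝓘(ℝ, ℝ)) 𝓘(ℝ, ℝ) f q) :
    MDifferentiableAt (I.prod 𝓘(ℝ, ℝ)) (I.prod 𝓘(ℝ, ℝ)).tangent
      (fun q : N × ℝ ↦ (⟨q, productField A f q⟩ : TangentBundle (I.prod 𝓘(ℝ, ℝ)) (N × ℝ))) q := by
  have h1 : MDifferentiableAt (I.prod 𝓘(ℝ, ℝ)) 𝓘(ℝ, ℝ).tangent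
      (fun q : N × ℝ ↦ (⟨q.2, f q⟩ : TangentBundle 𝓘(ℝ, ℝ) ℝ)) q := by
    rw [mdifferentiableAt_totalSpace]
    refine ⟨mdifferentiableAt_snd, ?_⟩
    refine hf.congr_of_eventuallyEq (Eventually.of_forall fun q' ↦ ?_)
    simp
  have h2 := (contMDiff_equivTangentBundleProd_symm (I := I) (M := N) (I' := 𝓘(ℝ, ℝ)) (M' := ℝ)
    (n := 1)).mdifferentiable (by simp)
  exact (h2 _).comp q (hA.prodMk h1)

lemma mdifferentiableAt_fst_apply {Ξ : ∀ q : N × ℝ, TangentSpace (I.prod 𝓘(ℝ, ℝ)) q} {q : N × ℝ}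
    (hΞ : MDiffAt (T% Ξ) q) : MDifferentiableAt (I.prod 𝓘(ℝ, ℝ)) I.tangent
      (fun q : N × ℝ ↦ (⟨q.1, (Ξ q).1⟩ : TangentBundle I N)) q := by
  have h := (contMDiff_equivTangentBundleProd (I := I) (M := N) (I' := 𝓘(ℝ, ℝ)) (M' := ℝ)
    (n := 1)).mdifferentiable (by simp)
  exact (mdifferentiableAt_fst).comp q ((h _).comp q hΞ)

lemma mdifferentiableAt_snd_apply {Ξ : ∀ q : N × ℝ, TangentSpace (I.prod 𝓘(ℝ, ℝ)) q} {q : N × ℝ}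
    (hΞ : MDiffAt (T% Ξ) q) : MDifferentiableAt (I.prod 𝓘(ℝ, ℝ)) 𝓘(ℝ, ℝ) (fun q ↦ (Ξ q).2) q := by
  have h := (contMDiff_equivTangentBundleProd (I := I) (M := N) (I' := 𝓘(ℝ, ℝ)) (M' := ℝ)
    (n := 1)).mdifferentiable (by simp)
  have h1 := (mdifferentiableAt_snd).comp q ((h _).comp q hΞ)
  refine (mdifferentiableAt_totalSpace _ _).1 h1 |>.2.congr_of_eventuallyEq
    (Eventually.of_forall fun q' ↦ ?_)
  simp [equivTangentBundleProd]

lemma mdifferentiableAt_sub_smul_along {A B : ∀ q : N × ℝ, TangentSpace I q.1} {f : N × ℝ → ℝ}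
    {q : N × ℝ}
    (hA : MDifferentiableAt (I.prod 𝓘(ℝ, ℝ)) I.tangent
      (fun q : N × ℝ ↦ (⟨q.1, A q⟩ : TangentBundle I N)) q)
    (hB : MDifferentiableAt (I.prod 𝓘(ℝ, ℝ)) I.tangent
      (fun q : N × ℝ ↦ (⟨q.1, B q⟩ : TangentBundle I N)) q)
    (hf : MDifferentiableAt (I.prod 𝓘(ℝ, ℝ)) 𝓘(ℝ, ℝ) f q) :
    MDifferentiableAt (I.prod 𝓘(ℝ, ℝ)) I.tangent
      (fun q : N × ℝ ↦ (⟨q.1, A q - f q • B q⟩ : TangentBundle I N)) q := by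
  rw [mdifferentiableAt_totalSpace] at hA hB ⊢
  refine ⟨hA.1, (hA.2.sub (hf.smul hB.2)).congr_of_eventuallyEq ?_⟩
  have h : ∀ᶠ q' : N × ℝ in 𝓝 q, q'.1 ∈ (chartAt H q.1).source :=
    continuous_fst.continuousAt.eventually
      ((chartAt H q.1).open_source.mem_nhds (mem_chart_source H _))
  filter_upwards [h] with q' hq'
  have hl : ∀ v : TangentSpace I q'.1,
      (trivializationAt E (TangentSpace I : N → Type _) q.1 ⟨q'.1, v⟩).2 =
      (trivializationAt E (TangentSpace I : N → Type _) q.1).continuousLinearMapAt ℝ q'.1 v :=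
    fun v ↦ by
      rw [Trivialization.continuousLinearMapAt_apply, Trivialization.linearMapAt_apply, if_pos]
      exact hq'
  rw [hl, map_sub, map_smul, ← hl, ← hl]
  rfl

lemma AlmostContactStructure.preservesMDiffAt_J (S : AlmostContactStructure I N) (q : N × ℝ) :
    PreservesMDiffAt (I := I.prod 𝓘(ℝ, ℝ)) S.J q := by
  intro Ξ hΞ
  have h1 := mdifferentiableAt_fst_apply hΞ
  have h2 := mdifferentiableAt_snd_apply hΞ
  have hfst : MDifferentiableAt (I.prod 𝓘(ℝ, ℝ)) I (Prod.fst : N × ℝ → N) q := mdifferentiableAt_fst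
  have hφ := MDifferentiableAt.clm_bundle_apply
    (((S.φ.contMDiff q.1).mdifferentiableAt (by simp)).comp q hfst) h1
  have hα := MDifferentiableAt.clm_bundle_apply (E₁ := (TangentSpace I : N → Type _))
    (E₂ := Bundle.Trivial N ℝ)
    (((S.α.smooth q.1).mdifferentiableAt (by simp)).comp q hfst) h1
  have hZ := ((S.Z.mdifferentiableAt q.1)).comp q hfst
  have hα' := ((mdifferentiableAt_totalSpace _ _).1 hα).2
  exact mdifferentiableAt_productField (mdifferentiableAt_sub_smul_along hφ hZ h2) hα'

lemma AlmostContactStructure.J_apply (S : AlmostContactStructure I N) {q : N × ℝ}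
    (v : TangentSpace I q.1) (c : ℝ) :
    S.J q (v, c) = (S.φ q.1 v - c • S.Z q.1, S.α q.1 v) := rfl

lemma mlieBracket_productField [I.Boundaryless] {A B : ∀ q : N, TangentSpace I q} {f g : N → ℝ}
    {q : N × ℝ} (hA : MDiffAt (T% A) q.1) (hB : MDiffAt (T% B) q.1) (hf : MDiffAt f q.1)
    (hg : MDiffAt g q.1) :
    mlieBracket (I.prod 𝓘(ℝ, ℝ)) (productField (fun q ↦ A q.1) fun q ↦ f q.1)
      (productField (fun q ↦ B q.1) fun q ↦ g q.1) q =
    (mlieBracket I A B q.1, mvfderiv I g q.1 (A q.1) - mvfderiv I f q.1 (B q.1)) := by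
  have hfst : MDifferentiableAt (I.prod 𝓘(ℝ, ℝ)) I (Prod.fst : N × ℝ → N) q := mdifferentiableAt_fst
  have hAf := mdifferentiableAt_productField (hA.comp q hfst) (hf.comp q hfst)
  have hBg := mdifferentiableAt_productField (hB.comp q hfst) (hg.comp q hfst)
  have h1 := mfderiv_mlieBracket_of_related (I' := I.prod 𝓘(ℝ, ℝ)) (I := I) (f := Prod.fst)
    contMDiffAt_fst hAf hBg hA hB
    (Eventually.of_forall fun y ↦ by rw [mfderiv_fst]; rfl)
    (Eventually.of_forall fun y ↦ by rw [mfderiv_fst]; rfl)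
  have h2 := mvfderiv_mlieBracket (I := I.prod 𝓘(ℝ, ℝ)) (F := Prod.snd)
    contMDiffAt_snd hAf hBg
  have hsnd : ∀ (q : N × ℝ) (v : TangentSpace (I.prod 𝓘(ℝ, ℝ)) q),
      mvfderiv (I.prod 𝓘(ℝ, ℝ)) (Prod.snd : N × ℝ → ℝ) q v = v.2 := fun q v ↦ by
    rw [mvfderiv_apply_eq_mfderiv, mfderiv_snd]; rfl
  simp only [hsnd] at h2
  rw [mfderiv_fst] at h1
  have hc : ∀ {g : N → ℝ} (_ : MDiffAt g q.1) (v : TangentSpace (I.prod 𝓘(ℝ, ℝ)) q),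
      mvfderiv (I.prod 𝓘(ℝ, ℝ)) (fun q : N × ℝ ↦ g q.1) q v = mvfderiv I g q.1 v.1 :=
    fun {g} hg v ↦ by
      rw [mvfderiv_comp_apply' (I := I) hg hfst, mfderiv_fst]; rfl
  refine Prod.ext h1 (h2.trans ?_)
  exact congrArg₂ (· - ·) (hc hg _) (hc hf _)

namespace AlmostContactStructure

variable (S : AlmostContactStructure I N)

lemma α_φ (p : N) (v : TangentSpace I p) : S.α p (S.φ p v) = 0 := by
  have h1 := S.φ_sq p (S.φ p v)
  have h2 := congrArg (S.φ p) (S.φ_sq p v)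
  simp only [map_add, map_neg, map_smul, S.φ_Z, smul_zero, add_zero] at h2
  rw [h2] at h1
  have h3 := congrArg (S.α p) h1
  simpa [S.α_Z] using h3

lemma J_J (q : N × ℝ) (v : TangentSpace (I.prod 𝓘(ℝ, ℝ)) q) : S.J q (S.J q v) = -v := by
  have h : ∀ (w : TangentSpace I q.1) (c : ℝ),
      S.φ q.1 (S.φ q.1 w - c • S.Z q.1) - S.α q.1 w • S.Z q.1 = -w ∧
        S.α q.1 (S.φ q.1 w - c • S.Z q.1) = -c := fun w c ↦ by
    rw [map_sub, map_smul, map_sub, map_smul, S.φ_Z, S.φ_sq, S.α_φ, S.α_Z]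
    exact ⟨by module, by simp⟩
  exact Prod.ext (h v.1 v.2).1 (h v.1 v.2).2

/-- The Nijenhuis tensor of the almost complex structure on `N × ℝ`, on vectors tangent to `N`. -/
lemma nijenhuisAt_J [I.Boundaryless] (q : N × ℝ) (v w : TangentSpace I q.1) :
    nijenhuisAt (S.preservesMDiffAt_J q) (productLift q v) (productLift q w) =
      (nijenhuisAt (S.φ.preservesMDiffAt q.1) v w + S.α.d q.1 v w • S.Z q.1,
        invarianceDefect S.α S.φ q.1 v w) := by
  obtain ⟨X, hX, rfl⟩ := exists_mdifferentiableAt_eq v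
  obtain ⟨Y, hY, rfl⟩ := exists_mdifferentiableAt_eq w
  have hφX := S.φ.mdifferentiableAt_apply hX
  have hφY := S.φ.mdifferentiableAt_apply hY
  have hαX := S.α.mdifferentiableAt_apply hX
  have hαY := S.α.mdifferentiableAt_apply hY
  have h0 : MDiffAt (fun _ : N ↦ (0 : ℝ)) q.1 := mdifferentiableAt_const
  have hfst : MDifferentiableAt (I.prod 𝓘(ℝ, ℝ)) I (Prod.fst : N × ℝ → N) q := mdifferentiableAt_fst
  have hXl := mdifferentiableAt_productField (hX.comp q hfst) (h0.comp q hfst)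
  have hYl := mdifferentiableAt_productField (hY.comp q hfst) (h0.comp q hfst)
  have hJ : ∀ X : ∀ p : N, TangentSpace I p,
      (fun q ↦ S.J q (productField (fun q ↦ X q.1) (fun _ ↦ 0) q)) =
        productField (fun q ↦ S.φ q.1 (X q.1)) (fun q ↦ S.α q.1 (X q.1)) := fun X ↦ by
    ext q
    refine Prod.ext ?_ rfl
    change S.φ q.1 (X q.1) - (0 : ℝ) • S.Z q.1 = S.φ q.1 (X q.1)
    simp
  refine (nijenhuisAt_apply (S.preservesMDiffAt_J q) hXl hYl).trans ?_
  unfold nijenhuis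
  erw [hJ, hJ, S.J_J]
  erw [mlieBracket_productField hX hY h0 h0, mlieBracket_productField hφX hφY hαX hαY,
    mlieBracket_productField hφX hY hαX h0, mlieBracket_productField hX hφY h0 hαY]
  have c0 : ∀ v : TangentSpace I q.1, mvfderiv I (fun _ : N ↦ (0 : ℝ)) q.1 v = 0 := fun v ↦
    mvfderiv_eq_zero_of_eventually_const (.of_forall fun _ ↦ rfl) v
  have e₁ := nijenhuisAt_apply (S.φ.preservesMDiffAt q.1) hX hY
  have e₂ := S.α.d_apply hX hY
  have e₃ := S.α.d_apply hφX hY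
  have e₄ := S.α.d_apply hX hφY
  have cφ : ∀ (X : ∀ p : N, TangentSpace I p) (v : TangentSpace I q.1),
      mvfderiv I (fun p ↦ S.α p (S.φ p (X p))) q.1 v = 0 := fun X v ↦
    mvfderiv_eq_zero_of_eventually_const (c := 0) (.of_forall fun _ ↦ S.α_φ _ _) v
  rw [cφ] at e₃ e₄
  refine Prod.ext ?_ ?_
  · refine Eq.trans ?_ (congrArg₂ (fun a b ↦ a + b • S.Z q.1) e₁ e₂).symm
    unfold nijenhuis
    generalize mlieBracket I X Y q.1 = b₁
    generalize mlieBracket I (fun q ↦ S.φ q (X q)) (fun q ↦ S.φ q (Y q)) q.1 = b₂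
    generalize mlieBracket I (fun q ↦ S.φ q (X q)) Y q.1 = b₃
    generalize mlieBracket I X (fun q ↦ S.φ q (Y q)) q.1 = b₄
    change -b₁ + b₂ - (S.φ q.1 b₃ - (mvfderiv I (fun _ : N ↦ (0 : ℝ)) q.1 (S.φ q.1 (X q.1))
      - mvfderiv I (fun q ↦ S.α q (X q)) q.1 (Y q.1)) • S.Z q.1) -
      (S.φ q.1 b₄ - (mvfderiv I (fun q ↦ S.α q (Y q)) q.1 (X q.1) -
        mvfderiv I (fun _ : N ↦ (0 : ℝ)) q.1 (S.φ q.1 (Y q.1))) • S.Z q.1) = _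
    rw [c0, c0, S.φ_sq]
    have key : ∀ (b₁ b₂ b₃ b₄ z : E) (r s t : ℝ),
        -b₁ + b₂ - (b₃ - (0 - s) • z) - (b₄ - (t - 0) • z) =
          -b₁ + r • z + b₂ - b₃ - b₄ + (t - s - r) • z := fun b₁ b₂ b₃ b₄ z r s t ↦ by module
    exact key _ _ _ _ _ _ _ _
  · refine Eq.trans ?_ (congrArg₂ (fun a b ↦ a + b) e₃ e₄).symm
    generalize mlieBracket I (fun q ↦ S.φ q (X q)) Y q.1 = b₃
    generalize mlieBracket I X (fun q ↦ S.φ q (Y q)) q.1 = b₄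
    change -(mvfderiv I (fun _ : N ↦ (0 : ℝ)) q.1 (X q.1)
        - mvfderiv I (fun _ : N ↦ (0 : ℝ)) q.1 (Y q.1))
      + (mvfderiv I (fun q ↦ S.α q (Y q)) q.1 (S.φ q.1 (X q.1))
        - mvfderiv I (fun q ↦ S.α q (X q)) q.1 (S.φ q.1 (Y q.1))) - S.α q.1 b₃ - S.α q.1 b₄ = _
    rw [c0, c0]
    ring

lemma exists_eq_productLift_add {q : N × ℝ} (v : TangentSpace (I.prod 𝓘(ℝ, ℝ)) q) :
    ∃ (u : TangentSpace I q.1) (c : ℝ),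
      v = productLift q u + c • S.J q (productLift q (S.Z q.1)) := by
  have h : S.J q (productLift q (S.Z q.1)) = ((0 : E), (1 : ℝ)) := by
    unfold productLift
    rw [S.J_apply, S.φ_Z, S.α_Z, zero_smul, sub_zero]
    rfl
  refine ⟨v.1, v.2, ?_⟩
  rw [h]
  refine Prod.ext ?_ ?_
  · change v.1 = v.1 + v.2 • (0 : E)
    simp
  · change v.2 = 0 + v.2 * 1
    simp

/-- Normality in terms of tensors on the manifold itself. -/
theorem isNormal_iff [I.Boundaryless] [T2Space N] : S.IsNormal ↔ ∀ (p : N) (v w : TangentSpace I p),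
    nijenhuisAt (S.φ.preservesMDiffAt p) v w + S.α.d p v w • S.Z p = 0 ∧
      invarianceDefect S.α S.φ p v w = 0 := by
  constructor
  · intro h p v w
    have h1 := h.nijenhuisAt_eq_zero (S.preservesMDiffAt_J (p, 0)) (productLift (p, 0) v)
      (productLift (p, 0) w)
    rw [S.nijenhuisAt_J (p, 0)] at h1
    exact Prod.ext_iff.1 h1
  · intro h
    refine nijenhuisVanishes_of_nijenhuisAt S.preservesMDiffAt_J fun q ↦ ?_
    set B := nijenhuisAt (S.preservesMDiffAt_J q) with hB
    have h1 : ∀ v w : TangentSpace I q.1, B (productLift q v) (productLift q w) = 0 :=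
      fun v w ↦ by
        rw [hB, S.nijenhuisAt_J]
        exact Prod.ext (h q.1 v w).1 (h q.1 v w).2
    have h3 : ∀ w, B (S.J q (productLift q (S.Z q.1))) w =
        -S.J q (B (productLift q (S.Z q.1)) w) := nijenhuisAt_apply_left _ S.J_J _
    have h2 : ∀ (v : TangentSpace (I.prod 𝓘(ℝ, ℝ)) q) (w : TangentSpace I q.1),
        B v (productLift q w) = 0 := fun v w ↦ by
      obtain ⟨u, c, rfl⟩ := S.exists_eq_productLift_add v
      rw [map_add, map_smul, add_apply, smul_apply, h1, h3, h1, map_zero,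
        neg_zero, smul_zero, add_zero]
    have h4 : ∀ w (u : TangentSpace I q.1), B (productLift q u) w = 0 := fun w u ↦ by
      rw [hB, nijenhuisAt_swap, ← hB, h2, neg_zero]
    intro v w
    obtain ⟨u, c, rfl⟩ := S.exists_eq_productLift_add v
    rw [map_add, map_smul, add_apply, smul_apply, h4, h3, h4, map_zero,
        neg_zero, smul_zero, add_zero]

end AlmostContactStructure

end Product

section Induced

variable {E : Type*} [NormedAddCommGroup E] [NormedSpace ℝ E] [FiniteDimensional ℝ E]
  {H : Type*} [TopologicalSpace H] {I : ModelWithCorners ℝ E H} [I.Boundaryless]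
  {M : Type u} [TopologicalSpace M] [ChartedSpace H M] [IsManifold I ∞ M]
  {D : ∀ p : M, Submodule ℝ (TangentSpace I p)} {r : ℕ}
  {L : Type u} [TopologicalSpace L] [ChartedSpace (EuclideanSpace ℝ (Fin r)) L]
  [IsManifold (𝓡 r) ∞ L] {ι : L → M}

/-- A vector field that an immersion maps to a smooth field along the immersion is smooth. -/
lemma contMDiffAt_of_mfderiv_eq_along {n : ℕ∞ω} (hn : n ≤ ∞) {x : L}
    (hι : ContMDiffAt (𝓡 r) I ∞ ι x) (hinj : Function.Injective (mfderiv (𝓡 r) I ι x))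
    {W : ∀ y : L, TangentSpace I (ι y)}
    (hW : ContMDiffAt (𝓡 r) I.tangent n (fun y ↦ (⟨ι y, W y⟩ : TangentBundle I M)) x)
    {Y : ∀ y : L, TangentSpace (𝓡 r) y} (h : ∀ᶠ y in 𝓝 x, mfderiv (𝓡 r) I ι y (Y y) = W y) :
    ContMDiffAt (𝓡 r) (𝓡 r).tangent n (fun y ↦ (⟨y, Y y⟩ : TangentBundle (𝓡 r) L)) x := by
  have hχ : CMDiffAt ∞ (extChartAt I (ι x)) (ι x) := contMDiffAt_extChartAt
  have hιd := hι.mdifferentiableAt (by simp)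
  have hs : ∀ᶠ y in 𝓝 x, ι y ∈ (chartAt H (ι x)).source :=
    hι.continuousAt.eventually ((chartAt H (ι x)).open_source.mem_nhds (mem_chart_source H _))
  have hd : ∀ᶠ y in 𝓝 x, MDifferentiableAt (𝓡 r) I ι y :=
    ((contMDiffAt_iff_contMDiffAt_nhds (n := 1) (by simp)).1 (hι.of_le (by simp))).mono
      fun y hy ↦ hy.mdifferentiableAt (by simp)
  refine contMDiffAt_of_mvfderiv_injective (F := fun y ↦ extChartAt I (ι x) (ι y)) hn
    (ContMDiffAt.comp x hχ hι) ?_ ?_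
  · intro v w hvw
    rw [mvfderiv_comp_apply' (hχ.mdifferentiableAt (by simp)) hιd,
      mvfderiv_comp_apply' (hχ.mdifferentiableAt (by simp)) hιd] at hvw
    exact hinj (mvfderiv_extChartAt_injective (mem_chart_source H _) hvw)
  · refine (contMDiffAt_totalSpace.1 hW).2.congr_of_eventuallyEq ?_
    filter_upwards [hs, hd, h] with y hy hyd hyY
    rw [mvfderiv_comp_apply' (mdifferentiableAt_extChartAt' hy) hyd, hyY]
    have h1 := congrArg (fun A ↦ A (W y)) (TangentBundle.continuousLinearMapAt_trivializationAt
      (I := I) hy)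
    refine h1.symm.trans ?_
    rw [Trivialization.continuousLinearMapAt_apply, Trivialization.linearMapAt_apply, if_pos]
    exact hy

lemma contMDiffAt_mfderiv_along (hι : ContMDiff (𝓡 r) I ∞ ι) {x : L}
    {Y : ∀ y : L, TangentSpace (𝓡 r) y} 
    (hY : ContMDiffAt (𝓡 r) (𝓡 r).tangent ∞ (fun y ↦ (⟨y, Y y⟩ : TangentBundle (𝓡 r) L)) x) :
    ContMDiffAt (𝓡 r) I.tangent ∞
      (fun y ↦ (⟨ι y, mfderiv (𝓡 r) I ι y (Y y)⟩ : TangentBundle I M)) x :=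
  ((hι.contMDiff_tangentMap (m := ∞) (by simp)) _).comp x hY

namespace IsIntegralManifold

/-- A left inverse of the differential of the inclusion of an integral manifold. -/
lemma exists_retraction (hι : IsIntegralManifold D r ι) (x : L) :
    ∃ ρ : TangentSpace I (ι x) →L[ℝ] TangentSpace (𝓡 r) x,
      (∀ v, ρ (mfderiv (𝓡 r) I ι x v) = v) ∧ ∀ w ∈ D (ι x), mfderiv (𝓡 r) I ι x (ρ w) = w := by
  let f : EuclideanSpace ℝ (Fin r) →L[ℝ] E := mfderiv (𝓡 r) I ι x
  have hf : Function.Injective f := hι.immersion x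
  obtain ⟨ρ, hρ⟩ := ContinuousLinearMap.HasLeftInverse.of_injective_of_finiteDimensional hf
  refine ⟨ρ, hρ, fun w hw ↦ ?_⟩
  rw [← hι.tangent] at hw
  obtain ⟨v, rfl⟩ := hw
  exact congrArg (mfderiv (𝓡 r) I ι x) (hρ v)

/-- A left inverse of the differential of the inclusion of an integral manifold. -/
noncomputable def retraction (hι : IsIntegralManifold D r ι) (x : L) :
    TangentSpace I (ι x) →L[ℝ] TangentSpace (𝓡 r) x :=
  (hι.exists_retraction x).choose

lemma retraction_mfderiv (hι : IsIntegralManifold D r ι) (x : L) (v : TangentSpace (𝓡 r) x) :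
    hι.retraction x (mfderiv (𝓡 r) I ι x v) = v :=
  (hι.exists_retraction x).choose_spec.1 v

lemma mfderiv_retraction (hι : IsIntegralManifold D r ι) {x : L} {w : TangentSpace I (ι x)}
    (hw : w ∈ D (ι x)) : mfderiv (𝓡 r) I ι x (hι.retraction x w) = w :=
  (hι.exists_retraction x).choose_spec.2 w hw

lemma mfderiv_mem (hι : IsIntegralManifold D r ι) {x : L} (v : TangentSpace (𝓡 r) x) :
    mfderiv (𝓡 r) I ι x v ∈ D (ι x) := by
  rw [← hι.tangent]
  exact ⟨v, rfl⟩

lemma t2Space [T2Space M] (hι : IsIntegralManifold D r ι) : T2Space L :=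
  .of_injective_continuous hι.injective hι.smooth.continuous

lemma contMDiffAt_retraction (hι : IsIntegralManifold D r ι) {X : SmoothField I M}
    (hX : ∀ q, X q ∈ D q) (x : L) : ContMDiffAt (𝓡 r) (𝓡 r).tangent ∞
      (fun y ↦ (⟨y, hι.retraction y (X (ι y))⟩ : TangentBundle (𝓡 r) L)) x :=
  contMDiffAt_of_mfderiv_eq_along le_rfl (hι.smooth x) (hι.immersion x)
    ((X.contMDiff (ι x)).comp x (hι.smooth x))
    (.of_forall fun y ↦ hι.mfderiv_retraction (hX (ι y)))

end IsIntegralManifold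

/-- The triple `(α, Z, φ)` restricts to an almost contact structure on the distribution `D`. -/
structure IsAlmostContactOn (D : ∀ p : M, Submodule ℝ (TangentSpace I p)) (α : OneForm I M)
    (Z : SmoothField I M) (φ : EndoField I M) : Prop where
  Z_mem : ∀ p, Z p ∈ D p
  φ_mem : ∀ p, ∀ v ∈ D p, φ p v ∈ D p
  α_Z : ∀ p, α p (Z p) = 1
  φ_Z : ∀ p, φ p (Z p) = 0
  φ_sq : ∀ p, ∀ v ∈ D p, φ p (φ p v) = -v + α p v • Z p

variable {α : OneForm I M} {Z : SmoothField I M} {φ : EndoField I M}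

/-- The almost contact structure induced on an integral manifold. -/
noncomputable def IsAlmostContactOn.induced (h : IsAlmostContactOn D α Z φ)
    (hι : IsIntegralManifold D r ι) : AlmostContactStructure (𝓡 r) L where
  α :=
    { toFun := fun x ↦ (α (ι x)).comp (mfderiv (𝓡 r) I ι x)
      smooth := fun x ↦ contMDiffAt_oneForm fun Y hY ↦ by
        have h1 := ContMDiffAt.clm_bundle_apply (E₁ := (TangentSpace I : M → Type _))
          (E₂ := Bundle.Trivial M ℝ) ((α.smooth (ι x)).comp x (hι.smooth x))
          (contMDiffAt_mfderiv_along hι.smooth hY)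
        exact (contMDiffAt_totalSpace.1 h1).2 }
  Z := ⟨fun x ↦ hι.retraction x (Z (ι x)), fun x ↦ hι.contMDiffAt_retraction h.Z_mem x⟩
  φ := ⟨fun x ↦ ((hι.retraction x).comp (φ (ι x))).comp (mfderiv (𝓡 r) I ι x),
    fun x ↦ contMDiffAt_endo fun Y hY ↦
      contMDiffAt_of_mfderiv_eq_along le_rfl (hι.smooth x) (hι.immersion x)
        (ContMDiffAt.clm_bundle_apply ((φ.contMDiff (ι x)).comp x (hι.smooth x))
          (contMDiffAt_mfderiv_along hι.smooth hY))
        (.of_forall fun y ↦ hι.mfderiv_retraction (h.φ_mem _ _ (hι.mfderiv_mem _)))⟩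
  α_Z x := (congrArg (α (ι x)) (hι.mfderiv_retraction (h.Z_mem _))).trans (h.α_Z _)
  φ_Z x := by
    refine (congrArg (fun w ↦ hι.retraction x (φ (ι x) w))
      (hι.mfderiv_retraction (h.Z_mem _))).trans ?_
    rw [h.φ_Z, map_zero]
  φ_sq x v := by
    refine (congrArg (fun w ↦ hι.retraction x (φ (ι x) w))
      (hι.mfderiv_retraction (h.φ_mem _ _ (hι.mfderiv_mem v)))).trans ?_
    rw [h.φ_sq _ _ (hι.mfderiv_mem v), map_add, map_neg, map_smul, hι.retraction_mfderiv]
    rfl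

lemma IsAlmostContactOn.isInduced (h : IsAlmostContactOn D α Z φ)
    (hι : IsIntegralManifold D r ι) : IsInduced α Z φ ι (h.induced hι) where
  α_eq _ _ := rfl
  Z_eq _ := hι.mfderiv_retraction (h.Z_mem _)
  φ_eq _ v := hι.mfderiv_retraction (h.φ_mem _ _ (hι.mfderiv_mem v))

variable {S : AlmostContactStructure (𝓡 r) L}

lemma IsIntegralManifold.exists_related (hι : IsIntegralManifold D r ι)
    (hsec : ∀ p, ∀ v ∈ D p, ∃ X : SmoothField I M, (∀ q, X q ∈ D q) ∧ X p = v)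
    {x : L} (v : TangentSpace (𝓡 r) x) :
    ∃ (X : SmoothField I M) (Y : ∀ y : L, TangentSpace (𝓡 r) y),
      MDifferentiableAt (𝓡 r) (𝓡 r).tangent (fun y ↦ (⟨y, Y y⟩ : TangentBundle (𝓡 r) L)) x ∧
      Y x = v ∧
      ∀ y, mfderiv (𝓡 r) I ι y (Y y) = X (ι y) := by
  obtain ⟨X, hX, hXv⟩ := hsec _ _ (hι.mfderiv_mem v)
  refine ⟨X, _, (hι.contMDiffAt_retraction hX x).mdifferentiableAt (by simp), ?_, fun y ↦
    hι.mfderiv_retraction (hX _)⟩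
  rw [hXv, hι.retraction_mfderiv]

namespace IsInduced

lemma d_eq (hS : IsInduced α Z φ ι S) (hι : IsIntegralManifold D r ι)
    (hsec : ∀ p, ∀ v ∈ D p, ∃ X : SmoothField I M, (∀ q, X q ∈ D q) ∧ X p = v)
    (x : L) (v w : TangentSpace (𝓡 r) x) :
    S.α.d x v w = α.d (ι x) (mfderiv (𝓡 r) I ι x v) (mfderiv (𝓡 r) I ι x w) := by
  obtain ⟨X, X', hX, rfl, hXX⟩ := hι.exists_related hsec v
  obtain ⟨Y, Y', hY, rfl, hYY⟩ := hι.exists_related hsec w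
  have hιd := (hι.smooth x).mdifferentiableAt (by simp)
  have hf : ∀ (X : SmoothField I M) {X' : ∀ y : L, TangentSpace (𝓡 r) y},
      (∀ y, mfderiv (𝓡 r) I ι y (X' y) = X (ι y)) → ∀ v,
      mvfderiv (𝓡 r) (fun y ↦ S.α y (X' y)) x v =
        mvfderiv I (fun q ↦ α q (X q)) (ι x) (mfderiv (𝓡 r) I ι x v) := fun X X' h v ↦ by
    have e : (fun y ↦ S.α y (X' y)) = fun y ↦ (fun q ↦ α q (X q)) (ι y) := by
      ext y
      rw [hS.α_eq, h]
    rw [e, mvfderiv_comp_apply' (α.mdifferentiableAt_apply (X.mdifferentiableAt _)) hιd]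
  rw [S.α.d_apply hX hY, hf Y hYY, hf X hXX, hXX, hYY,
    α.d_apply (X.mdifferentiableAt _) (Y.mdifferentiableAt _), hS.α_eq,
    mfderiv_mlieBracket_of_related (hι.smooth x) hX hY (X.mdifferentiableAt _)
      (Y.mdifferentiableAt _) (.of_forall hXX) (.of_forall hYY)]

lemma mfderiv_nijenhuisAt (hS : IsInduced α Z φ ι S) (hι : IsIntegralManifold D r ι)
    (hsec : ∀ p, ∀ v ∈ D p, ∃ X : SmoothField I M, (∀ q, X q ∈ D q) ∧ X p = v)
    (x : L) (v w : TangentSpace (𝓡 r) x) :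
    mfderiv (𝓡 r) I ι x (nijenhuisAt (S.φ.preservesMDiffAt x) v w) =
      nijenhuisAt (φ.preservesMDiffAt (ι x)) (mfderiv (𝓡 r) I ι x v) (mfderiv (𝓡 r) I ι x w) := by
  obtain ⟨X, X', hX, rfl, hXX⟩ := hι.exists_related hsec v
  obtain ⟨Y, Y', hY, rfl, hYY⟩ := hι.exists_related hsec w
  have hφX : ∀ y, mfderiv (𝓡 r) I ι y (S.φ y (X' y)) = (fun q ↦ φ q (X q)) (ι y) := fun y ↦ by
    rw [hS.φ_eq, hXX]
  have hφY : ∀ y, mfderiv (𝓡 r) I ι y (S.φ y (Y' y)) = (fun q ↦ φ q (Y q)) (ι y) := fun y ↦ by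
    rw [hS.φ_eq, hYY]
  have dX := X.mdifferentiableAt (ι x)
  have dY := Y.mdifferentiableAt (ι x)
  have dφX := φ.mdifferentiableAt_apply dX
  have dφY := φ.mdifferentiableAt_apply dY
  have dφX' := S.φ.mdifferentiableAt_apply hX
  have dφY' := S.φ.mdifferentiableAt_apply hY
  rw [hXX, hYY, nijenhuisAt_apply _ hX hY, nijenhuisAt_apply _ dX dY]
  unfold nijenhuis
  simp only [map_add, map_sub, hS.φ_eq]
  rw [mfderiv_mlieBracket_of_related (hι.smooth x) hX hY dX dY (.of_forall hXX) (.of_forall hYY),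
    mfderiv_mlieBracket_of_related (hι.smooth x) dφX' dφY' dφX dφY (.of_forall hφX)
      (.of_forall hφY),
    mfderiv_mlieBracket_of_related (hι.smooth x) dφX' hY dφX dY (.of_forall hφX) (.of_forall hYY),
    mfderiv_mlieBracket_of_related (hι.smooth x) hX dφY' dX dφY (.of_forall hXX) (.of_forall hφY)]

/-- Normality of the induced almost contact structure on an integral manifold. -/
theorem isNormal_iff [T2Space M] (hS : IsInduced α Z φ ι S) (hι : IsIntegralManifold D r ι)
    (hsec : ∀ p, ∀ v ∈ D p, ∃ X : SmoothField I M, (∀ q, X q ∈ D q) ∧ X p = v) :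
    S.IsNormal ↔ ∀ x, ∀ v ∈ D (ι x), ∀ w ∈ D (ι x),
      nijenhuisAt (φ.preservesMDiffAt (ι x)) v w + α.d (ι x) v w • Z (ι x) = 0 ∧
        invarianceDefect α φ (ι x) v w = 0 := by
  have := hι.t2Space
  have h1 : ∀ x (v w : TangentSpace (𝓡 r) x),
      mfderiv (𝓡 r) I ι x (nijenhuisAt (S.φ.preservesMDiffAt x) v w + S.α.d x v w • S.Z x) =
        nijenhuisAt (φ.preservesMDiffAt (ι x)) (mfderiv (𝓡 r) I ι x v) (mfderiv (𝓡 r) I ι x w)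
        + α.d (ι x) (mfderiv (𝓡 r) I ι x v) (mfderiv (𝓡 r) I ι x w) • Z (ι x) := fun x v w ↦ by
    rw [map_add, map_smul, hS.mfderiv_nijenhuisAt hι hsec, hS.d_eq hι hsec, hS.Z_eq]
  have h2 : ∀ x (v w : TangentSpace (𝓡 r) x), invarianceDefect S.α S.φ x v w =
      invarianceDefect α φ (ι x) (mfderiv (𝓡 r) I ι x v) (mfderiv (𝓡 r) I ι x w) := fun x v w ↦ by
    unfold invarianceDefect
    rw [hS.d_eq hι hsec, hS.d_eq hι hsec, hS.φ_eq, hS.φ_eq]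
  rw [S.isNormal_iff]
  constructor
  · intro h x v hv w hw
    rw [← hι.tangent] at hv hw
    obtain ⟨v, rfl⟩ := hv
    obtain ⟨w, rfl⟩ := hw
    have h3 := h1 x v w
    have h4 := h2 x v w
    rw [(h x v w).1, map_zero] at h3
    rw [(h x v w).2] at h4
    exact ⟨h3.symm, h4.symm⟩
  · intro h x v w
    have h3 := h x _ (hι.mfderiv_mem v) _ (hι.mfderiv_mem w)
    rw [← h1, ← h2] at h3
    exact ⟨hι.immersion x (h3.1.trans (map_zero _).symm), h3.2⟩

end IsInduced

end Induced

section Normality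

variable {E : Type*} [NormedAddCommGroup E] [NormedSpace ℝ E] [FiniteDimensional ℝ E]
  {H : Type*} [TopologicalSpace H] {I : ModelWithCorners ℝ E H} [I.Boundaryless]
  {M : Type u} [TopologicalSpace M] [ChartedSpace H M] [IsManifold I ∞ M]
  {α₁ α₂ : OneForm I M} {Z₁ Z₂ : SmoothField I M} {φ : EndoField I M}

lemma IsContactPairStructure.isAlmostContactPair {h k : ℕ}
    (hstr : IsContactPairStructure h k α₁ α₂ Z₁ Z₂ φ) : IsAlmostContactPair α₁ α₂ Z₁ Z₂ φ :=
  ⟨hstr.reeb, hstr.φ_sq, hstr.φ_Z₁, hstr.φ_Z₂, hstr.contactPair.isCompl⟩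

lemma isInvolutive_charDist (α : OneForm I M) : IsInvolutive (charDist α) :=
  fun _ _ _ hX hY h h' ↦ α.mlieBracket_mem_charDist hX hY h h'

namespace IsAlmostContactPair

lemma isAlmostContactOn (h : IsAlmostContactPair α₁ α₂ Z₁ Z₂ φ)
    (hφ : ∀ p, ∀ v ∈ charDist α₂ p, φ p v ∈ charDist α₂ p) :
    IsAlmostContactOn (charDist α₂) α₁ Z₁ φ where
  Z_mem p := mem_charDist.2 ⟨h.reeb.α₂_Z₁ p, h.reeb.dα₂_Z₁ p⟩
  φ_mem := hφ
  α_Z := h.reeb.α₁_Z₁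
  φ_Z := h.φ_Z₁
  φ_sq p v hv := by rw [h.φ_sq, (mem_charDist.1 hv).1, zero_smul, add_zero]

lemma pairTensor_of_mem {p : M} {v w : TangentSpace I p}
    (hv : v ∈ charDist α₂ p) : pairTensor α₁ α₂ Z₁ Z₂ φ p v w =
      nijenhuisAt (φ.preservesMDiffAt p) v w + α₁.d p v w • Z₁ p := by
  rw [pairTensor, (mem_charDist.1 hv).2 w, zero_smul, add_zero]

lemma pairTensor_of_mem_of_mem {p : M} {v w : TangentSpace I p}
    (hv : v ∈ charDist α₁ p) (hw : w ∈ charDist α₂ p) : pairTensor α₁ α₂ Z₁ Z₂ φ p v w =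
      nijenhuisAt (φ.preservesMDiffAt p) v w := by
  rw [pairTensor, (mem_charDist.1 hv).2 w, α₂.d_swap, (mem_charDist.1 hw).2 v]
  simp

/-- Normality of the almost contact structures induced on the leaves of one of the two
characteristic foliations. -/
lemma inducesNormalOnLeaves_iff [T2Space M] (h : IsAlmostContactPair α₁ α₂ Z₁ Z₂ φ) {r : ℕ}
    (hrank : ∀ p, Module.finrank ℝ (charDist α₂ p) = r)
    (hφ : ∀ p, ∀ v ∈ charDist α₂ p, φ p v ∈ charDist α₂ p) :
    InducesNormalOnLeaves (charDist α₂) r α₁ Z₁ φ ↔ ∀ p, ∀ v ∈ charDist α₂ p, ∀ w ∈ charDist α₂ p,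
      pairTensor α₁ α₂ Z₁ Z₂ φ p v w = 0 ∧ invarianceDefect α₁ φ p v w = 0 := by
  have hsec : ∀ p, ∀ v ∈ charDist α₂ p,
      ∃ X : SmoothField I M, (∀ q, X q ∈ charDist α₂ q) ∧ X p = v :=
    fun p v hv ↦ exists_smoothField_mem_charDist h.reeb h.isCompl hv
  constructor
  · intro hn p v hv w hw
    obtain ⟨L, _, _, _, ι, hι, x, rfl⟩ := exists_isLeaf hrank (isInvolutive_charDist α₂) hsec p
    obtain ⟨S, hS, hSn⟩ := hn L ι hι
    rw [pairTensor_of_mem hv]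
    exact (hS.isNormal_iff hι.integral hsec).1 hSn x v hv w hw
  · intro hn L _ _ _ ι hι
    refine ⟨(h.isAlmostContactOn hφ).induced hι.integral,
      (h.isAlmostContactOn hφ).isInduced hι.integral,
      (((h.isAlmostContactOn hφ).isInduced hι.integral).isNormal_iff hι.integral hsec).2
        fun x v hv w hw ↦ ?_⟩
    rw [← pairTensor_of_mem hv]
    exact hn _ v hv w hw

/-- Mixed vanishing of the Nijenhuis tensor, in terms of the tensor `[φ, φ] + dα₁ ⊗ Z₁ + dα₂ ⊗ Z₂`. -/
lemma mixed_nijenhuis_eq_zero_iff [T2Space M] (h : IsAlmostContactPair α₁ α₂ Z₁ Z₂ φ) :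
    (∀ X Y : SmoothField I M, (∀ p, X p ∈ charDist α₁ p) → (∀ p, Y p ∈ charDist α₂ p) →
      ∀ p, nijenhuis I (fun q ↦ φ q) X Y p = 0) ↔
    ∀ p, ∀ v ∈ charDist α₁ p, ∀ w ∈ charDist α₂ p, pairTensor α₁ α₂ Z₁ Z₂ φ p v w = 0 := by
  constructor
  · intro hN p v hv w hw
    rw [pairTensor_of_mem_of_mem hv hw]
    obtain ⟨X, hX, rfl⟩ := exists_smoothField_mem_charDist h.symm.reeb h.symm.isCompl hv
    obtain ⟨Y, hY, rfl⟩ := exists_smoothField_mem_charDist h.reeb h.isCompl hw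
    rw [nijenhuisAt_apply _ (X.mdifferentiableAt p) (Y.mdifferentiableAt p)]
    exact hN X Y hX hY p
  · intro hN X Y hX hY p
    rw [← nijenhuisAt_apply (φ.preservesMDiffAt p) (X.mdifferentiableAt p) (Y.mdifferentiableAt p),
      ← pairTensor_of_mem_of_mem (Z₁ := Z₁) (Z₂ := Z₂) (hX p) (hY p)]
    exact hN p _ (hX p) _ (hY p)

lemma pairTensor_eq_zero_of_isCompl (h : IsAlmostContactPair α₁ α₂ Z₁ Z₂ φ) {p : M}
    (h₁₁ : ∀ v ∈ charDist α₁ p, ∀ w ∈ charDist α₁ p, pairTensor α₁ α₂ Z₁ Z₂ φ p v w = 0)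
    (h₂₂ : ∀ v ∈ charDist α₂ p, ∀ w ∈ charDist α₂ p, pairTensor α₁ α₂ Z₁ Z₂ φ p v w = 0)
    (h₁₂ : ∀ v ∈ charDist α₁ p, ∀ w ∈ charDist α₂ p, pairTensor α₁ α₂ Z₁ Z₂ φ p v w = 0)
    (v w : TangentSpace I p) : pairTensor α₁ α₂ Z₁ Z₂ φ p v w = 0 := by
  have hdec : ∀ v : TangentSpace I p, ∃ a ∈ charDist α₁ p, ∃ b ∈ charDist α₂ p, a + b = v :=
    fun v ↦ Submodule.mem_sup.1 (by rw [(h.isCompl p).sup_eq_top]; trivial)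
  obtain ⟨a, ha, b, hb, rfl⟩ := hdec v
  obtain ⟨c, hc, d, hd, rfl⟩ := hdec w
  have h₂₁ : pairTensor α₁ α₂ Z₁ Z₂ φ p b c = 0 := by rw [pairTensor_swap, h₁₂ c hc b hb, neg_zero]
  rw [pairTensor_add_left, pairTensor_swap a, pairTensor_swap b, pairTensor_add_left,
    pairTensor_add_left, pairTensor_swap c a, pairTensor_swap d a, pairTensor_swap c b,
    pairTensor_swap d b, h₁₁ a ha c hc, h₁₂ a ha d hd, h₂₁, h₂₂ b hb d hd]
  simp

end IsAlmostContactPair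

end Normality

end ContactPair

theorem mainTheorem10 (h k : ℕ)
    {M : Type u} [TopologicalSpace M] [T2Space M] [SecondCountableTopology M]
    [ChartedSpace (EuclideanSpace ℝ (Fin (2 * h + 2 * k + 2))) M]
    [IsManifold (𝓡 (2 * h + 2 * k + 2)) ∞ M]
    (α₁ α₂ : ContactPair.OneForm (𝓡 (2 * h + 2 * k + 2)) M)
    (Z₁ Z₂ : ContactPair.SmoothField (𝓡 (2 * h + 2 * k + 2)) M)
    (φ : ContactPair.EndoField (𝓡 (2 * h + 2 * k + 2)) M)
    (hstr : ContactPair.IsContactPairStructure h k α₁ α₂ Z₁ Z₂ φ)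
    (hdec : ContactPair.IsDecomposable α₁ α₂ φ) :
    ContactPair.IsNormalContactPair α₁ α₂ Z₁ Z₂ φ ↔
      (ContactPair.InducesNormalOnLeaves (ContactPair.charDist α₂) (2 * h + 1) α₁ Z₁ φ ∧
        ContactPair.InducesNormalOnLeaves (ContactPair.charDist α₁) (2 * k + 1) α₂ Z₂ φ) ∧
      ∀ X Y : ContactPair.SmoothField (𝓡 (2 * h + 2 * k + 2)) M,
        (∀ p, X p ∈ ContactPair.charDist α₁ p) → (∀ p, Y p ∈ ContactPair.charDist α₂ p) →
          ∀ p, ContactPair.nijenhuis (𝓡 (2 * h + 2 * k + 2)) (fun q ↦ φ q) X Y p = 0 := by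
  have hp := hstr.isAlmostContactPair
  have hr := fun p ↦ (hstr.contactPair.finrank_charDist p).2
  have hr' := fun p ↦ (hstr.contactPair.finrank_charDist p).1
  rw [hp.isNormalContactPair_iff, hp.inducesNormalOnLeaves_iff hr hdec.2,
    hp.symm.inducesNormalOnLeaves_iff hr' hdec.1, hp.mixed_nijenhuis_eq_zero_iff]
  constructor
  · intro h0
    have h0' : ∀ p v w, ContactPair.pairTensor α₂ α₁ Z₂ Z₁ φ p v w = 0 := fun p v w ↦ by
      rw [ContactPair.pairTensor_comm, h0]
    exact ⟨⟨fun p v _ w _ ↦ ⟨h0 p v w, hp.invarianceDefect_eq_zero (h0 p) v w⟩,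
      fun p v _ w _ ↦ ⟨h0' p v w, hp.symm.invarianceDefect_eq_zero (h0' p) v w⟩⟩,
      fun p v _ w _ ↦ h0 p v w⟩
  · rintro ⟨⟨h₂₂, h₁₁⟩, h₁₂⟩ p
    refine hp.pairTensor_eq_zero_of_isCompl (fun v hv w hw ↦ ?_)
      (fun v hv w hw ↦ (h₂₂ p v hv w hw).1) (h₁₂ p)
    rw [ContactPair.pairTensor_comm]
    exact (h₁₁ p v hv w hw).1
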